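/- Let $n\ge 3$. Let $\mathbb H^n$ be the unit ball of $\mathbb R^n$ with the metric $b=\rho^{-2}\delta$, where $\rho(x)=\frac{1-|x|^2}{2}$ and $\delta$ is the Euclidean metric, and let $B_r(x)$ denote geodesic balls of $b$, $B_r=B_r(0)$. Let $k\ge 2$ be an integer, $\alpha\in(0,1)$, $\tau>n/2$, and $\kappa=\frac{4}{n-2}$. Let $M$ be a smooth $n$-dimensional manifold (possibly with boundary) with a Riemannian metric $g$ such that $(M,g)$ is $C^{2,\alpha}_\tau$ asymptotically hyperbolic, that is, $g\in C^{2,\alpha}_{\mathrm{loc}}(M)$ and there are a compact set $K_0\subset M$, a radius $R_0>0$ and a diffeomorphism (chart at infinity) $\Psi:M\setminus K_0\to\mathbb H^n\setminus\overline{B_{R_0}}$ such that $\Psi_*g-b\in C^{2,\alpha}_{\mathrm{loc}}$ and $$\sup_{x\in\mathbb H^n\setminus\overline{B_{R_0+1}}}\rho(x)^{-\tau}\,\|\Psi_*g-b\|_{C^{2,\alpha}(B_1(x))}<\infty .$$ Here and below $\|\cdot\|_{C^{k,\alpha}(B_1(x))}$ denotes the Euclidean $C^{k,\alpha}$ norm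 of the components in the coordinates $\xi$ with $y=x+\rho(x)\xi$, $y\in B_1(x)$. Fix such a chart and use it to identify $M\setminus K_0$ with $\mathbb H^n\setminus\overline{B_{R_0}}$. Let $\theta\in C^{k,\alpha}_\tau(M)$, that is, $\theta\in C^{k,\alpha}_{\mathrm{loc}}(M)$ and $\sup_{x\in\mathbb H^n\setminus\overline{B_{R_0+1}}}\rho(x)^{-\tau}\|\theta\circ\Psi^{-1}\|_{C^{k,\alpha}(B_1(x))}<\infty$, and set $\widehat g=e^{\kappa\theta}g$. Assume that for $h=g$ and for $h=\widehat g$ the function $(\mathrm{Scal}^{h}+n(n-1))\,\rho^{-1}$ is integrable near infinity (on the region of $M$ identified with $\mathbb H^n\setminus\overline{B_{R_0+1}}$) with respect to the volume measure of $h$. Let $\mathcal N$ be the span of the functions $V_0=\frac{1-\rho}{\rho}$ and $V_i=\frac{x^i}{\rho}$, $1\le i\le n$, on the unit ball. For $V\in\mathcal N$ and $h\in\{g,\widehat g\}$, with $e=\Psi_*h-b$, the mass functional $$\mathcal M_h(V)=\frac{1}{2(n-1)\omega_{n-1}}\lim_{\varepsilon\to0^+}\int_{\{\rho=\varepsilon\}}\Big[V\big(\mathrm{div}^b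 e-d(\mathrm{tr}_b e)\big)-e(\nabla^bV,\cdot)+(\mathrm{tr}_b e)\,dV\Big](\nu)\,d\mu^b$$ is well defined (the limit exists), where $\omega_{n-1}$ is the volume of the unit sphere $S^{n-1}$, $\nu$ is the outward $b$-unit normal of the sphere $\{\rho=\varepsilon\}$ and $d\mu^b$ is the area measure induced on it by $b$. Moreover, for every $V\in\mathcal N$ the limit on the right-hand side below exists, and $$\mathcal M_{\widehat g}(V)-\mathcal M_g(V)=\frac{\kappa}{2\omega_{n-1}}\lim_{\varepsilon\to0^+}\int_{\{\rho=\varepsilon\}}\big(\theta\,dV-V\,d\theta\big)(\nu)\,d\mu^b ,$$ where $\theta$ stands for $\theta\circ\Psi^{-1}$. -/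

import Mathlib

open Set Filter Topology MeasureTheory
open scoped Manifold ContDiff NNReal ENNReal

noncomputable section

namespace AHMass

/-- Euclidean space `ℝⁿ`. -/
abbrev Euc (n : ℕ) : Type := EuclideanSpace ℝ (Fin n)

/-- Bilinear forms on `ℝⁿ`: the values of covariant 2-tensors in Cartesian coordinates. -/
abbrev Tensor2 (n : ℕ) : Type := Euc n →L[ℝ] Euc n →L[ℝ] ℝ

/-- The `i`-th vector of the standard basis. -/
def basisVec {n : ℕ} (i : Fin n) : Euc n := EuclideanSpace.single i (1 : ℝ)

/-- The partial derivative `∂ᵢ f`. -/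
def pd {n : ℕ} (i : Fin n) (f : Euc n → ℝ) (x : Euc n) : ℝ := fderiv ℝ f x (basisVec i)

/-- The matrix of components `hᵢⱼ(x)` of a covariant 2-tensor. -/
def compMat {n : ℕ} (h : Euc n → Tensor2 n) (x : Euc n) : Matrix (Fin n) (Fin n) ℝ :=
  Matrix.of fun i j => h x (basisVec i) (basisVec j)

/-- The components `Gⁱʲ(x)` of the inverse metric. -/
def invComp {n : ℕ} (G : Euc n → Tensor2 n) (x : Euc n) : Matrix (Fin n) (Fin n) ℝ :=
  (compMat G x)⁻¹

/-! ### Riemannian geometry in Cartesian coordinates -/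

/-- The Christoffel symbol `Γᵏᵢⱼ = ½ Gᵏˡ (∂ᵢ Gⱼₗ + ∂ⱼ Gᵢₗ - ∂ₗ Gᵢⱼ)`. -/
def christoffel {n : ℕ} (G : Euc n → Tensor2 n) (k i j : Fin n) (x : Euc n) : ℝ :=
  (1 / 2) * ∑ l, invComp G x k l *
    (pd i (fun y => compMat G y j l) x + pd j (fun y => compMat G y i l) x
      - pd l (fun y => compMat G y i j) x)

/-- The Ricci tensor
`Rᵢⱼ = ∂ₖ Γᵏᵢⱼ - ∂ⱼ Γᵏᵢₖ + Γᵏₖₗ Γˡᵢⱼ - Γᵏⱼₗ Γˡᵢₖ`. -/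
def ricci {n : ℕ} (G : Euc n → Tensor2 n) (i j : Fin n) (x : Euc n) : ℝ :=
  ∑ k, (pd k (christoffel G k i j) x - pd j (christoffel G k i k) x
    + ∑ l, (christoffel G k k l x * christoffel G l i j x
      - christoffel G k j l x * christoffel G l i k x))

/-- The scalar curvature `Gⁱʲ Rᵢⱼ`. -/
def scalarCurvature {n : ℕ} (G : Euc n → Tensor2 n) (x : Euc n) : ℝ :=
  ∑ i, ∑ j, invComp G x i j * ricci G i j x

/-- The trace `tr_G e = Gⁱʲ eᵢⱼ`. -/
def traceWith {n : ℕ} (G e : Euc n → Tensor2 n) (x : Euc n) : ℝ :=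
  ∑ i, ∑ j, invComp G x i j * compMat e x i j

/-- The covariant derivative `(∇ₖ e)ᵢⱼ = ∂ₖ eᵢⱼ - Γˡₖᵢ eₗⱼ - Γˡₖⱼ eᵢₗ`, with respect to the
Levi-Civita connection of `G`. -/
def covDeriv {n : ℕ} (G e : Euc n → Tensor2 n) (k i j : Fin n) (x : Euc n) : ℝ :=
  pd k (fun y => compMat e y i j) x
    - ∑ l, (christoffel G l k i x * compMat e x l j + christoffel G l k j x * compMat e x i l)

/-- The divergence `(div_G e)ⱼ = Gᵏⁱ (∇ₖ e)ᵢⱼ`. -/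
def divWith {n : ℕ} (G e : Euc n → Tensor2 n) (j : Fin n) (x : Euc n) : ℝ :=
  ∑ k, ∑ i, invComp G x k i * covDeriv G e k i j x

/-- The components `(∇V)ⁱ = Gⁱʲ ∂ⱼ V` of the gradient. -/
def gradWith {n : ℕ} (G : Euc n → Tensor2 n) (V : Euc n → ℝ) (i : Fin n) (x : Euc n) : ℝ :=
  ∑ j, invComp G x i j * pd j V x

/-! ### The Poincaré ball model of hyperbolic space -/

/-- `ρ(x) = (1 - |x|²) / 2`. -/
def rho {n : ℕ} (x : Euc n) : ℝ := (1 - ‖x‖ ^ 2) / 2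

/-- The hyperbolic metric `b = ρ⁻² δ` (on the unit ball). -/
def hypMetric {n : ℕ} (x : Euc n) : Tensor2 n := ((rho x) ^ 2)⁻¹ • innerSL ℝ

/-- The hyperbolic distance of two points of the unit ball,
`cosh d(x,y) = 1 + |x - y|² / (2 ρ(x) ρ(y))`. -/
def hypDist {n : ℕ} (x y : Euc n) : ℝ :=
  Real.arcosh (1 + ‖x - y‖ ^ 2 / (2 * rho x * rho y))

/-- The geodesic ball `B_r(x)` of hyperbolic space. -/
def hypBall {n : ℕ} (x : Euc n) (r : ℝ) : Set (Euc n) := {y | ‖y‖ < 1 ∧ hypDist x y < r}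

/-- The exterior region `ℍⁿ \ closure B_R`, where `B_R` is the geodesic ball of radius `R` around
the origin. -/
def hypExterior (n : ℕ) (R : ℝ) : Set (Euc n) := {x | ‖x‖ < 1 ∧ R < hypDist 0 x}

/-! ### Hölder spaces -/

section Holder

variable {E F : Type*} [NormedAddCommGroup E] [NormedSpace ℝ E]
  [NormedAddCommGroup F] [NormedSpace ℝ F]

/-- `f ∈ C^{k,α}_loc(s)`, where `s` is open or, more generally, relatively open in the range of a
model with corners. -/
def LocHolderOn (k : ℕ) (α : ℝ≥0) (f : E → F) (s : Set E) : Prop :=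
  ContDiffOn ℝ k f s ∧
    ∀ y ∈ s, ∃ C : ℝ≥0, ∃ U ∈ 𝓝[s] y, HolderOnWith C α (iteratedFDerivWithin ℝ k f s) (U ∩ s)

/-- The norm `∑_{j ≤ k} sup_U |Dʲ f| + [Dᵏ f]_{α, U}` of `C^{k,α}(U)`, for functions that are `Cᵏ`
on the open set `U`. -/
def holderNormOn (k : ℕ) (α : ℝ≥0) (U : Set E) (f : E → F) : ℝ≥0∞ :=
  (∑ j ∈ Finset.range (k + 1), ⨆ y ∈ U, ‖iteratedFDeriv ℝ j f y‖ₑ)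
    + eHolderNorm α (U.domRestrict (iteratedFDeriv ℝ k f))

end Holder

/-- The coordinates `ξ ↦ x + ρ(x) ξ` around the point `x` of hyperbolic space. In these coordinates
the metric `b` is `(ρ(x) / ρ(x + ρ(x) ξ))² δ`, which on the unit geodesic ball `B_1(x)` is
comparable to `δ`, with all derivatives bounded, uniformly in `x`. -/
def normalizedCoord {n : ℕ} (x ξ : Euc n) : Euc n := x + rho x • ξ

/-- The norm of `C^{k,α}(B_1(x))` for functions, in normalized coordinates around `x`. -/
def ballNormFun {n : ℕ} (k : ℕ) (α : ℝ≥0) (x : Euc n) (f : Euc n → ℝ) : ℝ≥0∞ :=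
  holderNormOn k α (normalizedCoord x ⁻¹' hypBall x 1) (fun ξ => f (normalizedCoord x ξ))

/-- The norm of `C^{k,α}(B_1(x); S²ℍⁿ)` for covariant 2-tensors: the `C^{k,α}` norm of the
components of the tensor in normalized coordinates around `x`. -/
def ballNormTensor {n : ℕ} (k : ℕ) (α : ℝ≥0) (x : Euc n) (h : Euc n → Tensor2 n) : ℝ≥0∞ :=
  holderNormOn k α (normalizedCoord x ⁻¹' hypBall x 1)
    (fun ξ => (rho x) ^ 2 • h (normalizedCoord x ξ))

/-- The weighted norm `sup_{x ∈ ℍⁿ \ closure B_{R₀+1}} ρ(x)^{-τ} ‖f‖_{C^{k,α}(B_1(x))}`. -/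
def weightedNormFun {n : ℕ} (k : ℕ) (α : ℝ≥0) (τ R₀ : ℝ) (f : Euc n → ℝ) : ℝ≥0∞ :=
  ⨆ x ∈ hypExterior n (R₀ + 1), ENNReal.ofReal (rho x ^ (-τ)) * ballNormFun k α x f

/-- The weighted norm `sup_{x ∈ ℍⁿ \ closure B_{R₀+1}} ρ(x)^{-τ} ‖h‖_{C^{k,α}(B_1(x); S²ℍⁿ)}`. -/
def weightedNormTensor {n : ℕ} (k : ℕ) (α : ℝ≥0) (τ R₀ : ℝ) (h : Euc n → Tensor2 n) : ℝ≥0∞ :=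
  ⨆ x ∈ hypExterior n (R₀ + 1), ENNReal.ofReal (rho x ^ (-τ)) * ballNormTensor k α x h

/-! ### Asymptotically hyperbolic manifolds -/

section Manifold

variable {n : ℕ} {H : Type*} [TopologicalSpace H] (I : ModelWithCorners ℝ (Euc n) H)
  (M : Type*) [TopologicalSpace M] [ChartedSpace H M]

/-- A chart at infinity: a diffeomorphism `Ψ : M \ K₀ → ℍⁿ \ closure B_{R₀}`, with `K₀ ⊆ M` compact
and `R₀ > 0`. -/
structure ChartAtInfinity where
  /-- The compact set `K₀`. -/
  core : Set M
  isCompact_core : IsCompact core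
  /-- The radius `R₀`. -/
  radius : ℝ
  radius_pos : 0 < radius
  /-- The map `Ψ`. -/
  toHomeo : OpenPartialHomeomorph M (Euc n)
  source_eq : toHomeo.source = coreᶜ
  target_eq : toHomeo.target = hypExterior n radius
  contMDiffOn_toHomeo : ContMDiffOn I 𝓘(ℝ, Euc n) ∞ toHomeo toHomeo.source
  contMDiffOn_symm : ContMDiffOn 𝓘(ℝ, Euc n) I ∞ toHomeo.symm toHomeo.target

variable {M}

/-- `f ∈ C^{k,α}_loc(M)` for a function `f`. -/
def FunLocHolder (k : ℕ) (α : ℝ≥0) (f : M → ℝ) : Prop :=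
  ∀ p : M, LocHolderOn k α (f ∘ (extChartAt I p).symm) (extChartAt I p).target

variable [IsManifold I ∞ M]

/-- Riemannian metrics on `M`. Their regularity is a separate condition. -/
abbrev Metric (I : ModelWithCorners ℝ (Euc n) H) (M : Type*) [TopologicalSpace M]
    [ChartedSpace H M] [IsManifold I ∞ M] : Type _ :=
  Bundle.RiemannianMetric (fun p : M => TangentSpace I p)

variable {I}

/-- The pullback `F^* g` of `g` by a map `F : ℝⁿ ⊇ s → M`, as a field of bilinear forms on `ℝⁿ`:
`(F^* g)_y(v, w) = g(dF_y v, dF_y w)`. -/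
def pullback (g : Metric I M) (F : Euc n → M) (s : Set (Euc n)) (y : Euc n) : Tensor2 n :=
  ContinuousLinearMap.bilinearComp (show Tensor2 n from g.inner (F y))
    (show Euc n →L[ℝ] Euc n from mfderivWithin 𝓘(ℝ, Euc n) I F s y)
    (show Euc n →L[ℝ] Euc n from mfderivWithin 𝓘(ℝ, Euc n) I F s y)

/-- `g ∈ C^{k,α}_loc(M)`: in the charts of `M` the components of `g` are locally `C^{k,α}`. -/
def Metric.LocHolder (k : ℕ) (α : ℝ≥0) (g : Metric I M) : Prop :=
  ∀ p : M, LocHolderOn k α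
    (pullback g (extChartAt I p).symm (extChartAt I p).target) (extChartAt I p).target

/-- The push-forward `Ψ_* g` of the metric by the chart at infinity, on `ℍⁿ \ closure B_{R₀}`. -/
def pushMetric (Ψ : ChartAtInfinity I M) (g : Metric I M) : Euc n → Tensor2 n :=
  pullback g Ψ.toHomeo.symm Ψ.toHomeo.target

/-- The difference `e = Ψ_* g - b`. -/
def metricError (Ψ : ChartAtInfinity I M) (g : Metric I M) (x : Euc n) : Tensor2 n :=
  pushMetric Ψ g x - hypMetric x

/-- `(M, g)` is a `C^{k,α}_τ` asymptotically hyperbolic manifold, with chart at infinity `Ψ`. -/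
structure IsAsympHyp (k : ℕ) (α : ℝ≥0) (τ : ℝ) (Ψ : ChartAtInfinity I M) (g : Metric I M) :
    Prop where
  locHolder : g.LocHolder k α
  locHolder_error : LocHolderOn k α (metricError Ψ g) (hypExterior n Ψ.radius)
  weightedNorm_lt_top : weightedNormTensor k α τ Ψ.radius (metricError Ψ g) < ⊤

/-- `f ∈ C^{k,α}_τ(M)`, with respect to the chart at infinity `Ψ`. (On the compact set `K₀` the
condition `f ∈ C^{k,α}_loc(M)` bounds the remaining part of the norm.) -/
structure MemWeightedHolder (k : ℕ) (α : ℝ≥0) (τ : ℝ) (Ψ : ChartAtInfinity I M) (f : M → ℝ) :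
    Prop where
  locHolder : FunLocHolder I k α f
  locHolder_end : LocHolderOn k α (f ∘ Ψ.toHomeo.symm) (hypExterior n Ψ.radius)
  weightedNorm_lt_top : weightedNormFun k α τ Ψ.radius (f ∘ Ψ.toHomeo.symm) < ⊤

/-- `(Scal^g + n(n-1)) / ρ ∈ L¹(M, g)`, expressed in the chart at infinity, where `ρ` is defined,
and on the part of it that lies outside of the geodesic ball of radius `R₀ + 1`. -/
def ScalarIntegrable (Ψ : ChartAtInfinity I M) (g : Metric I M) : Prop :=
  IntegrableOn
    (fun x => (scalarCurvature (pushMetric Ψ g) x + (n : ℝ) * ((n : ℝ) - 1)) / rho x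
      * Real.sqrt (compMat (pushMetric Ψ g) x).det)
    (hypExterior n (Ψ.radius + 1)) volume

/-! ### The mass functional -/

/-- The function `V₀ = (1 - ρ) / ρ`. -/
def kernelZero (n : ℕ) (x : Euc n) : ℝ := (1 - rho x) / rho x

/-- The functions `Vᵢ = xⁱ / ρ`. -/
def kernelCoord {n : ℕ} (i : Fin n) (x : Euc n) : ℝ := x i / rho x

/-- The space `𝒩 = span {V₀, V₁, …, Vₙ}`. -/
def kernelSpace (n : ℕ) : Submodule ℝ (Euc n → ℝ) :=
  Submodule.span ℝ ({kernelZero n} ∪ range (kernelCoord (n := n)))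

/-- `ω_{n-1}`, the volume of the unit sphere of `ℝⁿ`. -/
def sphereVolume (n : ℕ) : ℝ := ((volume : Measure (Euc n)).toSphere).real univ

/-- The outward pointing `b`-unit normal `ν = ρ x / |x|` of the spheres centered at the origin. -/
def unitNormal {n : ℕ} (x : Euc n) : Euc n := (rho x / ‖x‖) • x

/-- The integral `∫ η(ν) dμᵇ` of a 1-form `η = ηⱼ dxʲ` over the sphere `{ρ = ε}`. This is the sphere
of Euclidean radius `r = √(1 - 2ε)`, with `dμᵇ = ε^{-(n-1)} r^{n-1} dz`. -/
def sphereFlux {n : ℕ} (η : Fin n → Euc n → ℝ) (ε : ℝ) : ℝ :=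
  ∫ z : _root_.Metric.sphere (0 : Euc n) 1,
    (∑ j, η j (Real.sqrt (1 - 2 * ε) • (z : Euc n))
        * unitNormal (Real.sqrt (1 - 2 * ε) • (z : Euc n)) j)
      * (Real.sqrt (1 - 2 * ε) / ε) ^ (n - 1) ∂((volume : Measure (Euc n)).toSphere)

/-- The 1-form `V (divᵇ e - d tr_b e) - e(∇ᵇV, ·) + (tr_b e) dV`. -/
def massForm {n : ℕ} (e : Euc n → Tensor2 n) (V : Euc n → ℝ) (j : Fin n) (x : Euc n) : ℝ :=
  V x * (divWith hypMetric e j x - pd j (traceWith hypMetric e) x)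
    - ∑ i, gradWith hypMetric V i x * compMat e x i j
    + traceWith hypMetric e x * pd j V x

/-- The expression `cₙ ∫_{ρ = ε} [V (divᵇ e - d tr_b e) - e(∇ᵇV, ·) + (tr_b e) dV](ν) dμᵇ`, with
`cₙ⁻¹ = 2 ω_{n-1} (n-1)`, whose limit as `ε → 0` is the mass functional. -/
def massIntegral (Ψ : ChartAtInfinity I M) (g : Metric I M) (V : Euc n → ℝ) (ε : ℝ) : ℝ :=
  (2 * sphereVolume n * ((n : ℝ) - 1))⁻¹ * sphereFlux (massForm (metricError Ψ g) V) ε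

/-- The mass functional `𝓜_g(V)`; it is well defined where `massIntegral` converges. -/
def massFunctional (Ψ : ChartAtInfinity I M) (g : Metric I M) (V : Euc n → ℝ) : ℝ :=
  limUnder (𝓝[>] (0 : ℝ)) (massIntegral Ψ g V)

/-- The 1-form `θ dV - V dθ`. -/
def wronskianForm {n : ℕ} (θ V : Euc n → ℝ) (j : Fin n) (x : Euc n) : ℝ :=
  θ x * pd j V x - V x * pd j θ x

/-- The conformal metric `e^φ g`. -/
def conformal (φ : M → ℝ) (g : Metric I M) : Metric I M where
  inner p := Real.exp (φ p) • g.inner p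
  symm p v w := by simp [g.symm p v w]
  pos p v hv := by
    have h := mul_pos (Real.exp_pos (φ p)) (g.pos p v hv)
    simpa using h
  continuousAt p := by
    have h := (g.continuousAt p).const_smul (Real.exp (φ p))
    exact h
  isVonNBounded p := by
    have hc : 0 < Real.sqrt (Real.exp (φ p)) := Real.sqrt_pos.2 (Real.exp_pos _)
    have h := (g.isVonNBounded p).image
      ((Real.sqrt (Real.exp (φ p)))⁻¹ • ContinuousLinearMap.id ℝ (TangentSpace I p))
    refine h.subset fun v hv => ?_
    refine ⟨Real.sqrt (Real.exp (φ p)) • v, ?_, ?_⟩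
    · have hs : Real.sqrt (Real.exp (φ p)) * (Real.sqrt (Real.exp (φ p)) * g.inner p v v)
          = Real.exp (φ p) * g.inner p v v := by
        rw [← mul_assoc, Real.mul_self_sqrt (Real.exp_pos _).le]
      have hv' : Real.exp (φ p) * g.inner p v v < 1 := hv
      simpa [hs] using hv'
    · simp [smul_smul, mul_inv_cancel₀ hc.ne']

end Manifold

end AHMass

end

open Asymptotics

noncomputable section

namespace AHMass

/-! Write `Ψ_* g = ρ⁻² (δ + h)`, that is `h = ρ² e`. The weighted Hölder bound, read at the centre
of each unit ball, says that `h`, `ρ ∂h` and `ρ² ∂²h` are `O(ρ^τ)` (`decay_of_weightedNorm`,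
`decay_scaledError`), and likewise for `θ`. Everything else is calculus in Cartesian coordinates on
the ball near `ρ = 0`.

Convergence of the mass. Let `U(h, V)` be the mass 1-form. Each `V ∈ 𝒩` satisfies `∇²V = V b`, so
`ΔV = n V`, and with `Ric = -(n-1) b` this puts `V` in the kernel of the formal adjoint of the
linearized scalar curvature. Hence `divᵇ U = V · DScal(h)` with nothing left over; in Euclidean
terms, `ρ^{2-n} U` has divergence `ρ^{-n} V DScal(h)` (`sum_pd_fluxWeight_mul_massH`). The scalar
curvature is built from `(δ + h)⁻¹`, `h`, `ρ ∂h`, `ρ² ∂²h`, `x` and `ρ` by sums and products, so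
expanding to first order gives `Scal + n(n-1) = DScal(h) + O(ρ^{2τ})`
(`firstOrder_scalarCurvature`). Since `V = O(ρ⁻¹)`, the quadratic error contributes `O(ρ^{2τ-n-1})`
to the divergence, which is integrable because `τ > n/2`; the rest is integrable by the hypothesis
on the scalar curvature. A `C¹` vector field with integrable divergence on `{a < |x| < 1}` has a
convergent flux through the spheres `|x| = r → 1` (`exists_tendsto_flux`), and this gives the mass
of both metrics (`exists_tendsto_sphereFlux_massH`).

The difference. With `φ = κ θ`, the conformal metric corresponds to `ĥ = h + φ δ + r`, where `r =
(e^φ - 1 - φ) δ + (e^φ - 1) h` decays like `ρ^{2τ}` together with its scaled derivatives. The form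
`U` is linear in `h`; `U(φ δ, V) = (n-1)(φ dV - V dφ)` (`massH_kd`), and the flux of `U(r, V)` is
`O(ρ^{2τ-n})`, hence tends to zero. So the flux of `θ dV - V dθ` equals, up to `o(1)`, the
difference of two convergent fluxes divided by `κ (n-1)`. Its limit therefore exists, and the factor
`(2 (n-1) ω_{n-1})⁻¹` turns `κ (n-1)` into `κ / (2 ω_{n-1})`. -/

/-! ### Weak derivatives on an interval and polar coordinates -/

/-- A continuous function on an interval whose weak derivative vanishes is constant. -/
lemma exists_eq_const_of_integral_deriv_mul_eq_zero {a b : ℝ} {u : ℝ → ℝ}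
    (hab : a < b) (hu : ContinuousOn u (Ioo a b))
    (h : ∀ φ : ℝ → ℝ, ContDiff ℝ ∞ φ → HasCompactSupport φ → tsupport φ ⊆ Ioo a b →
      ∫ r, deriv φ r * u r = 0) :
    ∃ c, ∀ r ∈ Ioo a b, u r = c := by
  -- A normalized bump. The constant sought is the pairing of `u` with `f₀`, since subtracting a
  -- multiple of `f₀` gives any test function mean zero.
  obtain ⟨f₀, hf₀, hf₀c, hf₀s, hf₀i⟩ : ∃ f : ℝ → ℝ, ContDiff ℝ ∞ f ∧ HasCompactSupport f ∧
      tsupport f ⊆ Ioo a b ∧ ∫ r, f r = 1 := by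
    let m := (a + b) / 2
    let B : ContDiffBump m := ⟨(b - a) / 8, (b - a) / 4, by linarith, by linarith⟩
    refine ⟨B.normed volume, B.contDiff_normed, B.hasCompactSupport_normed, ?_,
      B.integral_normed⟩
    rw [B.tsupport_normed_eq, Real.closedBall_eq_Icc]
    intro x hx
    simp only [B, m, mem_Icc] at hx
    constructor <;> linarith [hx.1, hx.2]
  have hint : ∀ f : ℝ → ℝ, ContDiff ℝ ∞ f → HasCompactSupport f → tsupport f ⊆ Ioo a b →
      Integrable fun r => f r * u r := by
    intro f hf hfc hfs
    have hc : Continuous fun r => f r * u r := by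
      rw [continuous_iff_continuousAt]
      intro x
      by_cases hx : x ∈ tsupport f
      · exact hf.continuous.continuousAt.mul (hu.continuousAt (isOpen_Ioo.mem_nhds (hfs hx)))
      · have : (fun r => f r * u r) =ᶠ[𝓝 x] fun _ => 0 := by
          filter_upwards [(isClosed_tsupport f).isOpen_compl.mem_nhds hx] with y hy
          rw [image_eq_zero_of_notMem_tsupport hy, zero_mul]
        exact (continuousAt_congr this).2 continuousAt_const
    exact hc.integrable_of_hasCompactSupport hfc.mul_right
  refine ⟨∫ r, f₀ r * u r, ?_⟩
  have hae : ∀ᵐ r ∂volume, r ∈ Ioo a b → u r - ∫ r, f₀ r * u r = 0 := by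
    refine IsOpen.ae_eq_zero_of_integral_contDiff_smul_eq_zero isOpen_Ioo
      ((hu.sub continuousOn_const).locallyIntegrableOn measurableSet_Ioo) ?_
    intro f hf hfc hfs
    set c := ∫ r, f r with hc
    -- `q` has mean zero, so its primitive is again a test function with compact support in the
    -- interval, and the hypothesis applies to that primitive.
    let q : ℝ → ℝ := fun r => f r - c * f₀ r
    have hq : ContDiff ℝ ∞ q := hf.sub (contDiff_const.mul hf₀)
    have hqi : Integrable q := (hf.continuous.integrable_of_hasCompactSupport hfc).sub
      ((hf₀.continuous.integrable_of_hasCompactSupport hf₀c).const_mul c)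
    have hq0 : ∫ r, q r = 0 := by
      simp only [q]
      rw [integral_sub (hf.continuous.integrable_of_hasCompactSupport hfc)
        ((hf₀.continuous.integrable_of_hasCompactSupport hf₀c).const_mul c),
        integral_const_mul, hf₀i]
      simp [hc]
    obtain ⟨l, r, hlr, hal, hrb, hsub⟩ : ∃ l r, l ≤ r ∧ a < l ∧ r < b ∧
        tsupport f ∪ tsupport f₀ ⊆ Icc l r := by
      have hK : IsCompact (tsupport f ∪ tsupport f₀) := hfc.isCompact.union hf₀c.isCompact
      have hne : (tsupport f ∪ tsupport f₀).Nonempty := by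
        by_contra hcon
        rw [not_nonempty_iff_eq_empty, union_empty_iff] at hcon
        have : f₀ = 0 := tsupport_eq_empty_iff.1 hcon.2
        simp [this] at hf₀i
      have hs : tsupport f ∪ tsupport f₀ ⊆ Ioo a b := union_subset hfs hf₀s
      exact ⟨sInf (tsupport f ∪ tsupport f₀), sSup (tsupport f ∪ tsupport f₀),
        (csInf_le hK.bddBelow hne.some_mem).trans (le_csSup hK.bddAbove hne.some_mem),
        (hs (hK.sInf_mem hne)).1, (hs (hK.sSup_mem hne)).2,
        fun x hx => ⟨csInf_le hK.bddBelow hx, le_csSup hK.bddAbove hx⟩⟩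
    have hqz : ∀ x, x ∉ Icc l r → q x = 0 := by
      intro x hx
      have h1 : x ∉ tsupport f := fun h' => hx (hsub (Or.inl h'))
      have h2 : x ∉ tsupport f₀ := fun h' => hx (hsub (Or.inr h'))
      simp [q, image_eq_zero_of_notMem_tsupport h1, image_eq_zero_of_notMem_tsupport h2]
    let φ : ℝ → ℝ := fun x => ∫ s in a..x, q s
    have hφd : ∀ x, HasDerivAt φ (q x) x := fun x =>
      intervalIntegral.integral_hasDerivAt_right (hq.continuous.intervalIntegrable _ _)
        (hq.continuous.stronglyMeasurableAtFilter _ _) hq.continuous.continuousAt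
    have hφ' : deriv φ = q := funext fun x => (hφd x).deriv
    have hφ : ContDiff ℝ ∞ φ := by
      rw [contDiff_infty_iff_deriv]
      exact ⟨fun x => (hφd x).differentiableAt, hφ' ▸ hq⟩
    -- Left of `l` nothing has been integrated yet; right of `r` the whole integral of `q` has been,
    -- and it vanishes.
    have hφz : ∀ x, x ∉ Icc l r → φ x = 0 := by
      intro x hx
      by_cases hxl : x < l
      · refine intervalIntegral.integral_zero_ae (Eventually.of_forall fun y hy => hqz y ?_)
        intro hy'
        have := (uIoc_subset_uIcc hy)
        rcases mem_uIcc.1 this with h1 | h1 <;> linarith [hy'.1, h1.1, h1.2]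
      · have hxr : r < x := by
          by_contra hcon
          exact hx ⟨not_lt.1 hxl, not_lt.1 hcon⟩
        have hsupp : Function.support q ⊆ Ioc a x := by
          intro y hy
          have : y ∈ Icc l r := by
            by_contra hcon
            exact hy (hqz y hcon)
          exact ⟨hal.trans_le this.1, this.2.trans hxr.le⟩
        show ∫ s in a..x, q s = 0
        rw [intervalIntegral.integral_eq_integral_of_support_subset hsupp, hq0]
    have hφs : tsupport φ ⊆ Icc l r := by
      refine closure_minimal (fun x hx => ?_) isClosed_Icc
      by_contra hcon
      exact hx (hφz x hcon)
    have key := h φ hφ (HasCompactSupport.of_support_subset_isCompact isCompact_Icc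
      ((subset_tsupport _).trans hφs)) (hφs.trans fun x hx => ⟨hal.trans_le hx.1, hx.2.trans_lt hrb⟩)
    rw [hφ'] at key
    have e1 : ∀ x, q x * u x = f x * u x - c * (f₀ x * u x) := fun x => by simp only [q]; ring
    simp only [e1] at key
    rw [integral_sub (hint f hf hfc hfs) ((hint f₀ hf₀ hf₀c hf₀s).const_mul c),
      integral_const_mul] at key
    simp only [smul_eq_mul, mul_sub]
    rw [integral_sub (hint f hf hfc hfs)
      ((hf.continuous.integrable_of_hasCompactSupport hfc).mul_const _), integral_mul_const]
    linarith
  -- Two continuous functions that agree almost everywhere on an open set agree on it.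
  have heq : EqOn u (fun _ => ∫ r, f₀ r * u r) (Ioo a b) := by
    refine Measure.eqOn_open_of_ae_eq (μ := volume) ?_ isOpen_Ioo hu continuousOn_const
    rw [Filter.EventuallyEq, ae_restrict_iff' measurableSet_Ioo]
    filter_upwards [hae] with x hx hx'
    exact sub_eq_zero.1 (hx hx')
  exact fun r hr => heq hr

/-- Integration in polar coordinates. -/
lemma integral_polar {E : Type*} [NormedAddCommGroup E] [NormedSpace ℝ E] [MeasurableSpace E]
    [BorelSpace E] [FiniteDimensional ℝ E] [Nontrivial E] (μ : Measure E) [μ.IsAddHaarMeasure]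
    {g : E → ℝ} (hg : Integrable g μ) :
    IntegrableOn (fun r : ℝ => r ^ (Module.finrank ℝ E - 1) *
        ∫ z : Metric.sphere (0 : E) 1, g (r • (z : E)) ∂μ.toSphere) (Ioi 0) ∧
      ∫ x, g x ∂μ = ∫ r in Ioi (0 : ℝ), r ^ (Module.finrank ℝ E - 1) *
        ∫ z : Metric.sphere (0 : E) 1, g (r • (z : E)) ∂μ.toSphere := by
  let d := Module.finrank ℝ E - 1
  let G : Metric.sphere (0 : E) 1 × Ioi (0 : ℝ) → ℝ := fun p => g ((p.2 : ℝ) • (p.1 : E))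
  have hmp := μ.measurePreserving_homeomorphUnitSphereProd
  have hemb := (homeomorphUnitSphereProd E).measurableEmbedding
  have hG : ∀ x : ({(0)}ᶜ : Set E), G (homeomorphUnitSphereProd E x) = g x := by
    intro x
    have hx : ‖(x : E)‖ ≠ 0 := norm_ne_zero_iff.2 x.2
    simp [G, smul_smul, hx]
  -- Passing to the complement of the origin loses nothing, and there the measure is the product of
  -- the sphere measure and `r^d dr`.
  have hGi : Integrable G (μ.toSphere.prod (.volumeIoiPow d)) := by
    rw [← hmp.integrable_comp_emb hemb]
    have h1 : IntegrableOn g ({(0)}ᶜ : Set E) μ := hg.integrableOn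
    rw [integrableOn_iff_comap_subtypeVal (measurableSet_singleton _).compl] at h1
    exact h1.congr (Eventually.of_forall fun x => (hG x).symm)
  have hm : Measurable fun r : Ioi (0 : ℝ) => Real.toNNReal ((r : ℝ) ^ d) :=
    (measurable_subtype_coe.pow_const _).real_toNNReal
  have hpt : ∀ r : Ioi (0 : ℝ), Real.toNNReal ((r : ℝ) ^ d) •
      ∫ z, G (z, r) ∂μ.toSphere = (r : ℝ) ^ d * ∫ z : Metric.sphere (0 : E) 1,
        g ((r : ℝ) • (z : E)) ∂μ.toSphere := by
    intro r
    rw [NNReal.smul_def, Real.coe_toNNReal _ (pow_nonneg (le_of_lt r.2) _), smul_eq_mul]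
  constructor
  · have h2 := hGi.integral_prod_right
    rw [Measure.volumeIoiPow] at h2
    simp only [ENNReal.ofReal] at h2
    rw [integrable_withDensity_iff_integrable_smul hm] at h2
    rw [integrableOn_iff_comap_subtypeVal measurableSet_Ioi]
    exact h2.congr (Eventually.of_forall hpt)
  · calc ∫ x, g x ∂μ = ∫ x : ({(0)}ᶜ : Set E), g x.1 ∂(μ.comap (↑)) := by
          rw [integral_subtype_comap (measurableSet_singleton _).compl g,
            restrict_compl_singleton]
      _ = ∫ p, G p ∂μ.toSphere.prod (.volumeIoiPow d) := by
          rw [← hmp.integral_comp hemb]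
          simp only [hG]
      _ = ∫ r, ∫ z, G (z, r) ∂μ.toSphere ∂(.volumeIoiPow d) := integral_prod_symm _ hGi
      _ = _ := by
          simp only [Measure.volumeIoiPow, ENNReal.ofReal]
          rw [integral_withDensity_eq_integral_smul hm]
          simp only [hpt]
          exact integral_subtype_comap measurableSet_Ioi fun r => r ^ d *
            ∫ z : Metric.sphere (0 : E) 1, g (r • (z : E)) ∂μ.toSphere

/-! ### Fluxes of vector fields through spheres -/

/-- The spherical shell `{a < |x| < 1}`. -/
def shell (n : ℕ) (a : ℝ) : Set (Euc n) := {x | a < ‖x‖ ∧ ‖x‖ < 1}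

lemma isOpen_shell (n : ℕ) (a : ℝ) : IsOpen (shell n a) :=
  (isOpen_lt continuous_const continuous_norm).inter (isOpen_lt continuous_norm continuous_const)

lemma smul_mem_shell {n : ℕ} {a r : ℝ} (ha : 0 ≤ a) (hr : r ∈ Ioo a 1)
    (z : _root_.Metric.sphere (0 : Euc n) 1) : r • (z : Euc n) ∈ shell n a := by
  have : ‖r • (z : Euc n)‖ = r := by
    rw [norm_smul, norm_eq_of_mem_sphere, mul_one, Real.norm_of_nonneg (ha.trans hr.1.le)]
  exact ⟨by rw [this]; exact hr.1, by rw [this]; exact hr.2⟩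

/-- The Euclidean surface integral of a function over the sphere of radius `r` around the origin. -/
def sphereInt {n : ℕ} (f : Euc n → ℝ) (r : ℝ) : ℝ :=
  r ^ (n - 1) * ∫ z : _root_.Metric.sphere (0 : Euc n) 1, f (r • (z : Euc n))
    ∂((volume : Measure (Euc n)).toSphere)

lemma continuousOn_sphereInt {n : ℕ} {a : ℝ} (ha : 0 ≤ a) {f : Euc n → ℝ}
    (hf : ContinuousOn f (shell n a)) : ContinuousOn (sphereInt f) (Ioo a 1) := by
  refine (continuousOn_id.pow _).mul ?_
  rw [continuousOn_iff_continuous_domRestrict]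
  have h : Continuous (fun (r : Ioo a 1) (z : _root_.Metric.sphere (0 : Euc n) 1) =>
      f ((r : ℝ) • (z : Euc n))).uncurry := by
    refine hf.comp_continuous (f := fun p : Ioo a 1 × _root_.Metric.sphere (0 : Euc n) 1 =>
      (p.1 : ℝ) • (p.2 : Euc n)) ?_ fun p => smul_mem_shell ha p.1.2 p.2
    fun_prop
  have : LocallyCompactSpace (Ioo a 1) := isOpen_Ioo.locallyCompactSpace
  have := continuous_parametric_integral_of_continuous
    (μ := (volume : Measure (Euc n)).toSphere) h isCompact_univ
  simp only [Measure.restrict_univ] at this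
  exact this

/-- `f` is controlled only on the open shell, but the support of `ψ` is closed and inside `(a, 1)`,
so near any point the product is either a product of continuous functions or identically zero. -/
lemma continuous_radial_mul {n : ℕ} {a : ℝ} {f : Euc n → ℝ}
    (hf : ContinuousOn f (shell n a)) {ψ : ℝ → ℝ} (hψ : Continuous ψ)
    (hψs : tsupport ψ ⊆ Ioo a 1) : Continuous fun x : Euc n => ψ ‖x‖ * f x := by
  rw [continuous_iff_continuousAt]
  intro x
  by_cases hx : ‖x‖ ∈ tsupport ψ
  · exact (hψ.comp continuous_norm).continuousAt.mul
      (hf.continuousAt ((isOpen_shell n a).mem_nhds (hψs hx)))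
  · have : (fun x : Euc n => ψ ‖x‖ * f x) =ᶠ[𝓝 x] fun _ => 0 := by
      filter_upwards [(continuous_norm (E := Euc n)).continuousAt.preimage_mem_nhds
        ((isClosed_tsupport ψ).isOpen_compl.mem_nhds hx)] with y hy
      rw [image_eq_zero_of_notMem_tsupport hy, zero_mul]
    exact (continuousAt_congr this).2 continuousAt_const

lemma integrable_radial_mul {n : ℕ} {a : ℝ} {f : Euc n → ℝ}
    (hf : ContinuousOn f (shell n a)) {ψ : ℝ → ℝ} (hψ : Continuous ψ)
    (hψs : tsupport ψ ⊆ Ioo a 1) : Integrable fun x : Euc n => ψ ‖x‖ * f x := by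
  refine (continuous_radial_mul hf hψ hψs).integrable_of_hasCompactSupport ?_
  refine HasCompactSupport.intro (isCompact_closedBall (0 : Euc n) 1) fun x hx => ?_
  rw [image_eq_zero_of_notMem_tsupport (f := ψ) (x := ‖x‖), zero_mul]
  intro h
  exact hx (by simpa using (hψs h).2.le)

/-- This reduces the `n`-dimensional divergence theorem to a statement about functions of the
radius: a radial test function on the ball becomes a test function for `sphereInt f`. -/
lemma integral_radial_mul {n : ℕ} (hn : n ≠ 0) {a : ℝ} (ha : 0 ≤ a) {f : Euc n → ℝ}
    (hf : ContinuousOn f (shell n a)) {ψ : ℝ → ℝ} (hψ : Continuous ψ)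
    (hψs : tsupport ψ ⊆ Ioo a 1) :
    ∫ x : Euc n, ψ ‖x‖ * f x = ∫ r, ψ r * sphereInt f r := by
  have : Nonempty (Fin n) := ⟨⟨0, Nat.pos_of_ne_zero hn⟩⟩
  have h := (integral_polar (volume : Measure (Euc n)) (integrable_radial_mul hf hψ hψs)).2
  rw [h, ← integral_indicator measurableSet_Ioi]
  congr 1
  ext r
  by_cases hr : r ∈ Ioi (0 : ℝ)
  · rw [indicator_of_mem hr]
    have : ∀ z : _root_.Metric.sphere (0 : Euc n) 1, ‖r • (z : Euc n)‖ = r := fun z => by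
      rw [norm_smul, norm_eq_of_mem_sphere, mul_one, Real.norm_of_nonneg (le_of_lt hr)]
    simp only [this, integral_const_mul, sphereInt, finrank_euclideanSpace, Fintype.card_fin]
    ring
  · rw [indicator_of_notMem hr, image_eq_zero_of_notMem_tsupport (f := ψ) (x := r), zero_mul]
    intro h
    exact hr (ha.trans_lt (hψs h).1)

lemma integrableOn_sphereInt {n : ℕ} (hn : n ≠ 0) {a : ℝ} (ha : 0 ≤ a) {f : Euc n → ℝ}
    (hf : IntegrableOn f (shell n a)) : IntegrableOn (sphereInt f) (Ioo a 1) := by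
  have : Nonempty (Fin n) := ⟨⟨0, Nat.pos_of_ne_zero hn⟩⟩
  rw [← integrable_indicator_iff (isOpen_shell n a).measurableSet] at hf
  have h := (integral_polar (volume : Measure (Euc n)) hf).1
  refine (h.mono_set fun r (hr : r ∈ Ioo a 1) => ha.trans_lt hr.1).congr_fun ?_ measurableSet_Ioo
  intro r hr
  simp only [indicator_of_mem (smul_mem_shell ha hr _), sphereInt, finrank_euclideanSpace,
    Fintype.card_fin]

/-- The norm is not differentiable at the origin; there `a > 0` makes `ψ ‖x‖` vanish in a
neighbourhood, and both sides are zero. -/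
lemma hasFDerivAt_radial {n : ℕ} {ψ : ℝ → ℝ} {a : ℝ} (ha : 0 < a) (hψ : Differentiable ℝ ψ)
    (hψs : tsupport ψ ⊆ Ioo a 1) (x v : Euc n) :
    DifferentiableAt ℝ (fun x : Euc n => ψ ‖x‖) x ∧
      fderiv ℝ (fun x : Euc n => ψ ‖x‖) x v = deriv ψ ‖x‖ * (inner ℝ x v / ‖x‖) := by
  by_cases hx : x = 0
  · have h0 : (fun y : Euc n => ψ ‖y‖) =ᶠ[𝓝 x] fun _ => 0 := by
      have : {y : Euc n | ‖y‖ < a} ∈ 𝓝 x :=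
        (isOpen_lt continuous_norm continuous_const).mem_nhds (by simpa [hx] using ha)
      filter_upwards [this] with y hy
      exact image_eq_zero_of_notMem_tsupport fun h => absurd (hψs h).1 (not_lt.2 (le_of_lt hy))
    refine ⟨(differentiableAt_const (0 : ℝ)).congr_of_eventuallyEq h0, ?_⟩
    rw [h0.fderiv_eq]
    simp [hx]
  · have h1 : HasFDerivAt (fun y : Euc n => ‖y‖ ^ 2) (2 • innerSL ℝ x) x :=
      (hasStrictFDerivAt_norm_sq x).hasFDerivAt
    have hn0 : ‖x‖ ≠ 0 := norm_ne_zero_iff.2 hx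
    have h2 : HasFDerivAt (fun y : Euc n => ‖y‖) (‖x‖⁻¹ • innerSL ℝ x) x := by
      have h3 := (h1.sqrt (pow_ne_zero 2 hn0))
      have h4 : (fun y : Euc n => √(‖y‖ ^ 2)) = fun y => ‖y‖ := by
        ext y; exact Real.sqrt_sq (norm_nonneg y)
      rw [h4] at h3
      have h5 : (1 / (2 * √(‖x‖ ^ 2))) • (2 • innerSL ℝ x) = ‖x‖⁻¹ • innerSL ℝ x := by
        rw [Real.sqrt_sq (norm_nonneg x)]
        ext w
        simp
        field_simp
      rwa [h5] at h3
    have h5 := (hψ ‖x‖).hasDerivAt.comp_hasFDerivAt x h2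
    refine ⟨h5.differentiableAt, ?_⟩
    have h6 : fderiv ℝ (fun x : Euc n => ψ ‖x‖) x = deriv ψ ‖x‖ • (‖x‖⁻¹ • innerSL ℝ x) := h5.fderiv
    rw [h6]
    simp
    left
    field_simp

lemma inner_basisVec {n : ℕ} (x : Euc n) (i : Fin n) : inner ℝ x (basisVec i) = x i := by
  simp [basisVec, EuclideanSpace.inner_single_right]

/-- The divergence theorem for radial cutoffs. -/
lemma integral_deriv_mul_sphereInt {n : ℕ} (hn : n ≠ 0) {a : ℝ} (ha : 0 < a)
    {F : Fin n → Euc n → ℝ} (hF : ∀ i, ContDiffOn ℝ 1 (F i) (shell n a)) {φ : ℝ → ℝ}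
    (hφ : ContDiff ℝ ∞ φ) (hφs : tsupport φ ⊆ Ioo a 1) :
    ∫ r, deriv φ r * sphereInt (fun x => ∑ i, F i x * (x i / ‖x‖)) r
      = -∫ r, φ r * sphereInt (fun x => ∑ i, pd i (F i) x) r := by
  have hpd : ∀ i, ContinuousOn (fun x => pd i (F i) x) (shell n a) := fun i =>
    ((hF i).continuousOn_fderiv_of_isOpen (isOpen_shell n a) le_rfl).clm_apply continuousOn_const
  have hφ'c : Continuous (deriv φ) := hφ.continuous_deriv (by simp)
  have hφ's : tsupport (deriv φ) ⊆ Ioo a 1 :=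
    (closure_mono (support_deriv_subset)).trans ((closure_minimal subset_rfl
      (isClosed_tsupport φ)).trans hφs)
  have hx : ∀ i : Fin n, ContinuousOn (fun x : Euc n => x i / ‖x‖) (shell n a) := fun i =>
    ContinuousOn.div (by fun_prop) continuous_norm.continuousOn fun x hx => (ha.trans hx.1).ne'
  have hFx : ∀ i : Fin n, ContinuousOn (fun x : Euc n => F i x * (x i / ‖x‖)) (shell n a) :=
    fun i => (hF i).continuousOn.mul (hx i)
  rw [← integral_radial_mul hn ha.le (continuousOn_finsetSum _ fun i _ => hFx i) hφ'c hφ's,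
    ← integral_radial_mul hn ha.le (continuousOn_finsetSum _ fun i _ => hpd i) hφ.continuous hφs]
  simp only [Finset.mul_sum]
  rw [integral_finsetSum _ fun i _ => integrable_radial_mul (hFx i) hφ'c hφ's,
    integral_finsetSum _ fun i _ => integrable_radial_mul (hpd i) hφ.continuous hφs,
    ← Finset.sum_neg_distrib]
  refine Finset.sum_congr rfl fun i _ => ?_
  have hd := hφ.differentiable (by simp)
  have e1 : ∀ x : Euc n, fderiv ℝ (fun x : Euc n => φ ‖x‖) x (basisVec i) * F i x
      = deriv φ ‖x‖ * (F i x * (x i / ‖x‖)) := fun x => by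
    rw [(hasFDerivAt_radial ha hd hφs x _).2, inner_basisVec]; ring
  -- Integration by parts in the direction `i`. The cutoff vanishes outside the shell, so `F i`
  -- needs to be differentiable only on the support of the cutoff, and no boundary term appears.
  have := integral_mul_fderiv_eq_neg_fderiv_mul_of_integrable (μ := (volume : Measure (Euc n)))
    (f := fun x : Euc n => φ ‖x‖) (g := F i) (v := basisVec i) ?_
    (integrable_radial_mul (hpd i) hφ.continuous hφs)
    (integrable_radial_mul (hF i).continuousOn hφ.continuous hφs)
    (fun x _ => (hasFDerivAt_radial ha hd hφs x 0).1) ?_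
  · simp only [e1] at this
    exact (neg_eq_iff_eq_neg.2 this).symm
  · simp only [e1]
    exact integrable_radial_mul (hFx i) hφ'c hφ's
  · intro x hx
    have hxs : ‖x‖ ∈ tsupport φ :=
      tsupport_comp_subset_preimage φ continuous_norm hx
    exact ((hF i).contDiffAt ((isOpen_shell n a).mem_nhds (hφs hxs))).differentiableAt one_ne_zero

/-- The flux of a vector field with integrable divergence has a limit at the unit sphere. -/
theorem exists_tendsto_flux {n : ℕ} (hn : n ≠ 0) {a : ℝ} (ha : 0 < a) (ha1 : a < 1)
    {F : Fin n → Euc n → ℝ} (hF : ∀ i, ContDiffOn ℝ 1 (F i) (shell n a))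
    (hint : IntegrableOn (fun x => ∑ i, pd i (F i) x) (shell n a)) :
    ∃ L, Tendsto (sphereInt fun x => ∑ i, F i x * (x i / ‖x‖)) (𝓝[<] 1) (𝓝 L) := by
  set Φ := sphereInt fun x : Euc n => ∑ i, F i x * (x i / ‖x‖)
  set D := sphereInt fun x : Euc n => ∑ i, pd i (F i) x
  have hpd : ∀ i, ContinuousOn (fun x => pd i (F i) x) (shell n a) := fun i =>
    ((hF i).continuousOn_fderiv_of_isOpen (isOpen_shell n a) le_rfl).clm_apply continuousOn_const
  have hΦ : ContinuousOn Φ (Ioo a 1) := continuousOn_sphereInt ha.le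
    (continuousOn_finsetSum _ fun i _ => (hF i).continuousOn.mul
      (ContinuousOn.div (by fun_prop) continuous_norm.continuousOn fun x hx => (ha.trans hx.1).ne'))
  have hD : ContinuousOn D (Ioo a 1) :=
    continuousOn_sphereInt ha.le (continuousOn_finsetSum _ fun i _ => hpd i)
  have hDi : IntervalIntegrable D volume a 1 := by
    rw [intervalIntegrable_iff_integrableOn_Ioo_of_le ha1.le]
    exact integrableOn_sphereInt hn ha.le hint
  set P : ℝ → ℝ := fun r => ∫ s in a..r, D s
  -- Integrability of the divergence enters here: it makes the primitive continuous up to and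
  -- including `r = 1`.
  have hP : ContinuousOn P (Icc a 1) := by
    have := intervalIntegral.continuousOn_primitive_interval' hDi left_mem_uIcc
    rwa [uIcc_of_le ha1.le] at this
  have hPd : ∀ r ∈ Ioo a 1, HasDerivAt P (D r) r := fun r hr =>
    intervalIntegral.integral_hasDerivAt_right
      (hDi.mono_set (uIcc_subset_uIcc left_mem_uIcc (by
        rw [uIcc_of_le ha1.le]; exact ⟨hr.1.le, hr.2.le⟩)))
      (hD.stronglyMeasurableAtFilter isOpen_Ioo r hr) (hD.continuousAt (isOpen_Ioo.mem_nhds hr))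
  have hmulc : ∀ {f ψ : ℝ → ℝ}, ContinuousOn f (Ioo a 1) → Continuous ψ → tsupport ψ ⊆ Ioo a 1 →
      HasCompactSupport ψ → Integrable fun r => ψ r * f r := by
    intro f ψ hf hψ hψs hψc
    have hc : Continuous fun r => ψ r * f r := by
      rw [continuous_iff_continuousAt]
      intro x
      by_cases hx : x ∈ tsupport ψ
      · exact hψ.continuousAt.mul (hf.continuousAt (isOpen_Ioo.mem_nhds (hψs hx)))
      · have : (fun r => ψ r * f r) =ᶠ[𝓝 x] fun _ => 0 := by
          filter_upwards [(isClosed_tsupport ψ).isOpen_compl.mem_nhds hx] with y hy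
          rw [image_eq_zero_of_notMem_tsupport hy, zero_mul]
        exact (continuousAt_congr this).2 continuousAt_const
    exact hc.integrable_of_hasCompactSupport hψc.mul_right
  have hPo := hP.mono Ioo_subset_Icc_self
  -- The flux has weak derivative `D` by the divergence theorem with radial cutoffs, and `P` has
  -- derivative `D`, so `Φ - P` is constant and `Φ` inherits the limit of `P`.
  obtain ⟨c, hc⟩ := exists_eq_const_of_integral_deriv_mul_eq_zero ha1 (hΦ.sub hPo) (by
    intro φ hφ hφc hφs
    have hφ'c : Continuous (deriv φ) := hφ.continuous_deriv (by simp)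
    have hφ's : tsupport (deriv φ) ⊆ Ioo a 1 :=
      (closure_mono (support_deriv_subset)).trans ((closure_minimal subset_rfl
        (isClosed_tsupport φ)).trans hφs)
    have i1 := hmulc hΦ hφ'c hφ's hφc.deriv
    have i2 := hmulc hPo hφ'c hφ's hφc.deriv
    have hfd : ∀ r, fderiv ℝ φ r 1 * P r = deriv φ r * P r := fun r => by
      rw [fderiv_apply_one_eq_deriv]
    have e2 : ∀ r, φ r * fderiv ℝ P r 1 = φ r * D r := fun r => by
      by_cases hr : r ∈ tsupport φ
      · rw [fderiv_apply_one_eq_deriv, (hPd r (hφs hr)).deriv]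
      · rw [image_eq_zero_of_notMem_tsupport hr, zero_mul, zero_mul]
    have h2 := integral_mul_fderiv_eq_neg_fderiv_mul_of_integrable (μ := (volume : Measure ℝ))
      (f := φ) (g := P) (v := 1) (by simpa only [hfd] using i2)
      (by simpa only [e2] using hmulc hD hφ.continuous hφs hφc)
      (hmulc hPo hφ.continuous hφs hφc) (fun x _ => hφ.differentiable (by simp) x)
      (fun x hx => (hPd x (hφs hx)).differentiableAt)
    simp only [e2, hfd] at h2
    have h1 : ∫ r, deriv φ r * Φ r = -∫ r, φ r * D r :=
      integral_deriv_mul_sphereInt hn ha hF hφ hφs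
    simp only [Pi.sub_apply, mul_sub]
    rw [integral_sub i1 i2, h1, h2, neg_neg, sub_self])
  refine ⟨c + P 1, ?_⟩
  have hlim : Tendsto (fun r => c + P r) (𝓝[<] 1) (𝓝 (c + P 1)) := by
    refine tendsto_const_nhds.add ?_
    have h1 : Tendsto P (𝓝[Icc a 1] 1) (𝓝 (P 1)) := hP 1 (right_mem_Icc.2 ha1.le)
    refine h1.mono_left ?_
    rw [← nhdsWithin_Ioo_eq_nhdsLT ha1]
    exact nhdsWithin_mono _ Ioo_subset_Icc_self
  refine hlim.congr' ?_
  filter_upwards [Ioo_mem_nhdsLT ha1] with r hr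
  have := hc r hr
  simp only [Pi.sub_apply] at this
  linarith

/-! ### Neighbourhoods of the sphere at infinity -/

/-- The filter of neighbourhoods of the sphere at infinity in the unit ball. -/
def ballEnd (n : ℕ) : Filter (Euc n) := comap rho (𝓝[>] (0 : ℝ))

lemma contDiff_rho {n : ℕ} {m : WithTop ℕ∞} : ContDiff ℝ m (rho (n := n)) := by
  unfold rho
  exact (contDiff_const.sub (contDiff_norm_sq ℝ)).div_const 2

lemma tendsto_rho (n : ℕ) : Tendsto (rho (n := n)) (ballEnd n) (𝓝[>] 0) := tendsto_comap

lemma rho_pos_iff {n : ℕ} {x : Euc n} : 0 < rho x ↔ ‖x‖ < 1 := by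
  unfold rho
  constructor
  · intro h
    nlinarith [norm_nonneg x]
  · intro h
    nlinarith [norm_nonneg x]

lemma eventually_rho_pos (n : ℕ) : ∀ᶠ x in ballEnd n, 0 < rho x :=
  (tendsto_rho n).eventually self_mem_nhdsWithin

lemma eventually_ballEnd_iff {n : ℕ} {p : Euc n → Prop} :
    (∀ᶠ x in ballEnd n, p x) ↔ ∃ δ > 0, ∀ x, 0 < rho x → rho x < δ → p x := by
  have := ((nhdsGT_basis (0 : ℝ)).comap (rho (n := n)))
  rw [ballEnd, this.eventually_iff]
  simp [mem_Ioo]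

/-- The sets `{0 < ρ < δ}` are open. Identities valid near infinity therefore hold on a
neighbourhood of each point near infinity, and may be differentiated. -/
lemma eventually_eventually_ballEnd {n : ℕ} {p : Euc n → Prop} (h : ∀ᶠ x in ballEnd n, p x) :
    ∀ᶠ x in ballEnd n, ∀ᶠ y in 𝓝 x, p y := by
  obtain ⟨δ, hδ, H⟩ := eventually_ballEnd_iff.1 h
  refine eventually_ballEnd_iff.2 ⟨δ, hδ, fun x h1 h2 => ?_⟩
  have hc : ContinuousAt (rho (n := n)) x := (contDiff_rho (m := 0)).continuous.continuousAt
  filter_upwards [hc.eventually (lt_mem_nhds h1), hc.eventually (gt_mem_nhds h2)] with y h3 h4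
  exact H y h3 h4

lemma exists_shell_of_eventually {n : ℕ} {p : Euc n → Prop} (h : ∀ᶠ x in ballEnd n, p x) :
    ∃ a, 0 < a ∧ a < 1 ∧ ∀ x ∈ shell n a, p x := by
  obtain ⟨δ, hδ, H⟩ := eventually_ballEnd_iff.1 h
  -- `ρ = (1 - |x|)(1 + |x|)/2 < 1 - |x|` in the ball, so `|x| > 1 - δ` suffices; the `1/2` keeps
  -- the inner radius positive.
  refine ⟨max (1 / 2) (1 - δ), by positivity, max_lt (by norm_num) (by linarith), fun x hx => ?_⟩
  refine H x (rho_pos_iff.2 hx.2) ?_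
  have h1 := (le_max_left _ _).trans_lt hx.1
  have h2 := (le_max_right _ _).trans_lt hx.1
  have h3 := hx.2
  unfold rho
  nlinarith

lemma abs_coord_le_norm {n : ℕ} (x : Euc n) (i : Fin n) : |x i| ≤ ‖x‖ := by
  simpa using PiLp.norm_apply_le x i

lemma isBigO_coord {n : ℕ} (i : Fin n) :
    (fun x : Euc n => x i) =O[ballEnd n] fun _ => (1 : ℝ) := by
  refine IsBigO.of_bound 1 ?_
  filter_upwards [eventually_rho_pos n] with x hx
  simpa using (abs_coord_le_norm x i).trans (rho_pos_iff.1 hx).le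

lemma isBigO_rho {n : ℕ} : (rho (n := n)) =O[ballEnd n] fun _ => (1 : ℝ) :=
  ((tendsto_rho n).mono_right nhdsWithin_le_nhds).isBigO_one ℝ

/-! ### Partial derivatives -/

section pd

variable {n : ℕ} {f g : Euc n → ℝ} {x : Euc n}

lemma pd_congr (h : f =ᶠ[𝓝 x] g) (i : Fin n) : pd i f x = pd i g x := by
  unfold pd; rw [h.fderiv_eq]

lemma pd_add (hf : DifferentiableAt ℝ f x) (hg : DifferentiableAt ℝ g x) (i : Fin n) :
    pd i (fun y => f y + g y) x = pd i f x + pd i g x := by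
  unfold pd; rw [fderiv_fun_add hf hg]; rfl

lemma pd_sub (hf : DifferentiableAt ℝ f x) (hg : DifferentiableAt ℝ g x) (i : Fin n) :
    pd i (fun y => f y - g y) x = pd i f x - pd i g x := by
  unfold pd; rw [fderiv_fun_sub hf hg]; rfl

lemma pd_mul (hf : DifferentiableAt ℝ f x) (hg : DifferentiableAt ℝ g x) (i : Fin n) :
    pd i (fun y => f y * g y) x = pd i f x * g x + f x * pd i g x := by
  unfold pd; rw [fderiv_fun_mul hf hg]; simp; ring

lemma pd_const_mul (c : ℝ) (hf : DifferentiableAt ℝ f x) (i : Fin n) :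
    pd i (fun y => c * f y) x = c * pd i f x := by
  unfold pd; rw [fderiv_const_mul hf]; simp

@[simp] lemma pd_const (c : ℝ) (i : Fin n) : pd i (fun _ => c) x = 0 := by
  unfold pd; simp

lemma pd_sum {ι : Type*} {s : Finset ι} {F : ι → Euc n → ℝ}
    (hF : ∀ j ∈ s, DifferentiableAt ℝ (F j) x) (i : Fin n) :
    pd i (fun y => ∑ j ∈ s, F j y) x = ∑ j ∈ s, pd i (F j) x := by
  unfold pd; rw [fderiv_fun_sum hF]; simp

lemma pd_comp {u : ℝ → ℝ} (hu : DifferentiableAt ℝ u (f x)) (hf : DifferentiableAt ℝ f x)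
    (i : Fin n) : pd i (fun y => u (f y)) x = deriv u (f x) * pd i f x := by
  unfold pd
  have := (hu.hasDerivAt.comp_hasFDerivAt x hf.hasFDerivAt).fderiv
  rw [show (fun y => u (f y)) = u ∘ f from rfl, this]
  simp

lemma pd_coord (i j : Fin n) : pd i (fun y : Euc n => y j) x = if i = j then 1 else 0 := by
  unfold pd
  have : (fun y : Euc n => y j) = EuclideanSpace.proj (𝕜 := ℝ) j := rfl
  rw [this, ContinuousLinearMap.fderiv]
  simp [basisVec, eq_comm]

lemma pd_rho (i : Fin n) : pd i rho x = -x i := by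
  have h : HasFDerivAt (rho (n := n)) _ x :=
    ((hasStrictFDerivAt_norm_sq x).hasFDerivAt.const_sub 1).mul_const (2 : ℝ)⁻¹
  unfold pd
  rw [h.fderiv]
  have := inner_basisVec x i
  simp [this]

lemma differentiableAt_rho : DifferentiableAt ℝ (rho (n := n)) x :=
  (contDiff_rho (m := 1)).differentiable one_ne_zero x

lemma differentiableAt_coord (i : Fin n) : DifferentiableAt ℝ (fun y : Euc n => y i) x := by
  fun_prop

lemma pd_inv_rho (hx : rho x ≠ 0) (i : Fin n) :
    pd i (fun y => (rho y)⁻¹) x = x i / rho x ^ 2 := by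
  rw [pd_comp (u := fun t => t⁻¹) (differentiableAt_inv hx) differentiableAt_rho, pd_rho,
    deriv_inv]
  field_simp

lemma contDiffAt_pd {m : ℕ} (hf : ContDiffAt ℝ (m + 1) f x) (i : Fin n) :
    ContDiffAt ℝ m (pd i f) x :=
  (hf.fderiv_right le_rfl).clm_apply contDiffAt_const

lemma differentiableAt_pd (hf : ContDiffAt ℝ 2 f x) (i : Fin n) :
    DifferentiableAt ℝ (pd i f) x :=
  (contDiffAt_pd (m := 1) (by simpa [one_add_one_eq_two] using hf) i).differentiableAt (by simp)

lemma _root_.ContDiffAt.eventually_differentiableAt (hf : ContDiffAt ℝ 2 f x) :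
    ∀ᶠ y in 𝓝 x, DifferentiableAt ℝ f y :=
  (hf.eventually (by simp)).mono fun _ h => h.differentiableAt (by simp)

end pd

/-! ### First order expansions -/

/-- `f = f₀ + f₁ + O(s²)`, with `f₀` bounded and `f₁ = O(s)`. -/
structure FirstOrder {X : Type*} (l : Filter X) (s f f₀ f₁ : X → ℝ) : Prop where
  zero : f₀ =O[l] fun _ => (1 : ℝ)
  one : f₁ =O[l] s
  rem : (fun x => f x - f₀ x - f₁ x) =O[l] fun x => s x ^ 2

namespace FirstOrder

variable {X : Type*} {l : Filter X} {s f g f₀ f₁ g₀ g₁ f₀' f₁' : X → ℝ}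

lemma congr (h : FirstOrder l s f f₀ f₁) (h₀ : ∀ᶠ x in l, f₀ x = f₀' x)
    (h₁ : ∀ᶠ x in l, f₁ x = f₁' x) : FirstOrder l s f f₀' f₁' := by
  refine ⟨h.zero.congr' h₀ EventuallyEq.rfl, h.one.congr' h₁ EventuallyEq.rfl,
    h.rem.congr' ?_ EventuallyEq.rfl⟩
  filter_upwards [h₀, h₁] with x e₀ e₁
  rw [e₀, e₁]

lemma congr_left (h : FirstOrder l s f f₀ f₁) (hfg : ∀ᶠ x in l, f x = g x) :
    FirstOrder l s g f₀ f₁ := by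
  refine ⟨h.zero, h.one, h.rem.congr' ?_ EventuallyEq.rfl⟩
  filter_upwards [hfg] with x e
  rw [e]

lemma bounded (h : f =O[l] fun _ => (1 : ℝ)) : FirstOrder l s f f fun _ => 0 :=
  ⟨h, isBigO_zero _ _, by simpa using isBigO_zero _ _⟩

lemma const (c : ℝ) : FirstOrder l s (fun _ => c) (fun _ => c) fun _ => 0 :=
  bounded (isBigO_const_const c one_ne_zero l)

lemma small (h : f =O[l] s) : FirstOrder l s f (fun _ => 0) f :=
  ⟨isBigO_zero _ _, h, by simpa using isBigO_zero _ _⟩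

lemma add (hf : FirstOrder l s f f₀ f₁) (hg : FirstOrder l s g g₀ g₁) :
    FirstOrder l s (fun x => f x + g x) (fun x => f₀ x + g₀ x) (fun x => f₁ x + g₁ x) :=
  ⟨hf.zero.add hg.zero, hf.one.add hg.one, (hf.rem.add hg.rem).congr_left fun x => by ring⟩

lemma neg (hf : FirstOrder l s f f₀ f₁) :
    FirstOrder l s (fun x => -f x) (fun x => -f₀ x) (fun x => -f₁ x) :=
  ⟨hf.zero.neg_left, hf.one.neg_left, hf.rem.neg_left.congr_left fun x => by ring⟩

lemma sub (hf : FirstOrder l s f f₀ f₁) (hg : FirstOrder l s g g₀ g₁) :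
    FirstOrder l s (fun x => f x - g x) (fun x => f₀ x - g₀ x) (fun x => f₁ x - g₁ x) :=
  ⟨hf.zero.sub hg.zero, hf.one.sub hg.one, (hf.rem.sub hg.rem).congr_left fun x => by ring⟩

lemma sum {ι : Type*} {t : Finset ι} {F F₀ F₁ : ι → X → ℝ}
    (h : ∀ i ∈ t, FirstOrder l s (F i) (F₀ i) (F₁ i)) :
    FirstOrder l s (fun x => ∑ i ∈ t, F i x) (fun x => ∑ i ∈ t, F₀ i x)
      (fun x => ∑ i ∈ t, F₁ i x) := by
  refine ⟨IsBigO.fun_sum fun i hi => (h i hi).zero, IsBigO.fun_sum fun i hi => (h i hi).one,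
    (IsBigO.fun_sum fun i hi => (h i hi).rem).congr_left fun x => ?_⟩
  simp only [Finset.sum_sub_distrib]

lemma sq_isBigO (hs : s =O[l] fun _ => (1 : ℝ)) : (fun x => s x ^ 2) =O[l] s := by
  simpa [pow_two] using hs.mul (isBigO_refl s l)

lemma isBigO_one (hs : s =O[l] fun _ => (1 : ℝ)) (hf : FirstOrder l s f f₀ f₁) :
    f =O[l] fun _ => (1 : ℝ) :=
  (((hf.rem.trans ((sq_isBigO hs).trans hs)).add (hf.one.trans hs)).add hf.zero).congr_left
    fun x => by ring

/-- Leibniz rule modulo `s²`: the product of the two linear parts and the terms with a remainder are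
all `O(s²)`. Boundedness of `s` makes every factor bounded. -/
lemma mul (hs : s =O[l] fun _ => (1 : ℝ)) (hf : FirstOrder l s f f₀ f₁)
    (hg : FirstOrder l s g g₀ g₁) :
    FirstOrder l s (fun x => f x * g x) (fun x => f₀ x * g₀ x)
      (fun x => f₀ x * g₁ x + f₁ x * g₀ x) := by
  refine ⟨by simpa using hf.zero.mul hg.zero, ?_, ?_⟩
  · exact (by simpa using hf.zero.mul hg.one : _ =O[l] s).add
      (by simpa using hf.one.mul hg.zero)
  · have h1 : (fun x => f₁ x * g₁ x) =O[l] fun x => s x ^ 2 := by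
      simpa only [pow_two] using hf.one.mul hg.one
    have h2 : (fun x => (f₀ x + f₁ x) * (g x - g₀ x - g₁ x)) =O[l] fun x => s x ^ 2 := by
      simpa using (hf.zero.add (hf.one.trans hs)).mul hg.rem
    have h3 : (fun x => (f x - f₀ x - f₁ x) * g x) =O[l] fun x => s x ^ 2 := by
      simpa using hf.rem.mul (hg.isBigO_one hs)
    exact ((h1.add h2).add h3).congr_left fun x => by ring

end FirstOrder

/-! ### Decaying functions -/

/-- `f` is `C²` near infinity, and `f`, `ρ ∂f` and `ρ² ∂²f` are `O(s)`. -/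
structure Decay {n : ℕ} (s f : Euc n → ℝ) : Prop where
  smooth : ∀ᶠ x in ballEnd n, ContDiffAt ℝ 2 f x
  zero : f =O[ballEnd n] s
  one : ∀ i, (fun x => rho x * pd i f x) =O[ballEnd n] s
  two : ∀ i j, (fun x => rho x ^ 2 * pd i (pd j f) x) =O[ballEnd n] s

namespace Decay

variable {n : ℕ} {s t f g : Euc n → ℝ}

lemma mono (hf : Decay s f) (h : s =O[ballEnd n] t) : Decay t f :=
  ⟨hf.smooth, hf.zero.trans h, fun i => (hf.one i).trans h, fun i j => (hf.two i j).trans h⟩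

lemma congr (hf : Decay s f) (h : ∀ᶠ x in ballEnd n, f x = g x) : Decay s g := by
  have h' := eventually_eventually_ballEnd h
  have h'' := eventually_eventually_ballEnd h'
  refine ⟨?_, hf.zero.congr' h EventuallyEq.rfl, fun i => (hf.one i).congr' ?_ EventuallyEq.rfl,
    fun i j => (hf.two i j).congr' ?_ EventuallyEq.rfl⟩
  · filter_upwards [hf.smooth, h'] with x h1 h2 using h1.congr_of_eventuallyEq (h2.mono fun _ => Eq.symm)
  · filter_upwards [h'] with x hx
    rw [pd_congr hx]
  · filter_upwards [h''] with x hx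
    rw [pd_congr (hx.mono fun y hy => pd_congr hy j)]

lemma const (c : ℝ) : Decay (fun _ : Euc n => (1 : ℝ)) fun _ => c := by
  refine ⟨Eventually.of_forall fun x => contDiffAt_const, isBigO_const_const _ one_ne_zero _,
    fun i => ?_, fun i j => ?_⟩
  · simp only [pd_const, mul_zero]
    exact isBigO_zero _ _
  · have : pd j (fun _ : Euc n => c) = fun _ => 0 := by ext; simp
    simp only [this, pd_const, mul_zero]
    exact isBigO_zero _ _

lemma add (hf : Decay s f) (hg : Decay s g) : Decay s fun x => f x + g x := by
  refine ⟨?_, hf.zero.add hg.zero, fun i => ((hf.one i).add (hg.one i)).congr' ?_ EventuallyEq.rfl,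
    fun i j => ((hf.two i j).add (hg.two i j)).congr' ?_ EventuallyEq.rfl⟩
  · filter_upwards [hf.smooth, hg.smooth] with x h1 h2 using h1.add h2
  · filter_upwards [hf.smooth, hg.smooth] with x h1 h2
    rw [pd_add (h1.differentiableAt (by simp)) (h2.differentiableAt (by simp))]
    ring
  · filter_upwards [hf.smooth, hg.smooth] with x h1 h2
    have e : pd j (fun y => f y + g y) =ᶠ[𝓝 x] fun y => pd j f y + pd j g y := by
      filter_upwards [h1.eventually_differentiableAt, h2.eventually_differentiableAt] with y h3 h4
      exact pd_add h3 h4 j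
    rw [pd_congr e, pd_add (differentiableAt_pd h1 j) (differentiableAt_pd h2 j)]
    ring

lemma mul (hf : Decay s f) (hg : Decay t g) :
    Decay (fun x => s x * t x) fun x => f x * g x := by
  refine ⟨?_, hf.zero.mul hg.zero,
    fun i => (((hf.one i).mul hg.zero).add (hf.zero.mul (hg.one i))).congr' ?_ EventuallyEq.rfl,
    fun i j => ((((hf.two i j).mul hg.zero).add ((hf.one j).mul (hg.one i))).add
      (((hf.one i).mul (hg.one j)).add (hf.zero.mul (hg.two i j)))).congr' ?_ EventuallyEq.rfl⟩
  · filter_upwards [hf.smooth, hg.smooth] with x h1 h2 using h1.mul h2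
  · filter_upwards [hf.smooth, hg.smooth] with x h1 h2
    rw [pd_mul (h1.differentiableAt (by simp)) (h2.differentiableAt (by simp))]
    ring
  · filter_upwards [hf.smooth, hg.smooth] with x h1 h2
    have e : pd j (fun y => f y * g y) =ᶠ[𝓝 x] fun y => pd j f y * g y + f y * pd j g y := by
      filter_upwards [h1.eventually_differentiableAt, h2.eventually_differentiableAt] with y h3 h4
      exact pd_mul h3 h4 j
    have d1 := h1.differentiableAt (by simp)
    have d2 := h2.differentiableAt (by simp)
    have d3 := differentiableAt_pd h1 j
    have d4 := differentiableAt_pd h2 j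
    rw [pd_congr e, pd_add (d3.fun_mul d2) (d1.fun_mul d4), pd_mul d3 d2, pd_mul d1 d4]
    ring

lemma const_mul (c : ℝ) (hf : Decay s f) : Decay s fun x => c * f x :=
  ((const c).mul hf).mono (by simpa using isBigO_refl _ _)

/-- The target rate `t` is free because the rate depends on how strongly `u` vanishes at zero. The
three conditions are what the chain rule needs for the value, for the `u'` terms and for the term
`u'' ρ² ∂ᵢf ∂ⱼf`. -/
lemma comp {u : ℝ → ℝ} (hu : ContDiff ℝ 2 u) (hf : Decay s f)
    (h₀ : (fun x => u (f x)) =O[ballEnd n] t)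
    (h₁ : (fun x => deriv u (f x) * s x) =O[ballEnd n] t)
    (h₂ : (fun x => deriv (deriv u) (f x) * (s x * s x)) =O[ballEnd n] t) :
    Decay t fun x => u (f x) := by
  have hu1 : Differentiable ℝ u := hu.differentiable (by simp)
  have hu2 : Differentiable ℝ (deriv u) :=
    ((contDiff_succ_iff_deriv (n := 1)).1 (by simpa [one_add_one_eq_two] using hu)).2.2.differentiable
      (by simp)
  refine ⟨?_, h₀,
    fun i => ((((isBigO_refl (fun x => deriv u (f x)) _).mul (hf.one i)).trans h₁)).congr' ?_
      EventuallyEq.rfl,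
    fun i j => ((((isBigO_refl (fun x => deriv (deriv u) (f x)) _).mul
      ((hf.one i).mul (hf.one j))).trans h₂).add
      (((isBigO_refl (fun x => deriv u (f x)) _).mul (hf.two i j)).trans h₁)).congr' ?_
        EventuallyEq.rfl⟩
  · filter_upwards [hf.smooth] with x h1 using hu.contDiffAt.comp x h1
  · filter_upwards [hf.smooth] with x h1
    rw [pd_comp (hu1 _) (h1.differentiableAt (by simp))]
    ring
  · filter_upwards [hf.smooth] with x h1
    have e : pd j (fun y => u (f y)) =ᶠ[𝓝 x] fun y => deriv u (f y) * pd j f y := by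
      filter_upwards [h1.eventually_differentiableAt] with y h3
      exact pd_comp (hu1 _) h3 j
    have d1 := h1.differentiableAt (by simp)
    rw [pd_congr e, pd_mul (f := fun y => deriv u (f y)) ((hu2 _).comp x d1) (differentiableAt_pd h1 j), pd_comp (hu2 _) d1]
    ring

lemma tendsto_zero (hf : Decay s f) (hs : Tendsto s (ballEnd n) (𝓝 0)) :
    Tendsto f (ballEnd n) (𝓝 0) := hf.zero.trans_tendsto hs

lemma exp_sub_one (hf : Decay s f) (hs : Tendsto s (ballEnd n) (𝓝 0)) :
    Decay s fun x => Real.exp (f x) - 1 := by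
  have hf0 := hf.tendsto_zero hs
  have h1 : (fun x => Real.exp (f x) - 1) =O[ballEnd n] s := by
    have := (Real.exp_sub_sum_range_isBigO_pow 1).comp_tendsto hf0
    simp only [Finset.range_one, Finset.sum_singleton, pow_zero, Nat.factorial_zero, Nat.cast_one,
      div_one, pow_one] at this
    exact this.trans hf.zero
  have h2 : (fun x => Real.exp (f x)) =O[ballEnd n] fun _ => (1 : ℝ) :=
    ((Real.continuous_exp.tendsto 0).comp hf0).isBigO_one ℝ
  have d1 : deriv (fun y => Real.exp y - 1) = Real.exp := by ext y; simp
  refine comp (u := fun y => Real.exp y - 1) (by fun_prop) hf h1 ?_ ?_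
  · rw [d1]
    simpa using h2.mul (isBigO_refl s _)
  · rw [d1, Real.deriv_exp]
    simpa using h2.mul ((hs.isBigO_one ℝ).mul (isBigO_refl s _))

/-- `u(y) = e^y - 1 - y` vanishes to second order at zero: `u(f) = O(s²)`, while `u'(f) = O(s)` is
multiplied by one derivative factor and `u''(f) = O(1)` by two. -/
lemma exp_sub_one_sub (hf : Decay s f) (hs : Tendsto s (ballEnd n) (𝓝 0)) :
    Decay (fun x => s x * s x) fun x => Real.exp (f x) - 1 - f x := by
  have hf0 := hf.tendsto_zero hs
  have h1 : (fun x => Real.exp (f x) - 1 - f x) =O[ballEnd n] fun x => s x * s x := by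
    have := (Real.exp_sub_sum_range_isBigO_pow 2).comp_tendsto hf0
    simp only [Finset.sum_range_succ, Finset.range_zero, Finset.sum_empty, pow_zero,
      Nat.factorial_zero, Nat.cast_one, div_one, pow_one, Nat.factorial_one, zero_add] at this
    refine (this.congr_left fun x => ?_).trans
      ((hf.zero.mul hf.zero).congr_left fun x => (pow_two _).symm)
    simp only [Function.comp_apply]
    ring
  have h2 : (fun x => Real.exp (f x)) =O[ballEnd n] fun _ => (1 : ℝ) :=
    ((Real.continuous_exp.tendsto 0).comp hf0).isBigO_one ℝ
  have d1 : deriv (fun y => Real.exp y - 1 - y) = fun y => Real.exp y - 1 := by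
    ext y
    rw [deriv_fun_sub (by fun_prop) (by fun_prop)]
    simp
  have d2 : deriv (fun y => Real.exp y - 1) = Real.exp := by ext y; simp
  refine comp (u := fun y => Real.exp y - 1 - y) (by fun_prop) hf h1 ?_ ?_
  · rw [d1]
    exact (hf.exp_sub_one hs).zero.mul (isBigO_refl s _)
  · rw [d1, d2]
    simpa using h2.mul ((isBigO_refl s _).mul (isBigO_refl s _))

end Decay

/-! ### The algebra of the linearized scalar curvature -/

section Algebra

variable {n : ℕ}

/-- The Kronecker delta. -/
def kd (i j : Fin n) : ℝ := if i = j then 1 else 0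

lemma kd_comm (i j : Fin n) : kd i j = kd j i := by simp [kd, eq_comm]

lemma sum_mul_kd (i : Fin n) (f : Fin n → ℝ) : ∑ j, f j * kd i j = f i := by simp [kd]

lemma sum_mul_kd' (i : Fin n) (f : Fin n → ℝ) : ∑ j, f j * kd j i = f i := by simp [kd]

lemma sum_kd_mul (i : Fin n) (f : Fin n → ℝ) : ∑ j, kd i j * f j = f i := by simp [kd]

lemma sum_kd_mul' (i : Fin n) (f : Fin n → ℝ) : ∑ j, kd j i * f j = f i := by simp [kd]

lemma sum_kd_self : ∑ j : Fin n, kd j j = n := by simp [kd]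

variable (r : ℝ) (x : Fin n → ℝ) (h : Fin n → Fin n → ℝ) (P : Fin n → Fin n → Fin n → ℝ)
  (Q : Fin n → Fin n → Fin n → Fin n → ℝ)

/-- `ρ Γᵏᵢⱼ` for the hyperbolic metric. -/
def chrZero (k i j : Fin n) : ℝ := x i * kd j k + x j * kd i k - x k * kd i j

/-- The linearization of `ρ Γᵏᵢⱼ`. -/
def chrOne (k i j : Fin n) : ℝ :=
  1 / 2 * (P i j k + P j i k - P k i j) - h i j * x k + kd i j * ∑ l, h k l * x l

/-- `ρ² ∂ₘ Γᵏᵢⱼ` for the hyperbolic metric. -/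
def dchrZero (m k i j : Fin n) : ℝ :=
  (r * kd i m + x i * x m) * kd j k + (r * kd j m + x j * x m) * kd i k
    - kd i j * (r * kd k m + x k * x m)

/-- The linearization of `ρ² ∂ₘ Γᵏᵢⱼ`. -/
def dchrOne (m k i j : Fin n) : ℝ :=
  1 / 2 * (Q m i j k + Q m j i k - Q m k i j) - P m i j * x k + kd i j * ∑ l, P m k l * x l
    - h i j * (r * kd k m + x k * x m) + kd i j * ∑ l, h k l * (r * kd l m + x l * x m)

/-- `ρ² Rᵢⱼ` for the hyperbolic metric. -/
def ricZero (i j : Fin n) : ℝ :=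
  ∑ k, (dchrZero r x k k i j - dchrZero r x j k i k
    + ∑ l, (chrZero x k k l * chrZero x l i j - chrZero x k j l * chrZero x l i k))

/-- The linearization of `ρ² Rᵢⱼ`. -/
def ricOne (i j : Fin n) : ℝ :=
  ∑ k, (dchrOne r x h P Q k k i j - dchrOne r x h P Q j k i k
    + ∑ l, (chrZero x k k l * chrOne x h P l i j + chrOne x h P k k l * chrZero x l i j
      - (chrZero x k j l * chrOne x h P l i k + chrOne x h P k j l * chrZero x l i k)))

/-- The linearization of the scalar curvature at the hyperbolic metric. -/
def scalOne : ℝ :=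
  (∑ i, ∑ j, Q i j i j - ∑ i, ∑ j, Q i i j j)
    + 2 * (n - 1) * (r * ∑ i, h i i + ∑ i, ∑ j, P i i j * x j - 1 / 2 * ∑ i, ∑ j, P j i i * x j)
    + n * (n - 1) * ∑ i, ∑ j, h i j * x i * x j

variable {r x h P Q}

lemma sum_chrZero_mul (l : Fin n) (c : ℝ) : ∑ k, chrZero x k k l * c = n * x l * c := by
  rw [← Finset.sum_mul]
  congr 1
  simp only [chrZero, Finset.sum_add_distrib, Finset.sum_sub_distrib, sum_mul_kd, sum_mul_kd',
    ← Finset.mul_sum, sum_kd_self]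
  ring

/-- Hyperbolic space is Einstein, `Ric = -(n-1) b`. The only input besides index contraction is
`|x|² = 1 - 2ρ`. -/
lemma ricZero_eq (hr : ∑ i, x i * x i = 1 - 2 * r) (i j : Fin n) :
    ricZero r x i j = -(n - 1) * kd i j := by
  have e1 : ∑ k, dchrZero r x k k i j = 2 * (r * kd i j + x i * x j)
      - kd i j * (r * n + ∑ i, x i * x i) := by
    simp only [dchrZero, Finset.sum_add_distrib, Finset.sum_sub_distrib, sum_mul_kd,
      ← Finset.mul_sum, sum_kd_self]
    rw [kd_comm j i]
    ring
  have e2 : ∑ k, dchrZero r x j k i k = n * (r * kd i j + x i * x j) := by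
    simp only [dchrZero, Finset.sum_add_distrib, Finset.sum_sub_distrib, sum_mul_kd, sum_kd_mul,
      ← Finset.mul_sum, sum_kd_self]
    ring
  have e3 : ∑ k, ∑ l, chrZero x k k l * chrZero x l i j
      = n * (2 * (x i * x j) - kd i j * ∑ i, x i * x i) := by
    rw [Finset.sum_comm]
    simp only [sum_chrZero_mul]
    have : ∀ l, n * x l * chrZero x l i j
        = n * (x i * (x l * kd j l) + x j * (x l * kd i l) - kd i j * (x l * x l)) := fun l => by
      simp only [chrZero]; ring
    simp only [this, ← Finset.mul_sum, Finset.sum_add_distrib, Finset.sum_sub_distrib, sum_mul_kd]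
    ring
  have e4 : ∑ k, ∑ l, chrZero x k j l * chrZero x l i k
      = (n + 2) * (x i * x j) - 2 * (kd i j * ∑ i, x i * x i) := by
    have : ∀ k, ∑ l, chrZero x k j l * chrZero x l i k
        = x j * chrZero x k i k + kd j k * (∑ l, x l * chrZero x l i k)
          - x k * chrZero x j i k := by
      intro k
      have : ∀ l, chrZero x k j l * chrZero x l i k = x j * (chrZero x l i k * kd l k)
          + kd j k * (x l * chrZero x l i k) - x k * (chrZero x l i k * kd j l) := fun l => by
        simp only [chrZero]; ring
      simp only [this, ← Finset.mul_sum, Finset.sum_add_distrib, Finset.sum_sub_distrib,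
        sum_mul_kd, sum_mul_kd']
    simp only [this, Finset.sum_add_distrib, Finset.sum_sub_distrib, sum_kd_mul]
    have f1 : ∀ i j, ∑ l, x l * chrZero x l i j = 2 * (x i * x j) - kd i j * ∑ i, x i * x i := by
      intro i j
      have : ∀ l, x l * chrZero x l i j
          = x i * (x l * kd j l) + x j * (x l * kd i l) - kd i j * (x l * x l) := fun l => by
        simp only [chrZero]; ring
      simp only [this, ← Finset.mul_sum, Finset.sum_add_distrib, Finset.sum_sub_distrib, sum_mul_kd]
      ring
    have f2 : ∀ k, chrZero x k i k = x i * kd k k := fun k => by simp only [chrZero]; ring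
    have f3 : ∀ k, x k * chrZero x j i k
        = x i * (x k * kd k j) + kd i j * (x k * x k) - x j * (x k * kd i k) := fun k => by
      simp only [chrZero]; ring
    simp only [f1, f2, f3, ← Finset.mul_sum, Finset.sum_add_distrib, Finset.sum_sub_distrib,
      sum_mul_kd, sum_mul_kd', sum_kd_self]
    ring
  simp only [ricZero, Finset.sum_add_distrib, Finset.sum_sub_distrib, e1, e2, e3, e4, hr]
  ring

lemma chrOne_symm (hh : ∀ i j, h i j = h j i) (hP : ∀ k i j, P k i j = P k j i) (k i j : Fin n) :
    chrOne x h P k i j = chrOne x h P k j i := by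
  simp only [chrOne]
  rw [hh i j, hP k i j, kd_comm i j]
  ring

lemma sum_chrOne_left (hh : ∀ i j, h i j = h j i) (hP : ∀ k i j, P k i j = P k j i) (l : Fin n) :
    ∑ k, chrOne x h P k k l = 1 / 2 * ∑ k, P l k k := by
  simp only [chrOne, Finset.sum_add_distrib, Finset.sum_sub_distrib, sum_kd_mul',
    ← Finset.mul_sum]
  simp only [hh l, fun k => hP k l k]
  ring

lemma sum_chrOne_right (l : Fin n) :
    ∑ i, chrOne x h P l i i = ∑ i, P i i l - 1 / 2 * ∑ i, P l i i - (∑ i, h i i) * x l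
      + n * ∑ m, h l m * x m := by
  simp only [chrOne, Finset.sum_add_distrib, Finset.sum_sub_distrib, ← Finset.sum_mul,
    ← Finset.mul_sum, sum_kd_self]
  ring

lemma sum_dchrOne_left (hQ : ∀ k l i j, Q k l i j = Q k l j i) :
    ∑ i, ∑ k, dchrOne r x h P Q k k i i
      = ∑ i, ∑ j, Q i j i j - 1 / 2 * ∑ i, ∑ j, Q i i j j - ∑ i, ∑ j, P j i i * x j
        + n * ∑ i, ∑ j, P i i j * x j - (∑ i, h i i) * (∑ i, x i * x i)
        + n * ∑ i, ∑ j, h i j * x i * x j := by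
  have e : ∀ i, ∑ k, dchrOne r x h P Q k k i i = ∑ k, Q k i k i - 1 / 2 * ∑ k, Q k k i i
      - ∑ k, P k i i * x k + kd i i * ∑ k, ∑ l, P k k l * x l - h i i * (r * n + ∑ i, x i * x i)
      + kd i i * (r * ∑ k, h k k + ∑ k, ∑ l, h k l * x k * x l) := by
    intro i
    simp only [dchrOne, Finset.sum_add_distrib, Finset.sum_sub_distrib, ← Finset.mul_sum,
      mul_add, sum_kd_self, fun k => hQ k i i k]
    have e2 : ∀ k, ∑ l, h k l * (r * kd l k) = r * h k k := fun k => by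
      rw [← sum_mul_kd' k (h k), Finset.mul_sum]
      exact Finset.sum_congr rfl fun l _ => by ring
    have e3 : ∀ k, ∑ l, h k l * (x l * x k) = ∑ l, h k l * x k * x l := fun k =>
      Finset.sum_congr rfl fun l _ => by ring
    simp only [e2, e3, ← Finset.mul_sum]
    ring
  simp only [e, Finset.sum_add_distrib, Finset.sum_sub_distrib, ← Finset.mul_sum,
    ← Finset.sum_mul, sum_kd_self]
  rw [Finset.sum_comm (f := fun i k => Q k i k i), Finset.sum_comm (f := fun i k => Q k k i i)]
  ring

lemma sum_dchrOne_right :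
    ∑ i, ∑ k, dchrOne r x h P Q i k i k = 1 / 2 * ∑ i, ∑ j, Q i i j j := by
  have e : ∀ i, ∑ k, dchrOne r x h P Q i k i k = 1 / 2 * ∑ k, Q i i k k := by
    intro i
    have e1 : ∀ k, dchrOne r x h P Q i k i k = 1 / 2 * Q i i k k - P i i k * x k
        + kd i k * (∑ l, P i k l * x l) - h i k * (r * kd k i + x k * x i)
        + kd i k * ∑ l, h k l * (r * kd l i + x l * x i) := fun k => by
      simp only [dchrOne]; ring
    simp only [e1, Finset.sum_add_distrib, Finset.sum_sub_distrib, ← Finset.mul_sum, sum_kd_mul]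
    ring
  simp only [e, ← Finset.mul_sum]

/-- The linearization of `Gⁱʲ Rᵢⱼ` has two sources: the trace of the linearized Ricci tensor, and
`-h` (the linearized inverse) paired with the Ricci tensor of `b`, which is `(n-1) tr h`. The
quadratic `ΓΓ` terms reduce to contractions with `t l = ∑ᵢ Γˡᵢᵢ` in linearized form or with the
trace of `P`. -/
lemma sum_kd_mul_ricOne_add (hr : ∑ i, x i * x i = 1 - 2 * r) (hh : ∀ i j, h i j = h j i)
    (hP : ∀ k i j, P k i j = P k j i) (hQ : ∀ k l i j, Q k l i j = Q k l j i) :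
    ∑ i, ∑ j, (kd i j * ricOne r x h P Q i j + -h i j * ricZero r x i j) = scalOne r x h P Q := by
  have e1 : ∀ i, ∑ j, (kd i j * ricOne r x h P Q i j + -h i j * ricZero r x i j)
      = ricOne r x h P Q i i + (n - 1) * h i i := by
    intro i
    rw [Finset.sum_add_distrib, sum_kd_mul]
    congr 1
    rw [← sum_mul_kd i (h i), Finset.mul_sum]
    exact Finset.sum_congr rfl fun j _ => by rw [ricZero_eq hr]; ring
  set t : Fin n → ℝ := fun l => ∑ i, chrOne x h P l i i with ht
  have a1 : ∑ i, ∑ k, ∑ l, chrZero x k k l * chrOne x h P l i i = n * ∑ l, x l * t l := by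
    have : ∀ i, ∑ k, ∑ l, chrZero x k k l * chrOne x h P l i i
        = ∑ l, n * x l * chrOne x h P l i i := fun i => by
      rw [Finset.sum_comm]; simp only [sum_chrZero_mul]
    simp only [this]
    rw [Finset.sum_comm]
    simp only [← Finset.mul_sum, mul_assoc, ht]
  have a2 : ∑ i, ∑ k, ∑ l, chrOne x h P k k l * chrZero x l i i
      = (2 - n) / 2 * ∑ i, ∑ j, P j i i * x j := by
    have : ∀ i, ∑ k, ∑ l, chrOne x h P k k l * chrZero x l i i
        = ∑ l, (1 / 2 * ∑ k, P l k k) * chrZero x l i i := fun i => by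
      rw [Finset.sum_comm]; simp only [← Finset.sum_mul, sum_chrOne_left hh hP]
    simp only [this]
    rw [Finset.sum_comm, Finset.sum_comm (f := fun i j => P j i i * x j)]
    simp only [← Finset.mul_sum, ← Finset.sum_mul]
    have : ∀ l, ∑ i, chrZero x l i i = (2 - n) * x l := fun l => by
      simp only [chrZero, Finset.sum_add_distrib, Finset.sum_sub_distrib, sum_mul_kd',
        ← Finset.mul_sum, sum_kd_self]
      ring
    simp only [this, Finset.mul_sum]
    exact Finset.sum_congr rfl fun l _ => by rw [← Finset.mul_sum]; ring
  have b : ∀ i k, ∑ l, chrOne x h P k i l * chrZero x l i k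
      = x i * chrOne x h P k k i + x k * chrOne x h P k i i - kd i k *
        ∑ l, x l * chrOne x h P k i l := by
    intro i k
    have : ∀ l, chrOne x h P k i l * chrZero x l i k = x i * (chrOne x h P k i l * kd k l)
        + x k * (chrOne x h P k i l * kd i l) - kd i k * (x l * chrOne x h P k i l) := fun l => by
      simp only [chrZero]; ring
    simp only [this, Finset.sum_add_distrib, Finset.sum_sub_distrib, ← Finset.mul_sum, sum_mul_kd]
    rw [chrOne_symm hh hP k i k]
  -- The first and third terms of `b`, after contraction, are the same double sum and cancel.
  have b' : ∑ i, ∑ k, ∑ l, chrOne x h P k i l * chrZero x l i k = ∑ l, x l * t l := by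
    simp only [b, Finset.sum_add_distrib, Finset.sum_sub_distrib, sum_kd_mul]
    have c1 : ∑ i, ∑ k, x i * chrOne x h P k k i = ∑ i, ∑ k, x k * chrOne x h P i i k := by
      rw [Finset.sum_comm]
    have c2 : ∑ i, ∑ k, x k * chrOne x h P k i i = ∑ l, x l * t l := by
      rw [Finset.sum_comm]; simp only [← Finset.mul_sum, ht]
    rw [c1, c2]
    ring
  have a4 : ∑ i, ∑ k, ∑ l, chrOne x h P k i l * chrZero x l i k = ∑ l, x l * t l := b'
  have a3 : ∑ i, ∑ k, ∑ l, chrZero x k i l * chrOne x h P l i k = ∑ l, x l * t l := by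
    rw [← b']
    refine Finset.sum_congr rfl fun i _ => ?_
    rw [Finset.sum_comm]
    exact Finset.sum_congr rfl fun k _ => Finset.sum_congr rfl fun l _ => by ring
  have a5 : ∑ l, x l * t l = ∑ i, ∑ j, P i i j * x j - 1 / 2 * ∑ i, ∑ j, P j i i * x j
      - (∑ i, h i i) * (∑ i, x i * x i) + n * ∑ i, ∑ j, h i j * x i * x j := by
    have e : ∀ l, x l * t l = ∑ i, P i i l * x l - 1 / 2 * ∑ i, P l i i * x l
        - (∑ i, h i i) * (x l * x l) + n * ∑ m, h l m * x l * x m := by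
      intro l
      have : ∑ m, h l m * x l * x m = x l * ∑ m, h l m * x m := by
        rw [Finset.mul_sum]; exact Finset.sum_congr rfl fun _ _ => by ring
      simp only [ht, sum_chrOne_right, this, ← Finset.sum_mul]
      ring
    rw [Finset.sum_comm (f := fun i j => P i i j * x j),
      Finset.sum_comm (f := fun i j => P j i i * x j)]
    simp only [e, Finset.sum_add_distrib, Finset.sum_sub_distrib, ← Finset.mul_sum]
  rw [Finset.sum_congr rfl fun i _ => e1 i]
  simp only [Finset.sum_add_distrib, ← Finset.mul_sum, ricOne, Finset.sum_sub_distrib,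
    sum_dchrOne_left hQ, sum_dchrOne_right, a1, a2, a3, a4, a5, hr, scalOne]
  ring

end Algebra

/-! ### Metrics asymptotic to the hyperbolic metric -/

lemma contDiffAt_det {E : Type*} [NormedAddCommGroup E] [NormedSpace ℝ E] {m : ℕ}
    {k : WithTop ℕ∞} {M : E → Matrix (Fin m) (Fin m) ℝ} {x : E}
    (hM : ∀ i j, ContDiffAt ℝ k (fun y => M y i j) x) :
    ContDiffAt ℝ k (fun y => (M y).det) x := by
  simp only [Matrix.det_apply]
  exact ContDiffAt.sum fun σ _ => (contDiffAt_prod fun i _ => hM _ _).const_smul _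

/-- Cramer's rule: entries of the inverse are quotients of determinants, where one row of the matrix
has been replaced by constants. -/
lemma contDiffAt_matrix_inv {E : Type*} [NormedAddCommGroup E] [NormedSpace ℝ E] {m : ℕ}
    {k : WithTop ℕ∞} {M : E → Matrix (Fin m) (Fin m) ℝ} {x : E}
    (hM : ∀ i j, ContDiffAt ℝ k (fun y => M y i j) x) (hx : (M x).det ≠ 0) (i j : Fin m) :
    ContDiffAt ℝ k (fun y => (M y)⁻¹ i j) x := by
  simp only [Matrix.inv_def, Ring.inverse_eq_inv', Matrix.smul_apply, smul_eq_mul,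
    Matrix.adjugate_apply]
  refine ((contDiffAt_det hM).inv hx).mul (contDiffAt_det fun a b => ?_)
  by_cases ha : a = j
  · subst ha
    simpa using contDiffAt_const
  · simpa [ha] using hM a b

/-- The matrix `δᵢⱼ + hᵢⱼ`. -/
def gam {n : ℕ} (h : Fin n → Fin n → Euc n → ℝ) (x : Euc n) : Matrix (Fin n) (Fin n) ℝ :=
  Matrix.of fun i j => kd i j + h i j x

/-- `G = ρ⁻² (δ + h)` with `h` decaying. -/
structure IsEndMetric {n : ℕ} (s : Euc n → ℝ) (G : Euc n → Tensor2 n)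
    (h : Fin n → Fin n → Euc n → ℝ) : Prop where
  tendsto : Tendsto s (ballEnd n) (𝓝 0)
  comp : ∀ᶠ x in ballEnd n, compMat G x = (rho x ^ 2)⁻¹ • gam h x
  symm : ∀ᶠ x in ballEnd n, ∀ i j, h i j x = h j i x
  decay : ∀ i j, Decay s (h i j)

/-! ### Expansion of the inverse metric, the connection and the curvature -/

namespace IsEndMetric

variable {n : ℕ} {s : Euc n → ℝ} {G : Euc n → Tensor2 n} {h : Fin n → Fin n → Euc n → ℝ}

lemma isBigO_one (H : IsEndMetric s G h) : s =O[ballEnd n] fun _ => (1 : ℝ) :=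
  H.tendsto.isBigO_one ℝ

lemma of_kd : (Matrix.of fun i j : Fin n => kd i j) = 1 := by
  ext i j
  simp [kd, Matrix.one_apply]

lemma one_eq_kd (i j : Fin n) : (1 : Matrix (Fin n) (Fin n) ℝ) i j = kd i j := by
  simp [kd, Matrix.one_apply]

lemma gam_eq (x : Euc n) : gam h x = 1 + Matrix.of fun i j => h i j x := by
  rw [← of_kd]; rfl

lemma tendsto_gam (H : IsEndMetric s G h) : Tendsto (gam h) (ballEnd n) (𝓝 1) := by
  rw [← of_kd]
  refine tendsto_pi_nhds.2 fun i => tendsto_pi_nhds.2 fun j => ?_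
  simpa [gam] using ((H.decay i j).tendsto_zero H.tendsto).const_add (kd i j)

lemma tendsto_det (H : IsEndMetric s G h) :
    Tendsto (fun x => (gam h x).det) (ballEnd n) (𝓝 1) := by
  have : Continuous fun M : Matrix (Fin n) (Fin n) ℝ => M.det := continuous_id.matrix_det
  simpa [Function.comp_def] using (this.tendsto 1).comp H.tendsto_gam

lemma det_ne_zero (H : IsEndMetric s G h) : ∀ᶠ x in ballEnd n, (gam h x).det ≠ 0 :=
  H.tendsto_det.eventually_ne one_ne_zero

lemma tendsto_inv (H : IsEndMetric s G h) (i j : Fin n) :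
    Tendsto (fun x => (gam h x)⁻¹ i j) (ballEnd n) (𝓝 (kd i j)) := by
  have : Continuous fun M : Matrix (Fin n) (Fin n) ℝ => M.adjugate := continuous_id.matrix_adjugate
  have h1 := (this.tendsto 1).comp H.tendsto_gam
  have h2 := ((H.tendsto_det.inv₀ one_ne_zero).mul
    ((tendsto_pi_nhds.1 (tendsto_pi_nhds.1 h1 i)) j))
  simpa [Matrix.inv_def, Ring.inverse_eq_inv', one_eq_kd] using h2

lemma mul_inv (H : IsEndMetric s G h) : ∀ᶠ x in ballEnd n,
    gam h x * (gam h x)⁻¹ = 1 ∧ (gam h x)⁻¹ * gam h x = 1 := by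
  filter_upwards [H.det_ne_zero] with x hx
  have : IsUnit (gam h x).det := isUnit_iff_ne_zero.2 hx
  exact ⟨Matrix.mul_nonsing_inv _ this, Matrix.nonsing_inv_mul _ this⟩

lemma isBigO_inv (H : IsEndMetric s G h) (i j : Fin n) :
    (fun x => (gam h x)⁻¹ i j) =O[ballEnd n] fun _ => (1 : ℝ) :=
  (H.tendsto_inv i j).isBigO_one ℝ

lemma firstOrder_inv (H : IsEndMetric s G h) (i j : Fin n) :
    FirstOrder (ballEnd n) s (fun x => (gam h x)⁻¹ i j) (fun _ => kd i j)
      (fun x => -h i j x) := by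
  refine ⟨isBigO_const_const _ one_ne_zero _, (H.decay i j).zero.neg_left, ?_⟩
  have h1 : (fun x => ∑ a, (∑ b, (gam h x)⁻¹ i b * h b a x) * h a j x)
      =O[ballEnd n] fun x => s x ^ 2 := by
    refine IsBigO.fun_sum fun a _ => ?_
    have : (fun x => ∑ b, (gam h x)⁻¹ i b * h b a x) =O[ballEnd n] s :=
      IsBigO.fun_sum fun b _ => by simpa using (H.isBigO_inv i b).mul (H.decay b a).zero
    simpa only [pow_two] using this.mul (H.decay a j).zero
  refine h1.congr' ?_ EventuallyEq.rfl
  filter_upwards [H.mul_inv] with x hx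
  -- The exact identity `A⁻¹ = 1 - h + A⁻¹ h h` for `A = 1 + h`; its last term is the quadratic
  -- remainder.
  have e : (gam h x)⁻¹ = 1 - (Matrix.of fun i j => h i j x)
      + (gam h x)⁻¹ * (Matrix.of fun i j => h i j x) * Matrix.of fun i j => h i j x := by
    have e1 : (gam h x)⁻¹ * (Matrix.of fun i j => h i j x) = 1 - (gam h x)⁻¹ := by
      have := hx.2
      nth_rewrite 2 [gam_eq] at this
      rw [mul_add, mul_one] at this
      exact eq_sub_of_add_eq' this
    rw [e1, sub_mul, one_mul, e1]
    abel
  have e2 := congrFun (congrFun e i) j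
  have e3 : ((gam h x)⁻¹ * (Matrix.of fun i j => h i j x) * Matrix.of fun i j => h i j x) i j
      = ∑ a, (∑ b, (gam h x)⁻¹ i b * h b a x) * h a j x := by
    simp [Matrix.mul_apply]
  rw [Matrix.add_apply, Matrix.sub_apply, e3, one_eq_kd, Matrix.of_apply] at e2
  linarith

lemma smooth_all (H : IsEndMetric s G h) :
    ∀ᶠ x in ballEnd n, ∀ i j, ContDiffAt ℝ 2 (h i j) x :=
  eventually_all.2 fun i => eventually_all.2 fun j => (H.decay i j).smooth

lemma smooth_inv (H : IsEndMetric s G h) :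
    ∀ᶠ x in ballEnd n, ∀ i j, ContDiffAt ℝ 2 (fun y => (gam h y)⁻¹ i j) x := by
  filter_upwards [H.smooth_all, H.det_ne_zero] with x h1 h2 i j
  exact contDiffAt_matrix_inv (fun i j => contDiffAt_const.add (h1 i j)) h2 i j

/-- `∂(A⁻¹) = -A⁻¹ (∂A) A⁻¹`, from differentiating `A⁻¹ A = 1` near `x` and multiplying by `A⁻¹` on
the right. -/
lemma pd_inv (H : IsEndMetric s G h) : ∀ᶠ x in ballEnd n, ∀ m i j,
    pd m (fun y => (gam h y)⁻¹ i j) x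
      = -∑ b, (∑ a, (gam h x)⁻¹ i a * pd m (h a b) x) * (gam h x)⁻¹ b j := by
  filter_upwards [H.smooth_all, H.smooth_inv, H.mul_inv, eventually_eventually_ballEnd H.mul_inv]
    with x h1 h2 h3 h4 m i j
  have hd : ∀ i j, DifferentiableAt ℝ (fun y => (gam h y)⁻¹ i j) x := fun i j =>
    (h2 i j).differentiableAt (by simp)
  have hg : ∀ i j, DifferentiableAt ℝ (fun y => gam h y i j) x := fun i j =>
    (contDiffAt_const.add (h1 i j)).differentiableAt (by simp)
  have hpg : ∀ i j, pd m (fun y => gam h y i j) x = pd m (h i j) x := fun i j => by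
    have := pd_add (f := fun _ => kd i j) (g := h i j) (x := x) (by fun_prop)
      ((h1 i j).differentiableAt (by simp)) m
    simpa [gam] using this
  have key : ∀ b, ∑ a, (pd m (fun y => (gam h y)⁻¹ i a) x * gam h x a b
      + (gam h x)⁻¹ i a * pd m (h a b) x) = 0 := by
    intro b
    have e : (fun y => ∑ a, (gam h y)⁻¹ i a * gam h y a b) =ᶠ[𝓝 x] fun _ => kd i b := by
      filter_upwards [h4] with y hy
      have := congrFun (congrFun hy.2 i) b
      rwa [Matrix.mul_apply, one_eq_kd] at this
    have e2 := pd_congr e m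
    rw [pd_sum (fun a _ => (hd i a).fun_mul (hg a b)), pd_const] at e2
    rw [← e2]
    exact Finset.sum_congr rfl fun a _ => by rw [pd_mul (hd i a) (hg a b), hpg]
  have key2 : ∀ b, ∑ a, pd m (fun y => (gam h y)⁻¹ i a) x * gam h x a b
      = -∑ a, (gam h x)⁻¹ i a * pd m (h a b) x := fun b => by
    have := key b
    rw [Finset.sum_add_distrib] at this
    linarith
  have : ∑ b, (∑ a, pd m (fun y => (gam h y)⁻¹ i a) x * gam h x a b) * (gam h x)⁻¹ b j
      = pd m (fun y => (gam h y)⁻¹ i j) x := by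
    simp only [Finset.sum_mul]
    rw [Finset.sum_comm]
    have e3 : ∀ a, ∑ b, pd m (fun y => (gam h y)⁻¹ i a) x * gam h x a b * (gam h x)⁻¹ b j
        = pd m (fun y => (gam h y)⁻¹ i a) x * kd a j := fun a => by
      have := congrFun (congrFun h3.1 a) j
      rw [Matrix.mul_apply, one_eq_kd] at this
      rw [← this, Finset.mul_sum]
      exact Finset.sum_congr rfl fun _ _ => by ring
    simp only [e3, sum_mul_kd']
  rw [← this]
  simp only [key2, neg_mul, Finset.sum_neg_distrib]

lemma firstOrder_pd (H : IsEndMetric s G h) (m i j : Fin n) :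
    FirstOrder (ballEnd n) s (fun x => rho x * pd m (h i j) x) (fun _ => 0)
      (fun x => rho x * pd m (h i j) x) :=
  FirstOrder.small ((H.decay i j).one m)

lemma firstOrder_pd_inv (H : IsEndMetric s G h) (m i j : Fin n) :
    FirstOrder (ballEnd n) s (fun x => rho x * pd m (fun y => (gam h y)⁻¹ i j) x) (fun _ => 0)
      (fun x => -(rho x * pd m (h i j) x)) := by
  have := (FirstOrder.sum (t := Finset.univ) fun b _ => FirstOrder.mul H.isBigO_one
    (FirstOrder.sum (t := Finset.univ) fun a _ => FirstOrder.mul H.isBigO_one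
      (H.firstOrder_inv i a) (H.firstOrder_pd m a b)) (H.firstOrder_inv b j)).neg
  refine (this.congr_left ?_).congr (Eventually.of_forall fun x => ?_)
    (Eventually.of_forall fun x => ?_)
  · filter_upwards [H.pd_inv] with x hx
    rw [hx m i j, mul_neg, Finset.mul_sum]
    congr 1
    refine Finset.sum_congr rfl fun b _ => ?_
    rw [← mul_assoc, Finset.mul_sum]
    congr 1
    exact Finset.sum_congr rfl fun a _ => by ring
  · simp
  · simp [sum_kd_mul, sum_mul_kd']

/-- The Christoffel symbols of `ρ⁻² (δ + h)`. -/
def chr (h : Fin n → Fin n → Euc n → ℝ) (k i j : Fin n) (y : Euc n) : ℝ :=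
  1 / 2 * ∑ l, (gam h y)⁻¹ k l * (pd i (h j l) y + pd j (h i l) y - pd l (h i j) y)
    + (rho y)⁻¹ * (y i * kd j k + y j * kd i k
      - (kd i j + h i j y) * ∑ l, (gam h y)⁻¹ k l * y l)

lemma invComp_eq (H : IsEndMetric s G h) :
    ∀ᶠ x in ballEnd n, invComp G x = rho x ^ 2 • (gam h x)⁻¹ := by
  filter_upwards [H.comp, eventually_rho_pos n, H.mul_inv] with x h1 h2 h3
  rw [invComp, h1]
  refine Matrix.inv_eq_right_inv ?_
  rw [smul_mul_smul_comm, h3.1, inv_mul_cancel₀ (by positivity), one_smul]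

lemma christoffel_eq (H : IsEndMetric s G h) :
    ∀ᶠ x in ballEnd n, ∀ k i j, christoffel G k i j x = chr h k i j x := by
  filter_upwards [eventually_eventually_ballEnd H.comp, H.invComp_eq, eventually_rho_pos n,
    H.mul_inv, H.smooth_all, H.symm] with x h1 h2 h3 h4 h5 h6 k i j
  have hpd : ∀ m i j, pd m (fun y => compMat G y i j) x
      = (rho x ^ 2)⁻¹ * (pd m (h i j) x + 2 * (rho x)⁻¹ * (x m * (kd i j + h i j x))) := by
    intro m i j
    have e : (fun y => compMat G y i j) =ᶠ[𝓝 x]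
        fun y => ((rho y)⁻¹ * (rho y)⁻¹) * (kd i j + h i j y) := by
      filter_upwards [h1] with y hy
      rw [hy, Matrix.smul_apply, smul_eq_mul, gam, Matrix.of_apply, pow_two, mul_inv_rev]
    have d1 : DifferentiableAt ℝ (fun y : Euc n => (rho y)⁻¹) x :=
      differentiableAt_rho.fun_inv h3.ne'
    have d2 := (h5 i j).differentiableAt (by simp)
    rw [pd_congr e, pd_mul (d1.fun_mul d1) (d2.const_add _), pd_mul d1 d1, pd_inv_rho h3.ne',
      pd_add (f := fun _ => kd i j) (by fun_prop) d2, pd_const]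
    field_simp
    ring
  -- Derivatives of `ρ⁻²` multiply the metric itself, so two of the three conformal terms contract
  -- with the inverse metric to Kronecker deltas; only the third keeps `(δ + h)⁻¹ x`.
  have hs : ∀ c : Fin n, ∑ l, (gam h x)⁻¹ k l * (kd c l + h c l x) = kd c k := by
    intro c
    have := congrFun (congrFun h4.2 k) c
    rw [Matrix.mul_apply, one_eq_kd, kd_comm] at this
    rw [← this]
    refine Finset.sum_congr rfl fun l _ => ?_
    rw [gam, Matrix.of_apply, h6 c l, kd_comm c l]
  have e1 : ∀ l, invComp G x k l * (pd i (fun y => compMat G y j l) x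
      + pd j (fun y => compMat G y i l) x - pd l (fun y => compMat G y i j) x)
      = (gam h x)⁻¹ k l * (pd i (h j l) x + pd j (h i l) x - pd l (h i j) x)
        + 2 * (rho x)⁻¹ * (x i * ((gam h x)⁻¹ k l * (kd j l + h j l x))
          + x j * ((gam h x)⁻¹ k l * (kd i l + h i l x))
          - (kd i j + h i j x) * ((gam h x)⁻¹ k l * x l)) := by
    intro l
    rw [h2, Matrix.smul_apply, smul_eq_mul, hpd, hpd, hpd]
    field_simp
    ring
  rw [christoffel, chr, Finset.sum_congr rfl fun l _ => e1 l, Finset.sum_add_distrib,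
    ← Finset.mul_sum, Finset.sum_sub_distrib, Finset.sum_add_distrib, ← Finset.mul_sum,
    ← Finset.mul_sum, ← Finset.mul_sum, hs, hs]
  ring

lemma firstOrder_coord (i : Fin n) :
    FirstOrder (ballEnd n) s (fun x => x i) (fun x => x i) fun _ => 0 :=
  FirstOrder.bounded (isBigO_coord i)

lemma firstOrder_rho : FirstOrder (ballEnd n) s rho rho fun _ => 0 :=
  FirstOrder.bounded isBigO_rho

lemma firstOrder_gam (H : IsEndMetric s G h) (i j : Fin n) :
    FirstOrder (ballEnd n) s (fun x => kd i j + h i j x) (fun _ => kd i j) (h i j) :=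
  ((FirstOrder.const (kd i j)).add (FirstOrder.small (H.decay i j).zero)).congr
    (Eventually.of_forall fun _ => by simp) (Eventually.of_forall fun _ => by simp)

lemma firstOrder_inv_coord (H : IsEndMetric s G h) (k : Fin n) :
    FirstOrder (ballEnd n) s (fun x => ∑ l, (gam h x)⁻¹ k l * x l) (fun x => x k)
      (fun x => -∑ l, h k l x * x l) :=
  (FirstOrder.sum (t := Finset.univ) fun l _ => FirstOrder.mul H.isBigO_one
    (H.firstOrder_inv k l) (firstOrder_coord l)).congr
    (Eventually.of_forall fun x => by simp [sum_kd_mul])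
    (Eventually.of_forall fun x => by simp)

lemma firstOrder_christoffel (H : IsEndMetric s G h) (k i j : Fin n) :
    FirstOrder (ballEnd n) s (fun x => rho x * christoffel G k i j x)
      (fun x => chrZero x k i j)
      (fun x => chrOne x (fun i j => h i j x) (fun m i j => rho x * pd m (h i j) x) k i j) := by
  have hO := H.isBigO_one
  have f1 := FirstOrder.mul hO (FirstOrder.const (1 / 2)) (FirstOrder.sum (t := Finset.univ)
    fun l _ => FirstOrder.mul hO (H.firstOrder_inv k l)
      (((H.firstOrder_pd i j l).add (H.firstOrder_pd j i l)).sub (H.firstOrder_pd l i j)))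
  have f2 := ((FirstOrder.mul hO (firstOrder_coord i) (FirstOrder.const (kd j k))).add
    (FirstOrder.mul hO (firstOrder_coord j) (FirstOrder.const (kd i k)))).sub
    (FirstOrder.mul hO (H.firstOrder_gam i j) (H.firstOrder_inv_coord k))
  refine ((f1.add f2).congr_left ?_).congr (Eventually.of_forall fun x => ?_)
    (Eventually.of_forall fun x => ?_)
  · filter_upwards [H.christoffel_eq, eventually_rho_pos n] with x hx hr
    rw [hx, chr, mul_add, ← mul_assoc (rho x) (rho x)⁻¹, mul_inv_cancel₀ hr.ne', one_mul]
    congr 1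
    rw [mul_left_comm]
    congr 1
    rw [Finset.mul_sum]
    exact Finset.sum_congr rfl fun l _ => by ring
  · simp [chrZero]
    ring
  · simp only [mul_zero, zero_mul, add_zero, sub_zero, sum_kd_mul, chrOne]
    ring

/-- The two factors `ρ` are distributed so that every factor is one whose expansion is known: `ρ ∂(δ
+ h)⁻¹`, `ρ ∂h`, `ρ² ∂²h`, `x`, `ρ`. The first-order calculus then applies term by term. -/
lemma pd_christoffel (H : IsEndMetric s G h) : ∀ᶠ x in ballEnd n, ∀ m k i j,
    rho x ^ 2 * pd m (christoffel G k i j) x =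
      1 / 2 * ∑ l, ((rho x * pd m (fun y => (gam h y)⁻¹ k l) x)
          * (rho x * pd i (h j l) x + rho x * pd j (h i l) x - rho x * pd l (h i j) x)
        + (gam h x)⁻¹ k l * (rho x ^ 2 * pd m (pd i (h j l)) x + rho x ^ 2 * pd m (pd j (h i l)) x
          - rho x ^ 2 * pd m (pd l (h i j)) x))
      + (x m * (x i * kd j k + x j * kd i k
          - (kd i j + h i j x) * ∑ l, (gam h x)⁻¹ k l * x l)
        + (rho x * (kd m i * kd j k + kd m j * kd i k)
          - ((rho x * pd m (h i j) x) * (∑ l, (gam h x)⁻¹ k l * x l)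
            + (kd i j + h i j x) * ∑ l, ((rho x * pd m (fun y => (gam h y)⁻¹ k l) x) * x l
              + (gam h x)⁻¹ k l * (rho x * kd m l))))) := by
  filter_upwards [eventually_eventually_ballEnd H.christoffel_eq, eventually_rho_pos n,
    H.smooth_all, H.smooth_inv] with x h1 h2 h3 h4 m k i j
  have hA : ∀ l, DifferentiableAt ℝ (fun y => (gam h y)⁻¹ k l) x := fun l =>
    (h4 k l).differentiableAt (by simp)
  have hh : DifferentiableAt ℝ (h i j) x := (h3 i j).differentiableAt (by simp)
  have hp : ∀ m i j, DifferentiableAt ℝ (pd m (h i j)) x := fun m i j =>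
    differentiableAt_pd (h3 i j) m
  have hr : DifferentiableAt ℝ (fun y : Euc n => (rho y)⁻¹) x := differentiableAt_rho.fun_inv h2.ne'
  have hx : ∀ l, DifferentiableAt ℝ (fun y : Euc n => y l) x := fun l => differentiableAt_coord l
  have hc : ∀ l, DifferentiableAt ℝ
      (fun y => pd i (h j l) y + pd j (h i l) y - pd l (h i j) y) x := fun l =>
    ((hp i j l).fun_add (hp j i l)).fun_sub (hp l i j)
  have hS : DifferentiableAt ℝ (fun y => ∑ l, (gam h y)⁻¹ k l * y l) x :=
    DifferentiableAt.fun_sum fun l _ => (hA l).fun_mul (hx l)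
  have hg : DifferentiableAt ℝ (fun y => kd i j + h i j y) x := hh.const_add _
  have hxk : ∀ l (c : ℝ), DifferentiableAt ℝ (fun y : Euc n => y l * c) x := fun l c =>
    (hx l).mul_const c
  have hL : DifferentiableAt ℝ (fun y : Euc n => y i * kd j k + y j * kd i k) x :=
    (hxk i _).fun_add (hxk j _)
  have e : christoffel G k i j =ᶠ[𝓝 x] chr h k i j := by
    filter_upwards [h1] with y hy using hy k i j
  have p1 : pd m (fun y => ∑ l, (gam h y)⁻¹ k l *
      (pd i (h j l) y + pd j (h i l) y - pd l (h i j) y)) x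
      = ∑ l, (pd m (fun y => (gam h y)⁻¹ k l) x
          * (pd i (h j l) x + pd j (h i l) x - pd l (h i j) x)
        + (gam h x)⁻¹ k l * (pd m (pd i (h j l)) x + pd m (pd j (h i l)) x
          - pd m (pd l (h i j)) x)) := by
    rw [pd_sum fun l _ => (hA l).fun_mul (hc l)]
    refine Finset.sum_congr rfl fun l _ => ?_
    rw [pd_mul (hA l) (hc l), pd_sub ((hp i j l).fun_add (hp j i l)) (hp l i j),
      pd_add (hp i j l) (hp j i l)]
  have p2 : pd m (fun y => ∑ l, (gam h y)⁻¹ k l * y l) x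
      = ∑ l, (pd m (fun y => (gam h y)⁻¹ k l) x * x l + (gam h x)⁻¹ k l * kd m l) := by
    rw [pd_sum fun l _ => (hA l).fun_mul (hx l)]
    refine Finset.sum_congr rfl fun l _ => ?_
    rw [pd_mul (hA l) (hx l), pd_coord]
    rfl
  have p3 : pd m (fun y => kd i j + h i j y) x = pd m (h i j) x := by
    rw [pd_add (f := fun _ => kd i j) (by fun_prop) hh, pd_const, zero_add]
  have p4 : pd m (fun y : Euc n => y i * kd j k + y j * kd i k) x
      = kd m i * kd j k + kd m j * kd i k := by
    rw [pd_add (hxk i _) (hxk j _), pd_mul (hx i) (by fun_prop), pd_mul (hx j) (by fun_prop),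
      pd_coord, pd_coord, pd_const, pd_const, mul_zero, mul_zero, add_zero, add_zero]
    rfl
  have hfirst : DifferentiableAt ℝ (fun y => ∑ l, (gam h y)⁻¹ k l *
      (pd i (h j l) y + pd j (h i l) y - pd l (h i j) y)) x :=
    DifferentiableAt.fun_sum fun l _ => (hA l).fun_mul (hc l)
  rw [pd_congr e]
  unfold chr
  rw [pd_add (hfirst.const_mul _) (hr.fun_mul (hL.fun_sub (hg.fun_mul hS))), pd_const_mul _ hfirst,
    pd_mul hr (hL.fun_sub (hg.fun_mul hS)), pd_sub hL (hg.fun_mul hS), pd_mul hg hS, p1, p2, p3, p4,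
    pd_inv_rho h2.ne']
  have q1 : ∑ l, ((rho x * pd m (fun y => (gam h y)⁻¹ k l) x)
          * (rho x * pd i (h j l) x + rho x * pd j (h i l) x - rho x * pd l (h i j) x)
        + (gam h x)⁻¹ k l * (rho x ^ 2 * pd m (pd i (h j l)) x + rho x ^ 2 * pd m (pd j (h i l)) x
          - rho x ^ 2 * pd m (pd l (h i j)) x))
      = rho x ^ 2 * ∑ l, (pd m (fun y => (gam h y)⁻¹ k l) x
          * (pd i (h j l) x + pd j (h i l) x - pd l (h i j) x)
        + (gam h x)⁻¹ k l * (pd m (pd i (h j l)) x + pd m (pd j (h i l)) x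
          - pd m (pd l (h i j)) x)) := by
    rw [Finset.mul_sum]
    exact Finset.sum_congr rfl fun l _ => by ring
  have q2 : ∑ l, ((rho x * pd m (fun y => (gam h y)⁻¹ k l) x) * x l
              + (gam h x)⁻¹ k l * (rho x * kd m l))
      = rho x * ∑ l, (pd m (fun y => (gam h y)⁻¹ k l) x * x l + (gam h x)⁻¹ k l * kd m l) := by
    rw [Finset.mul_sum]
    exact Finset.sum_congr rfl fun l _ => by ring
  rw [q1, q2]
  field_simp

lemma firstOrder_pd_christoffel (H : IsEndMetric s G h) (m k i j : Fin n) :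
    FirstOrder (ballEnd n) s (fun x => rho x ^ 2 * pd m (christoffel G k i j) x)
      (fun x => dchrZero (rho x) x m k i j)
      (fun x => dchrOne (rho x) x (fun i j => h i j x) (fun m i j => rho x * pd m (h i j) x)
        (fun m l i j => rho x ^ 2 * pd m (pd l (h i j)) x) m k i j) := by
  have hO := H.isBigO_one
  have hq : ∀ m l i j, FirstOrder (ballEnd n) s (fun x => rho x ^ 2 * pd m (pd l (h i j)) x)
      (fun _ => 0) (fun x => rho x ^ 2 * pd m (pd l (h i j)) x) := fun m l i j =>
    FirstOrder.small ((H.decay i j).two m l)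
  have f1 := FirstOrder.mul hO (FirstOrder.const (1 / 2)) (FirstOrder.sum (t := Finset.univ)
    fun l _ => (FirstOrder.mul hO (H.firstOrder_pd_inv m k l)
      (((H.firstOrder_pd i j l).add (H.firstOrder_pd j i l)).sub (H.firstOrder_pd l i j))).add
      (FirstOrder.mul hO (H.firstOrder_inv k l) (((hq m i j l).add (hq m j i l)).sub (hq m l i j))))
  have f2 := ((FirstOrder.mul hO (firstOrder_coord i) (FirstOrder.const (kd j k))).add
    (FirstOrder.mul hO (firstOrder_coord j) (FirstOrder.const (kd i k)))).sub
    (FirstOrder.mul hO (H.firstOrder_gam i j) (H.firstOrder_inv_coord k))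
  have f3 := FirstOrder.mul hO (firstOrder_coord m) f2
  have f4 := FirstOrder.mul hO (firstOrder_rho (s := s))
    (FirstOrder.const (kd m i * kd j k + kd m j * kd i k))
  have f5 := FirstOrder.mul hO (H.firstOrder_pd m i j) (H.firstOrder_inv_coord k)
  have f6 := FirstOrder.mul hO (H.firstOrder_gam i j) (FirstOrder.sum (t := Finset.univ)
    fun l _ => (FirstOrder.mul hO (H.firstOrder_pd_inv m k l) (firstOrder_coord l)).add
      (FirstOrder.mul hO (H.firstOrder_inv k l)
        (FirstOrder.mul hO (firstOrder_rho (s := s)) (FirstOrder.const (kd m l)))))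
  refine ((f1.add (f3.add (f4.sub (f5.add f6)))).congr_left ?_).congr
    (Eventually.of_forall fun x => ?_) (Eventually.of_forall fun x => ?_)
  · filter_upwards [H.pd_christoffel] with x hx
    rw [hx]
  · simp only [mul_zero, zero_mul, add_zero, zero_add, sub_zero, Finset.sum_const_zero, sum_kd_mul,
      dchrZero]
    rw [kd_comm m i, kd_comm m j, kd_comm m k]
    ring
  · simp only [mul_zero, zero_mul, add_zero, zero_add, sub_zero, Finset.sum_const_zero, sum_kd_mul,
      dchrOne, Finset.sum_add_distrib, neg_mul, Finset.sum_neg_distrib]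
    have e : ∑ l, h k l x * (rho x * kd l m + x l * x m)
        = ∑ l, h k l x * (rho x * kd m l) + x m * ∑ l, h k l x * x l := by
      rw [Finset.mul_sum, ← Finset.sum_add_distrib]
      exact Finset.sum_congr rfl fun l _ => by rw [kd_comm l m]; ring
    rw [e, kd_comm m k]
    ring

lemma firstOrder_ricci (H : IsEndMetric s G h) (i j : Fin n) :
    FirstOrder (ballEnd n) s (fun x => rho x ^ 2 * ricci G i j x)
      (fun x => ricZero (rho x) x i j)
      (fun x => ricOne (rho x) x (fun i j => h i j x) (fun m i j => rho x * pd m (h i j) x)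
        (fun m l i j => rho x ^ 2 * pd m (pd l (h i j)) x) i j) := by
  have hO := H.isBigO_one
  have f := FirstOrder.sum (t := Finset.univ) fun k _ =>
    ((H.firstOrder_pd_christoffel k k i j).sub (H.firstOrder_pd_christoffel j k i k)).add
    (FirstOrder.sum (t := Finset.univ) fun l _ =>
      (FirstOrder.mul hO (H.firstOrder_christoffel k k l) (H.firstOrder_christoffel l i j)).sub
      (FirstOrder.mul hO (H.firstOrder_christoffel k j l) (H.firstOrder_christoffel l i k)))
  refine f.congr_left (Eventually.of_forall fun x => ?_)
  simp only [ricci, Finset.mul_sum, mul_add, mul_sub]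
  refine Finset.sum_congr rfl fun k _ => ?_
  congr 1
  exact Finset.sum_congr rfl fun l _ => by ring

lemma sum_coord_sq (x : Euc n) : ∑ i, x i * x i = 1 - 2 * rho x := by
  have := EuclideanSpace.real_norm_sq_eq x
  unfold rho
  rw [this]
  simp only [pow_two]
  ring

/-- The linearization of the scalar curvature at the hyperbolic metric, in terms of `h`. -/
def linScal (h : Fin n → Fin n → Euc n → ℝ) (x : Euc n) : ℝ :=
  scalOne (rho x) x (fun i j => h i j x) (fun m i j => rho x * pd m (h i j) x)
    (fun m l i j => rho x ^ 2 * pd m (pd l (h i j)) x)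

/-- The Ricci factor `ρ²` cancels the `ρ²` of the inverse metric, so the scalar curvature is the
trace of `ρ² Ric` with `(δ + h)⁻¹`, a product of expanded quantities. Only the quadratic remainder
is left after removing `-n(n-1)` and the linear part. -/
lemma firstOrder_scalarCurvature (H : IsEndMetric s G h) :
    (fun x => scalarCurvature G x + n * (n - 1) - linScal h x)
      =O[ballEnd n] fun x => s x ^ 2 := by
  have hO := H.isBigO_one
  have f := FirstOrder.sum (t := Finset.univ) fun i _ => FirstOrder.sum (t := Finset.univ)
    fun j _ => FirstOrder.mul hO (H.firstOrder_inv i j) (H.firstOrder_ricci i j)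
  refine f.rem.congr' ?_ EventuallyEq.rfl
  filter_upwards [H.invComp_eq, H.symm, eventually_eventually_ballEnd H.symm,
    eventually_eventually_ballEnd (eventually_eventually_ballEnd H.symm)] with x h1 h2 h3 h4
  have hr := sum_coord_sq x
  have e0 : ∑ i : Fin n, ∑ j, kd i j * ricZero (rho x) x i j = -(n * (n - 1)) := by
    simp only [sum_kd_mul, ricZero_eq hr, ← Finset.mul_sum, sum_kd_self]
    ring
  -- Symmetry of `h` holds only near infinity; the eventual form on neighbourhoods transfers it to
  -- first and second derivatives.
  have hP : ∀ k i j, pd k (h i j) x = pd k (h j i) x := fun k i j =>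
    pd_congr (h3.mono fun y hy => hy i j) k
  have hQ : ∀ k l i j, pd k (pd l (h i j)) x = pd k (pd l (h j i)) x := fun k l i j =>
    pd_congr (h4.mono fun y hy => pd_congr (hy.mono fun z hz => hz i j) l) k
  rw [e0, sum_kd_mul_ricOne_add hr (fun i j => h2 i j) (fun k i j => by rw [hP k i j])
    (fun k l i j => by rw [hQ k l i j])]
  have e1 : scalarCurvature G x = ∑ i, ∑ j, (gam h x)⁻¹ i j * (rho x ^ 2 * ricci G i j x) := by
    rw [scalarCurvature, h1]
    refine Finset.sum_congr rfl fun i _ => Finset.sum_congr rfl fun j _ => ?_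
    rw [Matrix.smul_apply, smul_eq_mul]
    ring
  rw [e1, linScal]
  ring

end IsEndMetric

/-! ### The mass 1-form -/

/-- The mass 1-form of `e = ρ⁻² h`. -/
def massH {n : ℕ} (h : Fin n → Fin n → Euc n → ℝ) (V : Euc n → ℝ) (j : Fin n) (x : Euc n) : ℝ :=
  V x * (∑ i, pd i (h i j) x + (rho x)⁻¹ * (n * ∑ i, x i * h i j x - x j * ∑ i, h i i x)
      - ∑ i, pd j (h i i) x)
    - ∑ i, h i j x * pd i V x + (∑ i, h i i x) * pd j V x

/-- The density `ρ^{2-n}`, by which the flux with respect to `b` of a 1-form turns into a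
Euclidean flux. -/
def fluxWeight {n : ℕ} (x : Euc n) : ℝ := (rho x)⁻¹ ^ (n - 2)

/-- Functions with `∇²V = V b`. -/
structure IsPotential {n : ℕ} (V : Euc n → ℝ) : Prop where
  smooth : ∀ x, rho x ≠ 0 → ContDiffAt ℝ 2 V x
  hess : ∀ x, rho x ≠ 0 → ∀ i j, pd i (pd j V) x
    = (rho x)⁻¹ * (x i * pd j V x + x j * pd i V x - kd i j * ∑ k, x k * pd k V x)
      + V x * kd i j * (rho x)⁻¹ ^ 2
  bound : (fun x => rho x * V x) =O[ballEnd n] fun _ => (1 : ℝ)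
  bound_pd : ∀ i, (fun x => rho x ^ 2 * pd i V x) =O[ballEnd n] fun _ => (1 : ℝ)

/-! ### The potentials in `𝒩` -/

section Potential

variable {n : ℕ} {V W : Euc n → ℝ}

lemma isPotential_zero : IsPotential (0 : Euc n → ℝ) := by
  have h0 : ∀ j : Fin n, pd j (0 : Euc n → ℝ) = fun _ => 0 := fun j => by
    ext x; exact pd_const 0 j
  refine ⟨fun x _ => contDiffAt_const, fun x _ i j => ?_, ?_, fun i => ?_⟩
  · simp [h0]
  · simp only [Pi.zero_apply, mul_zero]
    exact isBigO_zero _ _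
  · simp only [h0, mul_zero]
    exact isBigO_zero _ _

lemma isOpen_rho_ne : IsOpen {x : Euc n | rho x ≠ 0} :=
  isOpen_ne_fun (contDiff_rho (m := 0)).continuous continuous_const

lemma IsPotential.add (hV : IsPotential V) (hW : IsPotential W) : IsPotential (V + W) := by
  have h1 : ∀ x, rho x ≠ 0 → ∀ j, pd j (V + W) x = pd j V x + pd j W x := fun x hx j =>
    pd_add ((hV.smooth x hx).differentiableAt (by simp))
      ((hW.smooth x hx).differentiableAt (by simp)) j
  refine ⟨fun x hx => (hV.smooth x hx).add (hW.smooth x hx), fun x hx i j => ?_, ?_, fun i => ?_⟩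
  · have e : pd j (V + W) =ᶠ[𝓝 x] fun y => pd j V y + pd j W y := by
      filter_upwards [isOpen_rho_ne.mem_nhds hx] with y hy using h1 y hy j
    rw [pd_congr e, pd_add (differentiableAt_pd (hV.smooth x hx) j)
      (differentiableAt_pd (hW.smooth x hx) j), hV.hess x hx, hW.hess x hx]
    simp only [h1 x hx, mul_add, Finset.sum_add_distrib, Pi.add_apply]
    ring
  · exact (hV.bound.add hW.bound).congr_left fun x => by simp [mul_add]
  · refine ((hV.bound_pd i).add (hW.bound_pd i)).congr' ?_ EventuallyEq.rfl
    filter_upwards [eventually_rho_pos n] with x hx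
    rw [h1 x hx.ne']
    ring

lemma IsPotential.smul (c : ℝ) (hV : IsPotential V) : IsPotential (c • V) := by
  have h1 : ∀ x, rho x ≠ 0 → ∀ j, pd j (c • V) x = c * pd j V x := fun x hx j =>
    pd_const_mul c ((hV.smooth x hx).differentiableAt (by simp)) j
  refine ⟨fun x hx => (hV.smooth x hx).const_smul c, fun x hx i j => ?_, ?_, fun i => ?_⟩
  · have e : pd j (c • V) =ᶠ[𝓝 x] fun y => c * pd j V y := by
      filter_upwards [isOpen_rho_ne.mem_nhds hx] with y hy using h1 y hy j
    rw [pd_congr e, pd_const_mul c (differentiableAt_pd (hV.smooth x hx) j), hV.hess x hx]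
    simp only [h1 x hx, mul_left_comm _ c, ← Finset.mul_sum, Pi.smul_apply, smul_eq_mul]
    ring
  · exact (hV.bound.const_mul_left c).congr_left fun x => by simp; ring
  · refine ((hV.bound_pd i).const_mul_left c).congr' ?_ EventuallyEq.rfl
    filter_upwards [eventually_rho_pos n] with x hx
    rw [h1 x hx.ne']
    ring

lemma contDiffAt_inv_rho {x : Euc n} {m : WithTop ℕ∞} (hx : rho x ≠ 0) :
    ContDiffAt ℝ m (fun y : Euc n => (rho y)⁻¹) x := contDiff_rho.contDiffAt.inv hx

/-- Where `ρ ≠ 0`, `V₀ = ρ⁻¹ - 1` and `∂ⱼV₀ = xⱼ ρ⁻²`; the Hessian equation then reduces to `|x|² =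
1 - 2ρ`. -/
lemma isPotential_kernelZero : IsPotential (kernelZero n) := by
  have h1 : ∀ x : Euc n, rho x ≠ 0 → ∀ j, pd j (kernelZero n) x = (rho x)⁻¹ * ((rho x)⁻¹ * x j) := by
    intro x hx j
    have e : kernelZero n =ᶠ[𝓝 x] fun y => (rho y)⁻¹ - 1 := by
      filter_upwards [isOpen_rho_ne.mem_nhds hx] with y hy
      unfold kernelZero
      field_simp [show rho y ≠ 0 from hy]
    rw [pd_congr e, pd_sub (differentiableAt_rho.fun_inv hx) (by fun_prop), pd_inv_rho hx, pd_const]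
    field_simp
    ring
  refine ⟨fun x hx => ?_, fun x hx i j => ?_, ?_, fun i => ?_⟩
  · exact (contDiffAt_const.sub contDiff_rho.contDiffAt).div contDiff_rho.contDiffAt hx
  · have e : pd j (kernelZero n) =ᶠ[𝓝 x] fun y => (rho y)⁻¹ * ((rho y)⁻¹ * y j) := by
      filter_upwards [isOpen_rho_ne.mem_nhds hx] with y hy using h1 y hy j
    have d1 : DifferentiableAt ℝ (fun y : Euc n => (rho y)⁻¹) x := differentiableAt_rho.fun_inv hx
    have d2 := differentiableAt_coord (x := x) j
    rw [pd_congr e, pd_mul d1 (d1.fun_mul d2), pd_mul d1 d2, pd_inv_rho hx, pd_coord]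
    have hs : ∑ k, x k * ((rho x)⁻¹ * ((rho x)⁻¹ * x k)) = (rho x)⁻¹ ^ 2 * (1 - 2 * rho x) := by
      rw [← IsEndMetric.sum_coord_sq x, Finset.mul_sum]
      exact Finset.sum_congr rfl fun _ _ => by ring
    simp only [h1 x hx, hs, kernelZero]
    rw [show (if i = j then (1 : ℝ) else 0) = kd i j from rfl]
    field_simp
    ring
  · refine ((isBigO_const_const (1 : ℝ) one_ne_zero _).sub isBigO_rho).congr' ?_ EventuallyEq.rfl
    filter_upwards [eventually_rho_pos n] with x hx
    unfold kernelZero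
    field_simp
  · refine (isBigO_coord i).congr' ?_ EventuallyEq.rfl
    filter_upwards [eventually_rho_pos n] with x hx
    rw [h1 x hx.ne']
    field_simp

lemma isPotential_kernelCoord (k : Fin n) : IsPotential (kernelCoord k) := by
  have h1 : ∀ x : Euc n, rho x ≠ 0 → ∀ j, pd j (kernelCoord k) x
      = (rho x)⁻¹ * (kd j k + (rho x)⁻¹ * (x k * x j)) := by
    intro x hx j
    have e : kernelCoord k = fun y : Euc n => y k * (rho y)⁻¹ := by
      ext y; simp [kernelCoord, div_eq_mul_inv]
    rw [e, pd_mul (differentiableAt_coord k) (differentiableAt_rho.fun_inv hx), pd_inv_rho hx,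
      pd_coord, show (if j = k then (1 : ℝ) else 0) = kd j k from rfl]
    field_simp
  refine ⟨fun x hx => ?_, fun x hx i j => ?_, ?_, fun i => ?_⟩
  · exact ContDiffAt.div (by fun_prop) contDiff_rho.contDiffAt hx
  · have e : pd j (kernelCoord k) =ᶠ[𝓝 x]
        fun y => (rho y)⁻¹ * (kd j k + (rho y)⁻¹ * (y k * y j)) := by
      filter_upwards [isOpen_rho_ne.mem_nhds hx] with y hy using h1 y hy j
    have d1 : DifferentiableAt ℝ (fun y : Euc n => (rho y)⁻¹) x := differentiableAt_rho.fun_inv hx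
    have d2 := differentiableAt_coord (x := x) j
    have d3 := differentiableAt_coord (x := x) k
    rw [pd_congr e, pd_mul d1 ((d1.fun_mul (d3.fun_mul d2)).const_add _),
      pd_add (f := fun _ => kd j k) (by fun_prop) (d1.fun_mul (d3.fun_mul d2)),
      pd_mul d1 (d3.fun_mul d2), pd_mul d3 d2, pd_inv_rho hx, pd_coord, pd_coord, pd_const]
    have hs : ∑ l, x l * ((rho x)⁻¹ * (kd l k + (rho x)⁻¹ * (x k * x l)))
        = (rho x)⁻¹ * (x k + (rho x)⁻¹ * (x k * (1 - 2 * rho x))) := by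
      have : ∀ l, x l * ((rho x)⁻¹ * (kd l k + (rho x)⁻¹ * (x k * x l)))
          = (rho x)⁻¹ * (x l * kd l k + (rho x)⁻¹ * (x k * (x l * x l))) := fun l => by ring
      simp only [this, ← Finset.mul_sum, Finset.sum_add_distrib, sum_mul_kd',
        IsEndMetric.sum_coord_sq]
    simp only [h1 x hx, hs, kernelCoord]
    rw [show (if i = j then (1 : ℝ) else 0) = kd i j from rfl,
      show (if i = k then (1 : ℝ) else 0) = kd i k from rfl]
    field_simp
    ring
  · refine (isBigO_coord k).congr' ?_ EventuallyEq.rfl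
    filter_upwards [eventually_rho_pos n] with x hx
    unfold kernelCoord
    field_simp
  · have : (fun x : Euc n => rho x * kd i k + x k * x i) =O[ballEnd n] fun _ => (1 : ℝ) := by
      refine IsBigO.add ?_ ?_
      · simpa using isBigO_rho.mul (isBigO_const_const (kd i k) one_ne_zero (ballEnd n))
      · simpa using (isBigO_coord k).mul (isBigO_coord i)
    refine this.congr' ?_ EventuallyEq.rfl
    filter_upwards [eventually_rho_pos n] with x hx
    rw [h1 x hx.ne']
    field_simp

lemma isPotential_of_mem (hV : V ∈ kernelSpace n) : IsPotential V := by
  refine Submodule.span_induction (p := fun V _ => IsPotential V) ?_ isPotential_zero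
    (fun V W _ _ h1 h2 => h1.add h2) (fun c V _ h => h.smul c) hV
  rintro V (rfl | ⟨k, rfl⟩)
  · exact isPotential_kernelZero
  · exact isPotential_kernelCoord k

end Potential

/-! ### The mass 1-form and its divergence -/

section MassForm

variable {n : ℕ}

/-- With zero perturbation and zero rate, the general formulas for inverse metric and Christoffel
symbols give those of `b` at no extra cost. -/
lemma isEndMetric_hypMetric : IsEndMetric (fun _ : Euc n => 0) hypMetric fun _ _ _ => 0 := by
  have hpd : ∀ j : Fin n, pd j (fun _ : Euc n => (0 : ℝ)) = fun _ => 0 := fun j => by ext; simp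
  refine ⟨tendsto_const_nhds, Eventually.of_forall fun x => ?_, Eventually.of_forall fun x => by simp,
    fun i j => ⟨Eventually.of_forall fun x => contDiffAt_const, isBigO_refl _ _, fun i => ?_,
      fun i j => ?_⟩⟩
  · ext i j
    have e : hypMetric x (basisVec i) (basisVec j)
        = (rho x ^ 2)⁻¹ * inner ℝ (basisVec i) (basisVec j) := rfl
    rw [compMat, Matrix.of_apply, e, inner_basisVec]
    simp [gam, basisVec, kd, eq_comm]
  · simp only [hpd, mul_zero]
    exact isBigO_refl _ _
  · simp only [hpd, mul_zero]
    exact isBigO_refl _ _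

lemma hypMetric_comp : ∀ᶠ x in ballEnd n, (∀ i j, invComp hypMetric x i j = rho x ^ 2 * kd i j) ∧
    ∀ k i j, christoffel hypMetric k i j x = (rho x)⁻¹ * chrZero x k i j := by
  have hg : ∀ x : Euc n, gam (fun _ _ _ => 0) x = 1 := fun x => by
    rw [IsEndMetric.gam_eq]; ext; simp
  filter_upwards [isEndMetric_hypMetric.invComp_eq (n := n),
    isEndMetric_hypMetric.christoffel_eq (n := n)] with x h1 h2
  constructor
  · intro i j
    rw [h1, hg, inv_one, Matrix.smul_apply, smul_eq_mul, IsEndMetric.one_eq_kd]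
  · intro k i j
    rw [h2, IsEndMetric.chr, hg, inv_one]
    simp only [pd_const, IsEndMetric.one_eq_kd, sum_kd_mul, chrZero]
    simp
    ring_nf
    simp

/-- The inverse of `b` is `ρ² δ`, which cancels the `ρ⁻²` in `e`: the trace of `e` becomes the
Euclidean trace of `h`, and `divᵇ e` the Euclidean divergence of `h` plus terms of order `ρ⁻¹` from
the Christoffel symbols and from `∂ρ⁻²`. -/
lemma massForm_eq {e : Euc n → Tensor2 n} {h : Fin n → Fin n → Euc n → ℝ}
    (he : ∀ᶠ x in ballEnd n, ∀ i j, compMat e x i j = (rho x ^ 2)⁻¹ * h i j x)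
    (hh : ∀ᶠ x in ballEnd n, ∀ i j, DifferentiableAt ℝ (h i j) x)
    (hsymm : ∀ᶠ x in ballEnd n, ∀ i j, h i j x = h j i x) :
    ∀ᶠ x in ballEnd n, ∀ V j, massForm e V j x = massH h V j x := by
  have htr : ∀ᶠ x in ballEnd n, traceWith hypMetric e x = ∑ i, h i i x := by
    filter_upwards [he, hypMetric_comp, eventually_rho_pos n] with x h1 h2 h3
    simp only [traceWith, h1, h2.1]
    refine Finset.sum_congr rfl fun i _ => ?_
    refine (Finset.sum_congr rfl fun j _ => ?_).trans (sum_kd_mul i fun j => h i j x)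
    field_simp
  filter_upwards [he, eventually_eventually_ballEnd he, hh, hypMetric_comp, eventually_rho_pos n, htr,
    eventually_eventually_ballEnd htr, hsymm] with x h1 h1' h2 h3 h4 h5 h6 h7 V j
  have hpd : ∀ m i j, pd m (fun y => compMat e y i j) x
      = (rho x ^ 2)⁻¹ * (pd m (h i j) x + 2 * (rho x)⁻¹ * (x m * h i j x)) := by
    intro m i j
    have e : (fun y => compMat e y i j) =ᶠ[𝓝 x] fun y => ((rho y)⁻¹ * (rho y)⁻¹) * h i j y := by
      filter_upwards [h1'] with y hy
      rw [hy, pow_two, mul_inv_rev]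
    have d1 : DifferentiableAt ℝ (fun y : Euc n => (rho y)⁻¹) x :=
      differentiableAt_rho.fun_inv h4.ne'
    rw [pd_congr e, pd_mul (d1.fun_mul d1) (h2 i j), pd_mul d1 d1, pd_inv_rho h4.ne']
    field_simp
    ring
  have hcov : ∀ k i, covDeriv hypMetric e k i j x = (rho x ^ 2)⁻¹ * (pd k (h i j) x
      + (rho x)⁻¹ * (2 * (x k * h i j x) - ∑ l, (chrZero x l k i * h l j x
        + chrZero x l k j * h i l x))) := by
    intro k i
    have : ∑ l, (christoffel hypMetric l k i x * compMat e x l j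
        + christoffel hypMetric l k j x * compMat e x i l)
        = (rho x ^ 2)⁻¹ * (rho x)⁻¹ * ∑ l, (chrZero x l k i * h l j x
          + chrZero x l k j * h i l x) := by
      rw [Finset.mul_sum]
      refine Finset.sum_congr rfl fun l _ => ?_
      rw [h3.2, h3.2, h1, h1]
      ring
    rw [covDeriv, hpd, this]
    ring
  have hdiv : divWith hypMetric e j x = ∑ i, pd i (h i j) x
      + (rho x)⁻¹ * (n * ∑ i, x i * h i j x - x j * ∑ i, h i i x) := by
    have e1 : ∀ k, ∑ i, invComp hypMetric x k i * covDeriv hypMetric e k i j x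
        = pd k (h k j) x + (rho x)⁻¹ * (2 * (x k * h k j x) - ∑ l, (chrZero x l k k * h l j x
        + chrZero x l k j * h k l x)) := by
      intro k
      have : ∀ i, invComp hypMetric x k i * covDeriv hypMetric e k i j x
          = kd k i * (pd k (h i j) x + (rho x)⁻¹ * (2 * (x k * h i j x)
            - ∑ l, (chrZero x l k i * h l j x + chrZero x l k j * h i l x))) := fun i => by
        rw [h3.1, hcov]
        field_simp
      simp only [this, sum_kd_mul]
    have e2 : ∑ k, ∑ l, chrZero x l k k * h l j x = (2 - n) * ∑ i, x i * h i j x := by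
      rw [Finset.sum_comm, Finset.mul_sum]
      refine Finset.sum_congr rfl fun l _ => ?_
      rw [← Finset.sum_mul]
      simp only [chrZero, Finset.sum_add_distrib, Finset.sum_sub_distrib, sum_mul_kd',
        ← Finset.mul_sum, sum_kd_self]
      ring
    have e3 : ∑ k, ∑ l, chrZero x l k j * h k l x = x j * ∑ i, h i i x := by
      have : ∀ k l, chrZero x l k j * h k l x
          = (x k * h k l x) * kd j l + x j * (h k l x * kd k l) - kd k j * (x l * h k l x) :=
        fun k l => by simp only [chrZero]; ring
      simp only [this, Finset.sum_add_distrib, Finset.sum_sub_distrib, sum_mul_kd,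
        ← Finset.mul_sum, sum_kd_mul']
      have : ∑ l, x l * h j l x = ∑ k, x k * h k j x :=
        Finset.sum_congr rfl fun l _ => by rw [h7 j l]
      rw [this]
      ring
    rw [divWith]
    simp only [e1, Finset.sum_add_distrib, ← Finset.mul_sum, Finset.sum_sub_distrib, e2, e3]
    ring
  have hgrad : ∑ i, gradWith hypMetric V i x * compMat e x i j = ∑ i, h i j x * pd i V x := by
    refine Finset.sum_congr rfl fun i _ => ?_
    have : gradWith hypMetric V i x = rho x ^ 2 * pd i V x := by
      simp only [gradWith, h3.1, mul_assoc, ← Finset.mul_sum, sum_kd_mul]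
    rw [this, h1]
    field_simp
  have hptr : pd j (traceWith hypMetric e) x = ∑ i, pd j (h i i) x := by
    rw [pd_congr (g := fun y => ∑ i, h i i y) h6, pd_sum fun i _ => h2 i i]
  rw [massForm, massH, hdiv, hptr, hgrad, h5]

lemma pd_fluxWeight (hn : 3 ≤ n) {x : Euc n} (hx : rho x ≠ 0) (j : Fin n) :
    pd j fluxWeight x = (n - 2) * fluxWeight x * (x j * (rho x)⁻¹) := by
  -- The exponent `n - 2` is a natural subtraction; `n ≥ 3` makes it a successor, so that the power
  -- rule and the cast to `ℝ` are exact.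
  obtain ⟨m, hm⟩ : ∃ m, n - 2 = m + 1 := ⟨n - 3, by omega⟩
  have hnm : (n : ℝ) - 2 = m + 1 := by
    rw [← Nat.cast_two, ← Nat.cast_sub (by omega), hm]; push_cast; ring
  have : pd j (fun y : Euc n => ((rho y)⁻¹) ^ (n - 2)) x = _ :=
    pd_comp (u := fun t => t ^ (n - 2)) (f := fun y : Euc n => (rho y)⁻¹) (by fun_prop)
      (differentiableAt_rho.fun_inv hx) j
  unfold fluxWeight
  rw [this, pd_inv_rho hx, hnm, hm]
  simp
  ring

lemma contDiffAt_fluxWeight {x : Euc n} {m : WithTop ℕ∞} (hx : rho x ≠ 0) :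
    ContDiffAt ℝ m (fluxWeight (n := n)) x := (contDiffAt_inv_rho hx).pow _

/-- The pointwise algebra behind `divᵇ U = V DScal(h)`, with `p = ∂h`, `q = ∂²h`, `dv = ∂V` as
independent variables and the Hessian of `V` already replaced through `∇²V = V b`. The first group
is the derivative of the weight `ρ^{2-n}` divided by that weight. All terms in `dv` cancel and the
remaining ones assemble to `DScal(h)`: this is the vanishing of the adjoint operator on `V`. -/
lemma sum_div_massH_algebra {r v : ℝ} (hr0 : r ≠ 0) {x dv : Fin n → ℝ} {h : Fin n → Fin n → ℝ}
    {p : Fin n → Fin n → Fin n → ℝ} {q : Fin n → Fin n → Fin n → Fin n → ℝ}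
    (hr : ∑ i, x i * x i = 1 - 2 * r) (hp : ∀ k i j, p k i j = p k j i)
    (hh : ∀ i j, h i j = h j i) (hq : ∀ k l i j, q k l i j = q k l j i) :
    ∑ j, (((n : ℝ) - 2) * (x j * r⁻¹) * (v * (∑ i, p i i j
          + r⁻¹ * (n * ∑ i, x i * h i j - x j * ∑ i, h i i) - ∑ i, p j i i)
          - ∑ i, h i j * dv i + (∑ i, h i i) * dv j)
        + (dv j * (∑ i, p i i j + r⁻¹ * (n * ∑ i, x i * h i j - x j * ∑ i, h i i) - ∑ i, p j i i)
          + v * (∑ i, q j i i j + (x j * r⁻¹ ^ 2 * (n * ∑ i, x i * h i j - x j * ∑ i, h i i)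
            + r⁻¹ * (n * ∑ i, (kd j i * h i j + x i * p j i j)
              - (∑ i, h i i + x j * ∑ i, p j i i))) - ∑ i, q j j i i)
          - ∑ i, (p j i j * dv i + h i j * (r⁻¹ * (x j * dv i + x i * dv j
            - kd j i * ∑ k, x k * dv k) + v * kd j i * r⁻¹ ^ 2))
          + ((∑ i, p j i i) * dv j + (∑ i, h i i) * (r⁻¹ * (x j * dv j + x j * dv j
            - kd j j * ∑ k, x k * dv k) + v * kd j j * r⁻¹ ^ 2))))
      = r⁻¹ ^ 2 * v * scalOne r x h (fun k i j => r * p k i j) fun k l i j => r ^ 2 * q k l i j := by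
  have k1 : ∀ j, ∑ i, (kd j i * h i j + x i * p j i j) = h j j + ∑ i, x i * p j i j := fun j => by
    rw [Finset.sum_add_distrib, sum_kd_mul j fun i => h i j]
  have k2 : ∀ j, ∑ i, (p j i j * dv i + h i j * (r⁻¹ * (x j * dv i + x i * dv j
      - kd j i * ∑ k, x k * dv k) + v * kd j i * r⁻¹ ^ 2))
      = ∑ i, p j i j * dv i + r⁻¹ * (x j * ∑ i, h i j * dv i + dv j * ∑ i, x i * h i j
        - h j j * ∑ k, x k * dv k) + v * r⁻¹ ^ 2 * h j j := by
    intro j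
    have : ∀ i, p j i j * dv i + h i j * (r⁻¹ * (x j * dv i + x i * dv j
      - kd j i * ∑ k, x k * dv k) + v * kd j i * r⁻¹ ^ 2) = p j i j * dv i
        + r⁻¹ * (x j * (h i j * dv i) + dv j * (x i * h i j) - (kd j i * h i j) * ∑ k, x k * dv k)
        + v * r⁻¹ ^ 2 * (kd j i * h i j) := fun i => by ring
    simp only [this, Finset.sum_add_distrib, Finset.sum_sub_distrib, ← Finset.mul_sum,
      ← Finset.sum_mul]
    rw [sum_kd_mul j fun i => h i j]
  have k3 : ∀ j : Fin n, kd j j = 1 := fun j => by simp [kd]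
  have s1 : ∑ j, ∑ i, x i * p j i j = ∑ j, x j * ∑ i, p i i j := by
    rw [Finset.sum_comm]
    simp only [← Finset.mul_sum]
    exact Finset.sum_congr rfl fun i _ => by
      congr 1
      exact Finset.sum_congr rfl fun j _ => hp _ _ _
  have s2 : ∑ j, ∑ i, p j i j * dv i = ∑ j, dv j * ∑ i, p i i j := by
    rw [Finset.sum_comm]
    simp only [← Finset.sum_mul]
    exact Finset.sum_congr rfl fun i _ => by
      rw [mul_comm]
      congr 1
      exact Finset.sum_congr rfl fun j _ => hp _ _ _
  have s3 : ∑ j, dv j * ∑ i, x i * h i j = ∑ j, x j * ∑ i, h j i * dv i := by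
    simp only [Finset.mul_sum]
    rw [Finset.sum_comm]
    exact Finset.sum_congr rfl fun i _ => Finset.sum_congr rfl fun j _ => by ring
  have s4 : ∑ i, ∑ j, h i j * x i * x j = ∑ j, x j * ∑ i, x i * h i j := by
    simp only [Finset.mul_sum]
    rw [Finset.sum_comm]
    exact Finset.sum_congr rfl fun i _ => Finset.sum_congr rfl fun j _ => by ring
  have s5 : ∑ i, ∑ j, p i i j * x j = ∑ j, x j * ∑ i, p i i j := by
    simp only [Finset.mul_sum]
    rw [Finset.sum_comm]
    exact Finset.sum_congr rfl fun i _ => Finset.sum_congr rfl fun j _ => by ring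
  have s6 : ∑ i, ∑ j, p j i i * x j = ∑ j, x j * ∑ i, p j i i := by
    simp only [Finset.mul_sum]
    rw [Finset.sum_comm]
    exact Finset.sum_congr rfl fun i _ => Finset.sum_congr rfl fun j _ => by ring
  have s7 : ∑ i, ∑ j, q i j i j = ∑ j, ∑ i, q j i i j :=
    Finset.sum_congr rfl fun i _ => Finset.sum_congr rfl fun j _ => hq _ _ _ _
  have s8 : ∑ j, x j * ∑ i, h j i * dv i = ∑ j, x j * ∑ i, h i j * dv i := by
    exact Finset.sum_congr rfl fun i _ => by
      congr 1
      exact Finset.sum_congr rfl fun j _ => by rw [hh]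
  -- The summand as a combination of elementary `j`-terms with coefficients independent of `j`; the
  -- relations `s1` to `s8` then identify their sums.
  have split : ∀ j, (((n : ℝ) - 2) * (x j * r⁻¹) * (v * (∑ i, p i i j
          + r⁻¹ * (n * ∑ i, x i * h i j - x j * ∑ i, h i i) - ∑ i, p j i i)
          - ∑ i, h i j * dv i + (∑ i, h i i) * dv j)
        + (dv j * (∑ i, p i i j + r⁻¹ * (n * ∑ i, x i * h i j - x j * ∑ i, h i i) - ∑ i, p j i i)
          + v * (∑ i, q j i i j + (x j * r⁻¹ ^ 2 * (n * ∑ i, x i * h i j - x j * ∑ i, h i i)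
            + r⁻¹ * (n * (h j j + ∑ i, x i * p j i j)
              - (∑ i, h i i + x j * ∑ i, p j i i))) - ∑ i, q j j i i)
          - (∑ i, p j i j * dv i + r⁻¹ * (x j * ∑ i, h i j * dv i + dv j * ∑ i, x i * h i j
            - h j j * ∑ k, x k * dv k) + v * r⁻¹ ^ 2 * h j j)
          + ((∑ i, p j i i) * dv j + (∑ i, h i i) * (r⁻¹ * (x j * dv j + x j * dv j
            - 1 * ∑ k, x k * dv k) + v * 1 * r⁻¹ ^ 2))))
      = (n - 2) * r⁻¹ * v * (x j * ∑ i, p i i j) + (n - 1) * r⁻¹ ^ 2 * v * n * (x j * ∑ i, x i * h i j)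
        - (n - 1) * r⁻¹ ^ 2 * v * (∑ i, h i i) * (x j * x j)
        - (n - 1) * r⁻¹ * v * (x j * ∑ i, p j i i) - (n - 1) * r⁻¹ * (x j * ∑ i, h i j * dv i)
        + (n - 1) * r⁻¹ * (∑ i, h i i) * (x j * dv j) + dv j * ∑ i, p i i j
        + (n - 1) * r⁻¹ * (dv j * ∑ i, x i * h i j)
        + v * ∑ i, q j i i j + (v * r⁻¹ * n + r⁻¹ * (∑ k, x k * dv k) - v * r⁻¹ ^ 2) * h j j
        + v * r⁻¹ * n * ∑ i, x i * p j i j - v * ∑ i, q j j i i - ∑ i, p j i j * dv i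
        + (v * r⁻¹ ^ 2 - r⁻¹ * (∑ k, x k * dv k) - v * r⁻¹) * ∑ i, h i i := fun j => by ring
  simp only [k1, k2, k3, split]
  simp only [Finset.sum_add_distrib, Finset.sum_sub_distrib, ← Finset.mul_sum, s1, s2, s3, s8, hr,
    Finset.sum_const, Finset.card_univ, Fintype.card_fin, nsmul_eq_mul]
  have t1 : ∀ i j : Fin n, r * p i i j * x j = r * (p i i j * x j) := fun i j => by ring
  have t2 : ∀ i j : Fin n, r * p j i i * x j = r * (p j i i * x j) := fun i j => by ring
  simp only [scalOne, t1, t2, ← Finset.mul_sum, s4, s5, s6, s7]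
  field_simp
  ring

lemma contDiffAt_massH {h : Fin n → Fin n → Euc n → ℝ} {V : Euc n → ℝ} (hV : IsPotential V)
    {x : Euc n} (hx : rho x ≠ 0) (hh : ∀ i j, ContDiffAt ℝ 2 (h i j) x) (j : Fin n) :
    ContDiffAt ℝ 1 (massH h V j) x := by
  have h1 : ∀ i j, ContDiffAt ℝ 1 (h i j) x := fun i j => (hh i j).of_le (by norm_num)
  have h2 : ∀ k i j, ContDiffAt ℝ 1 (pd k (h i j)) x := fun k i j =>
    contDiffAt_pd (m := 1) (by simpa [one_add_one_eq_two] using hh i j) k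
  have h3 : ContDiffAt ℝ 1 V x := (hV.smooth x hx).of_le (by norm_num)
  have h4 : ∀ i, ContDiffAt ℝ 1 (pd i V) x := fun i =>
    contDiffAt_pd (m := 1) (by simpa [one_add_one_eq_two] using hV.smooth x hx) i
  have h5 : ∀ i, ContDiffAt ℝ 1 (fun y : Euc n => y i) x := fun i => by fun_prop
  have h6 : ContDiffAt ℝ 1 (fun y : Euc n => (rho y)⁻¹) x := contDiffAt_inv_rho hx
  have htr : ContDiffAt ℝ 1 (fun y => ∑ i, h i i y) x := ContDiffAt.sum fun i _ => h1 i i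
  have ha : ContDiffAt ℝ 1 (fun y => ∑ i, pd i (h i j) y) x := ContDiffAt.sum fun i _ => h2 i i j
  have hb : ContDiffAt ℝ 1 (fun y => ∑ i, pd j (h i i) y) x := ContDiffAt.sum fun i _ => h2 j i i
  have hc : ContDiffAt ℝ 1 (fun y : Euc n => ∑ i, y i * h i j y) x :=
    ContDiffAt.sum fun i _ => (h5 i).mul (h1 i j)
  have hg : ContDiffAt ℝ 1 (fun y => ∑ i, h i j y * pd i V y) x :=
    ContDiffAt.sum fun i _ => (h1 i j).mul (h4 i)
  have hN : ContDiffAt ℝ 1 (fun y : Euc n => n * ∑ i, y i * h i j y - y j * ∑ i, h i i y) x :=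
    (contDiffAt_const.mul hc).sub ((h5 j).mul htr)
  unfold massH
  exact ((h3.mul ((ha.add (h6.mul hN)).sub hb)).sub hg).add (htr.mul (h4 j))

/-- The divergence of the mass 1-form. -/
lemma sum_pd_fluxWeight_mul_massH (hn : 3 ≤ n) {h : Fin n → Fin n → Euc n → ℝ} {V : Euc n → ℝ}
    (hV : IsPotential V) (hh : ∀ᶠ x in ballEnd n, ∀ i j, ContDiffAt ℝ 2 (h i j) x)
    (hsymm : ∀ᶠ x in ballEnd n, ∀ i j, h i j x = h j i x) :
    ∀ᶠ x in ballEnd n, ∑ j, pd j (fun y => fluxWeight y * massH h V j y) x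
      = fluxWeight x * ((rho x)⁻¹ ^ 2 * V x * IsEndMetric.linScal h x) := by
  filter_upwards [hh, hsymm, eventually_eventually_ballEnd hsymm, eventually_rho_pos n,
    eventually_eventually_ballEnd (eventually_eventually_ballEnd hsymm)] with x h1 h2 h3 h4 h5
  have hx : rho x ≠ 0 := h4.ne'
  have hp : ∀ k i j, pd k (h i j) x = pd k (h j i) x := fun k i j =>
    pd_congr (h3.mono fun y hy => hy i j) k
  have hq : ∀ k l i j, pd k (pd l (h i j)) x = pd k (pd l (h j i)) x := fun k l i j =>
    pd_congr (h5.mono fun y hy => pd_congr (hy.mono fun z hz => hz i j) l) k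
  have d1 : ∀ i j, DifferentiableAt ℝ (h i j) x := fun i j => (h1 i j).differentiableAt (by simp)
  have d2 : ∀ k i j, DifferentiableAt ℝ (pd k (h i j)) x := fun k i j =>
    differentiableAt_pd (h1 i j) k
  have d3 : DifferentiableAt ℝ V x := (hV.smooth x hx).differentiableAt (by simp)
  have d4 : ∀ i, DifferentiableAt ℝ (pd i V) x := fun i => differentiableAt_pd (hV.smooth x hx) i
  have d5 : ∀ i, DifferentiableAt ℝ (fun y : Euc n => y i) x := fun i => differentiableAt_coord i
  have d6 : DifferentiableAt ℝ (fun y : Euc n => (rho y)⁻¹) x := differentiableAt_rho.fun_inv hx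
  have dtr : DifferentiableAt ℝ (fun y => ∑ i, h i i y) x :=
    DifferentiableAt.fun_sum fun i _ => d1 i i
  have dc : ∀ j, DifferentiableAt ℝ (fun y : Euc n => ∑ i, y i * h i j y) x := fun j =>
    DifferentiableAt.fun_sum fun i _ => (d5 i).fun_mul (d1 i j)
  have da : ∀ j, DifferentiableAt ℝ (fun y => ∑ i, pd i (h i j) y) x := fun j =>
    DifferentiableAt.fun_sum fun i _ => d2 i i j
  have db : ∀ j, DifferentiableAt ℝ (fun y => ∑ i, pd j (h i i) y) x := fun j =>
    DifferentiableAt.fun_sum fun i _ => d2 j i i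
  have dg : ∀ j, DifferentiableAt ℝ (fun y => ∑ i, h i j y * pd i V y) x := fun j =>
    DifferentiableAt.fun_sum fun i _ => (d1 i j).fun_mul (d4 i)
  have dN : ∀ j, DifferentiableAt ℝ
      (fun y : Euc n => n * ∑ i, y i * h i j y - y j * ∑ i, h i i y) x := fun j =>
    ((dc j).const_mul _).fun_sub ((d5 j).fun_mul dtr)
  have pdM : ∀ j, pd j (massH h V j) x
      = pd j V x * (∑ i, pd i (h i j) x + (rho x)⁻¹ * (n * ∑ i, x i * h i j x
          - x j * ∑ i, h i i x) - ∑ i, pd j (h i i) x)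
        + V x * (∑ i, pd j (pd i (h i j)) x + (x j * (rho x)⁻¹ ^ 2 * (n * ∑ i, x i * h i j x
            - x j * ∑ i, h i i x) + (rho x)⁻¹ * (n * ∑ i, (kd j i * h i j x + x i * pd j (h i j) x)
              - (∑ i, h i i x + x j * ∑ i, pd j (h i i) x))) - ∑ i, pd j (pd j (h i i)) x)
        - ∑ i, (pd j (h i j) x * pd i V x + h i j x * ((rho x)⁻¹ * (x j * pd i V x + x i * pd j V x
            - kd j i * ∑ k, x k * pd k V x) + V x * kd j i * (rho x)⁻¹ ^ 2))
        + ((∑ i, pd j (h i i) x) * pd j V x + (∑ i, h i i x) * ((rho x)⁻¹ * (x j * pd j V x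
            + x j * pd j V x - kd j j * ∑ k, x k * pd k V x) + V x * kd j j * (rho x)⁻¹ ^ 2)) := by
    intro j
    have q1 : pd j (fun y : Euc n => ∑ i, y i * h i j y) x
        = ∑ i, (kd j i * h i j x + x i * pd j (h i j) x) := by
      rw [pd_sum fun i _ => (d5 i).fun_mul (d1 i j)]
      refine Finset.sum_congr rfl fun i _ => ?_
      rw [pd_mul (d5 i) (d1 i j), pd_coord]
      rfl
    have q2 : pd j (fun y => ∑ i, h i j y * pd i V y) x
        = ∑ i, (pd j (h i j) x * pd i V x + h i j x * pd j (pd i V) x) := by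
      rw [pd_sum fun i _ => (d1 i j).fun_mul (d4 i)]
      exact Finset.sum_congr rfl fun i _ => pd_mul (d1 i j) (d4 i) j
    have q3 : pd j (fun y => y j) x = 1 := by simp [pd_coord]
    unfold massH
    rw [pd_add ((d3.fun_mul (((da j).fun_add (d6.fun_mul (dN j))).fun_sub (db j))).fun_sub (dg j))
      (dtr.fun_mul (d4 j)), pd_sub (d3.fun_mul (((da j).fun_add (d6.fun_mul (dN j))).fun_sub (db j)))
      (dg j), pd_mul d3 (((da j).fun_add (d6.fun_mul (dN j))).fun_sub (db j)),
      pd_sub ((da j).fun_add (d6.fun_mul (dN j))) (db j), pd_add (da j) (d6.fun_mul (dN j)),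
      pd_mul d6 (dN j), pd_sub ((dc j).const_mul _) ((d5 j).fun_mul dtr), pd_const_mul _ (dc j),
      pd_mul (d5 j) dtr, pd_mul dtr (d4 j), q1, q2, q3, pd_sum fun i _ => d2 i i j,
      pd_sum fun i _ => d2 j i i, pd_sum fun i _ => d1 i i, pd_inv_rho hx, hV.hess x hx j j]
    simp only [hV.hess x hx j]
    rw [div_eq_mul_inv, ← inv_pow, one_mul]
  have hdM : ∀ j, DifferentiableAt ℝ (massH h V j) x := fun j =>
    (contDiffAt_massH hV hx h1 j).differentiableAt one_ne_zero
  have hdw : DifferentiableAt ℝ (fluxWeight (n := n)) x :=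
    (contDiffAt_fluxWeight (m := 1) hx).differentiableAt one_ne_zero
  rw [IsEndMetric.linScal, ← sum_div_massH_algebra hx (IsEndMetric.sum_coord_sq x) (p := fun k i j => pd k (h i j) x)
    (q := fun k l i j => pd k (pd l (h i j)) x) hp (dv := fun i => pd i V x) h2 hq, Finset.mul_sum]
  refine Finset.sum_congr rfl fun j _ => ?_
  rw [pd_mul hdw (hdM j), pd_fluxWeight hn hx, pdM]
  unfold massH
  ring

end MassForm

/-! ### Fluxes through large spheres -/

section Flux

variable {n : ℕ}

lemma rho_smul_sphere {ε : ℝ} (hε : ε ∈ Ioo (0 : ℝ) (1 / 2))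
    (z : _root_.Metric.sphere (0 : Euc n) 1) :
    ‖√(1 - 2 * ε) • (z : Euc n)‖ = √(1 - 2 * ε) ∧ rho (√(1 - 2 * ε) • (z : Euc n)) = ε := by
  have h : ‖√(1 - 2 * ε) • (z : Euc n)‖ = √(1 - 2 * ε) := by
    rw [norm_smul, norm_eq_of_mem_sphere, mul_one, Real.norm_of_nonneg (Real.sqrt_nonneg _)]
  refine ⟨h, ?_⟩
  rw [rho, h, Real.sq_sqrt (by linarith [hε.2])]
  ring

/-- The powers of `ρ` combine: `ν` contributes `ρ`, the area measure `ρ^{-(n-1)}`, together the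
weight `ρ^{2-n}` in front of a Euclidean flux. The factor `r^{n-1}` is part of `sphereInt`. -/
lemma sphereFlux_eq (hn : 2 ≤ n) (η : Fin n → Euc n → ℝ) {ε : ℝ} (hε : ε ∈ Ioo (0 : ℝ) (1 / 2)) :
    sphereFlux η ε
      = sphereInt (fun x => ∑ j, (fluxWeight x * η j x) * (x j / ‖x‖)) √(1 - 2 * ε) := by
  rw [sphereFlux, sphereInt, ← integral_const_mul]
  refine integral_congr_ae (Eventually.of_forall fun z => ?_)
  have hr : 0 < √(1 - 2 * ε) := Real.sqrt_pos.2 (by linarith [hε.2])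
  obtain ⟨h1, h2⟩ := rho_smul_sphere hε z
  have hε0 := hε.1.ne'
  obtain ⟨m, rfl⟩ : ∃ m, n = m + 2 := ⟨n - 2, by omega⟩
  simp only [unitNormal, fluxWeight, h1, h2, Finset.sum_mul, Finset.mul_sum, PiLp.smul_apply,
    smul_eq_mul]
  refine Finset.sum_congr rfl fun j _ => ?_
  simp only [Nat.add_sub_cancel, show m + 2 - 1 = m + 1 by omega, div_pow, pow_succ, inv_pow]
  field_simp

lemma eventually_sphere {p : Euc n → Prop} (hp : ∀ᶠ x in ballEnd n, p x) :
    ∀ᶠ ε in 𝓝[>] (0 : ℝ), ε ∈ Ioo (0 : ℝ) (1 / 2) ∧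
      ∀ z : _root_.Metric.sphere (0 : Euc n) 1, p (√(1 - 2 * ε) • (z : Euc n)) := by
  obtain ⟨δ, hδ, H⟩ := eventually_ballEnd_iff.1 hp
  filter_upwards [Ioo_mem_nhdsGT (show (0 : ℝ) < 1 / 2 by norm_num), Ioo_mem_nhdsGT hδ] with ε h1 h2
  refine ⟨h1, fun z => H _ ?_ ?_⟩ <;> rw [(rho_smul_sphere h1 z).2]
  exacts [h2.1, h2.2]

lemma tendsto_sqrt_one_sub :
    Tendsto (fun ε : ℝ => √(1 - 2 * ε)) (𝓝[>] 0) (𝓝[<] 1) := by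
  refine tendsto_nhdsWithin_iff.2 ⟨?_, ?_⟩
  · have : Continuous fun ε : ℝ => √(1 - 2 * ε) := by fun_prop
    have h := this.tendsto 0
    simp only [mul_zero, sub_zero, Real.sqrt_one] at h
    exact h.mono_left nhdsWithin_le_nhds
  · filter_upwards [self_mem_nhdsWithin] with ε hε
    rw [mem_Iio, Real.sqrt_lt' one_pos]
    linarith [show (0 : ℝ) < ε from hε]

lemma sphereFlux_congr {η η' : Fin n → Euc n → ℝ}
    (h : ∀ᶠ x in ballEnd n, ∀ j, η j x = η' j x) :
    sphereFlux η =ᶠ[𝓝[>] 0] sphereFlux η' := by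
  filter_upwards [eventually_sphere h] with ε hε
  simp only [sphereFlux, hε.2]

/-- Needed to split the integral of a sum; on a compact sphere continuity of the form suffices. -/
lemma integrable_sphereFlux {η : Fin n → Euc n → ℝ}
    (h : ∀ᶠ x in ballEnd n, ∀ j, ContinuousAt (η j) x) :
    ∀ᶠ ε in 𝓝[>] (0 : ℝ), Integrable (fun z : _root_.Metric.sphere (0 : Euc n) 1 =>
      (∑ j, η j (√(1 - 2 * ε) • (z : Euc n)) * unitNormal (√(1 - 2 * ε) • (z : Euc n)) j)
        * (√(1 - 2 * ε) / ε) ^ (n - 1)) ((volume : Measure (Euc n)).toSphere) := by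
  filter_upwards [eventually_sphere h] with ε hε
  have hc : Continuous fun z : _root_.Metric.sphere (0 : Euc n) 1 => √(1 - 2 * ε) • (z : Euc n) := by
    fun_prop
  refine Integrable.mul_const (integrable_finsetSum _ fun j _ => ?_) _
  have h1 : Continuous fun z : _root_.Metric.sphere (0 : Euc n) 1 =>
      η j (√(1 - 2 * ε) • (z : Euc n)) :=
    continuous_iff_continuousAt.2 fun z => ContinuousAt.comp (f := fun z :
      _root_.Metric.sphere (0 : Euc n) 1 => √(1 - 2 * ε) • (z : Euc n)) (hε.2 z j) hc.continuousAt
  have h2 : Continuous fun z : _root_.Metric.sphere (0 : Euc n) 1 =>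
      unitNormal (√(1 - 2 * ε) • (z : Euc n)) j := by
    simp only [unitNormal, (rho_smul_sphere hε.1 _).1, (rho_smul_sphere hε.1 _).2]
    fun_prop
  exact (h1.mul h2).integrable_of_hasCompactSupport
    (HasCompactSupport.of_compactSpace _)

lemma sphereFlux_add {η η' : Fin n → Euc n → ℝ}
    (h : ∀ᶠ x in ballEnd n, ∀ j, ContinuousAt (η j) x)
    (h' : ∀ᶠ x in ballEnd n, ∀ j, ContinuousAt (η' j) x) :
    ∀ᶠ ε in 𝓝[>] (0 : ℝ), sphereFlux (fun j x => η j x + η' j x) ε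
      = sphereFlux η ε + sphereFlux η' ε := by
  filter_upwards [integrable_sphereFlux h, integrable_sphereFlux h'] with ε h1 h2
  simp only [sphereFlux]
  rw [← integral_add h1 h2]
  simp only [add_mul, Finset.sum_add_distrib]

lemma sphereFlux_const_mul (c : ℝ) (η : Fin n → Euc n → ℝ) (ε : ℝ) :
    sphereFlux (fun j x => c * η j x) ε = c * sphereFlux η ε := by
  simp only [sphereFlux]
  rw [← integral_const_mul]
  simp only [mul_assoc, ← Finset.mul_sum]

/-- Each sphere `{ρ = ε}` has Euclidean radius at most one, so its Euclidean area is bounded and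
pointwise smallness of the weighted form is enough. -/
lemma tendsto_sphereFlux_zero (hn : 2 ≤ n) {η : Fin n → Euc n → ℝ}
    (h : ∀ j, Tendsto (fun x => fluxWeight x * η j x) (ballEnd n) (𝓝 0)) :
    Tendsto (sphereFlux η) (𝓝[>] 0) (𝓝 0) := by
  have hsum : Tendsto (fun x => ∑ j, |fluxWeight x * η j x|) (ballEnd n) (𝓝 0) := by
    have := tendsto_finsetSum (Finset.univ : Finset (Fin n)) fun j _ => (h j).abs
    simpa using this
  set v := ((volume : Measure (Euc n)).toSphere).real univ
  rw [Metric.tendsto_nhds]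
  intro δ hδ
  have hv : 0 < v + 1 := add_pos_of_nonneg_of_pos measureReal_nonneg one_pos
  -- Dividing by `v + 1` avoids a zero denominator and leaves the strict bound `δ v / (v + 1) < δ`.
  have h1 := hsum.eventually (gt_mem_nhds (div_pos hδ hv))
  filter_upwards [eventually_sphere h1] with ε hε
  have hr1 : √(1 - 2 * ε) ≤ 1 := Real.sqrt_le_one.2 (by linarith [hε.1.1])
  rw [dist_zero_right, sphereFlux_eq hn η hε.1, sphereInt, norm_mul, norm_pow,
    Real.norm_of_nonneg (Real.sqrt_nonneg _)]
  have h2 : ‖∫ z : _root_.Metric.sphere (0 : Euc n) 1, ∑ j,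
      (fluxWeight (√(1 - 2 * ε) • (z : Euc n)) * η j (√(1 - 2 * ε) • (z : Euc n)))
        * ((√(1 - 2 * ε) • (z : Euc n)) j / ‖√(1 - 2 * ε) • (z : Euc n)‖)
      ∂((volume : Measure (Euc n)).toSphere)‖ ≤ δ / (v + 1) * v := by
    refine norm_integral_le_of_norm_le_const (Eventually.of_forall fun z => ?_)
    refine le_trans ?_ (hε.2 z).le
    refine (norm_sum_le _ _).trans (Finset.sum_le_sum fun j _ => ?_)
    rw [norm_mul, Real.norm_eq_abs, Real.norm_eq_abs]
    refine mul_le_of_le_one_right (abs_nonneg _) ?_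
    rw [abs_div, abs_norm]
    exact div_le_one_of_le₀ (abs_coord_le_norm _ j) (norm_nonneg _)
  calc _ ≤ 1 * (δ / (v + 1) * v) :=
        mul_le_mul (pow_le_one₀ (Real.sqrt_nonneg _) hr1) h2 (norm_nonneg _) zero_le_one
    _ < δ := by
        rw [one_mul, div_mul_eq_mul_div, div_lt_iff₀ hv]
        nlinarith

/-- In polar coordinates `ρ = (1 - y)(1 + y)/2` with `y = |x|`; only `(1 - y)^p` is singular at `y =
1`, and `p > -1` makes it integrable. -/
lemma integrableOn_rho_rpow (hn : n ≠ 0) {p : ℝ} (hp : -1 < p) {a : ℝ} :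
    IntegrableOn (fun x : Euc n => rho x ^ p) (shell n a) := by
  have : Nonempty (Fin n) := ⟨⟨0, Nat.pos_of_ne_zero hn⟩⟩
  have hsub : shell n a ⊆ Metric.ball (0 : Euc n) 1 := fun x hx => by simpa using hx.2
  refine IntegrableOn.mono_set ?_ hsub
  have := (integrableOn_fun_norm_addHaar (volume : Measure (Euc n)) (r := 1)
    (f := fun y : ℝ => ((1 - y ^ 2) / 2) ^ p)).2 ?_
  · exact this
  · have h1 : IntervalIntegrable (fun y : ℝ => (1 - y) ^ p) volume 0 1 := by
      have := (intervalIntegral.intervalIntegrable_rpow' hp (a := 0) (b := 1)).comp_sub_left 1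
      simpa using this.symm
    rw [intervalIntegrable_iff_integrableOn_Icc_of_le zero_le_one] at h1
    have hc : ContinuousOn (fun y : ℝ => y ^ (Module.finrank ℝ (Euc n) - 1) * ((1 + y) / 2) ^ p)
        (Icc 0 1) := by
      refine (continuousOn_id.pow _).mul (ContinuousOn.rpow_const (by fun_prop) fun y hy => Or.inl ?_)
      have := hy.1
      positivity
    refine ((h1.mul_continuousOn hc isCompact_Icc).mono_set Ioo_subset_Icc_self).congr_fun ?_
      measurableSet_Ioo
    intro y hy
    have e : (1 - y ^ 2) / 2 = (1 - y) * ((1 + y) / 2) := by ring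
    simp only [smul_eq_mul]
    rw [e, Real.mul_rpow (by linarith [hy.2]) (by linarith [hy.1])]
    ring

lemma eventually_mem_hypExterior (R : ℝ) : ∀ᶠ x in ballEnd n, x ∈ hypExterior n R := by
  have h1 : Tendsto (fun x : Euc n => (rho x)⁻¹) (ballEnd n) atTop :=
    tendsto_inv_nhdsGT_zero.comp (tendsto_rho n)
  filter_upwards [h1.eventually (eventually_gt_atTop (Real.cosh R + 1)), eventually_rho_pos n]
    with x h2 h3
  refine ⟨rho_pos_iff.1 h3, ?_⟩
  -- `cosh d(0, x) = ρ⁻¹ - 1`, which exceeds `cosh R` once `ρ` is small.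
  have e : 1 + ‖(0 : Euc n) - x‖ ^ 2 / (2 * rho (0 : Euc n) * rho x) = (rho x)⁻¹ - 1 := by
    have : rho (0 : Euc n) = 1 / 2 := by simp [rho]
    have h4 : ‖x‖ ^ 2 = 1 - 2 * rho x := by unfold rho; ring
    rw [this, zero_sub, norm_neg, h4]
    field_simp
    ring
  rw [hypDist, e]
  have h5 : |R| < Real.arcosh ((rho x)⁻¹ - 1) := by
    rw [← Real.arcosh_cosh (abs_nonneg R), Real.cosh_abs]
    exact (Real.arcosh_lt_arcosh (Real.cosh_pos R)
      (by linarith [Real.cosh_pos R])).2 (by linarith)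
  exact (le_abs_self R).trans_lt h5

end Flux

/-! ### Existence of the mass -/

section Mass

variable {n : ℕ} {G : Euc n → Tensor2 n} {h : Fin n → Fin n → Euc n → ℝ} {V : Euc n → ℝ}

/-- `V = O(ρ⁻¹)` meets `∂h = O(ρ⁻¹ t)` or `ρ⁻¹ h`, and `∂V = O(ρ⁻²)` meets `h = O(t)`: every term is
`O(ρ⁻² t)`. -/
lemma isBigO_massH {t : Euc n → ℝ} (hV : IsPotential V) (hh : ∀ i j, Decay t (h i j)) (j : Fin n) :
    (fun x => rho x ^ 2 * massH h V j x) =O[ballEnd n] t := by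
  have hpd : ∀ k i j, (fun x => rho x * pd k (h i j) x) =O[ballEnd n] t := fun k i j =>
    (hh i j).one k
  have hx : ∀ k i j, (fun x : Euc n => x k * h i j x) =O[ballEnd n] t := fun k i j => by
    simpa using (isBigO_coord k).mul (hh i j).zero
  have s1 : (fun x => ∑ i, rho x * pd i (h i j) x) =O[ballEnd n] t :=
    IsBigO.fun_sum fun i _ => hpd i i j
  have s2 : (fun x => ∑ i, rho x * pd j (h i i) x) =O[ballEnd n] t :=
    IsBigO.fun_sum fun i _ => hpd j i i
  have s3 : (fun x : Euc n => ∑ i, x i * h i j x) =O[ballEnd n] t :=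
    IsBigO.fun_sum fun i _ => hx i i j
  have s4 : (fun x : Euc n => ∑ i, x j * h i i x) =O[ballEnd n] t :=
    IsBigO.fun_sum fun i _ => hx j i i
  have h1 : (fun x : Euc n => ∑ i, rho x * pd i (h i j) x
      + (n * ∑ i, x i * h i j x - ∑ i, x j * h i i x)
      - ∑ i, rho x * pd j (h i i) x) =O[ballEnd n] t :=
    (s1.add ((s3.const_mul_left _).sub s4)).sub s2
  have h2 : (fun x => ∑ i, h i j x * (rho x ^ 2 * pd i V x)) =O[ballEnd n] t :=
    IsBigO.fun_sum fun i _ => by simpa using (hh i j).zero.mul (hV.bound_pd i)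
  have h3 : (fun x => (∑ i, h i i x) * (rho x ^ 2 * pd j V x)) =O[ballEnd n] t := by
    have s5 : (fun x => ∑ i, h i i x) =O[ballEnd n] t := IsBigO.fun_sum fun i _ => (hh i i).zero
    simpa using s5.mul (hV.bound_pd j)
  have h4 : (fun x : Euc n => (rho x * V x) * (∑ i, rho x * pd i (h i j) x
      + (n * ∑ i, x i * h i j x - ∑ i, x j * h i i x)
      - ∑ i, rho x * pd j (h i i) x)) =O[ballEnd n] t := by
    simpa using hV.bound.mul h1
  refine ((h4.sub h2).add h3).congr' ?_ EventuallyEq.rfl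
  filter_upwards [eventually_rho_pos n] with x hr
  have e2 : ∑ i, h i j x * (rho x ^ 2 * pd i V x) = rho x ^ 2 * ∑ i, h i j x * pd i V x := by
    rw [Finset.mul_sum]; exact Finset.sum_congr rfl fun _ _ => by ring
  simp only [massH, e2, ← Finset.mul_sum]
  field_simp

/-- The mass integrals of a metric with integrable scalar curvature converge. -/
theorem exists_tendsto_sphereFlux_massH (hn : 3 ≤ n) {τ : ℝ} (hτ : (n : ℝ) / 2 < τ)
    (H : IsEndMetric (fun x => rho x ^ τ) G h) (hV : IsPotential V) {R : ℝ}
    (hint : IntegrableOn (fun x => (scalarCurvature G x + (n : ℝ) * ((n : ℝ) - 1)) / rho x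
      * √(compMat G x).det) (hypExterior n R)) :
    ∃ L, Tendsto (sphereFlux (massH h V)) (𝓝[>] 0) (𝓝 L) := by
  set F : Fin n → Euc n → ℝ := fun j x => fluxWeight x * massH h V j x with hF
  set g : Euc n → ℝ := fun x => (scalarCurvature G x + (n : ℝ) * ((n : ℝ) - 1)) / rho x
      * √(compMat G x).det with hg
  have hdet : Tendsto (fun x => (√(gam h x).det)⁻¹) (ballEnd n) (𝓝 1) := by
    have := (H.tendsto_det.sqrt).inv₀ (by simp)
    simpa using this
  have hwρ : ∀ x : Euc n, 0 < rho x → fluxWeight x * (rho x)⁻¹ ^ 2 = (rho x ^ n)⁻¹ := by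
    intro x hx
    rw [fluxWeight, ← pow_add, Nat.sub_add_cancel (by omega), inv_pow]
  -- The Riemannian density is `ρ^{-n} √det(δ + h)`, and `ρ^{2-n} ρ⁻² = ρ^{-n}`. So this part of the
  -- divergence is the integrable function `g` times the bounded factor `ρ V / √det(δ + h)`.
  have hA : (fun x => fluxWeight x * (rho x)⁻¹ ^ 2 * V x
      * (scalarCurvature G x + n * (n - 1))) =O[ballEnd n] g := by
    have h1 : (fun x => (rho x * V x) * (√(gam h x).det)⁻¹ * g x) =O[ballEnd n] g := by
      simpa using (hV.bound.mul (hdet.isBigO_one ℝ)).mul (isBigO_refl g _)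
    refine h1.congr' ?_ EventuallyEq.rfl
    filter_upwards [H.comp, eventually_rho_pos n, H.tendsto_det.eventually (lt_mem_nhds one_pos)]
      with x h2 h3 h4
    have e : √(compMat G x).det = (rho x ^ n)⁻¹ * √(gam h x).det := by
      rw [h2, Matrix.det_smul, Fintype.card_fin,
        show (rho x ^ 2)⁻¹ ^ n = ((rho x ^ n)⁻¹) ^ 2 by rw [← inv_pow, ← inv_pow]; ring,
        Real.sqrt_mul (by positivity), Real.sqrt_sq (by positivity)]
    have h5 : √(gam h x).det ≠ 0 := (Real.sqrt_pos.2 h4).ne'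
    rw [hg, hwρ x h3]
    simp only [e]
    field_simp
  -- `ρ^{-n}` from the weight, `ρ⁻¹` from `V`, `ρ^{2τ}` from the quadratic remainder.
  have hB : (fun x => fluxWeight x * (rho x)⁻¹ ^ 2 * V x
      * (scalarCurvature G x + n * (n - 1) - IsEndMetric.linScal h x)) =O[ballEnd n]
      fun x => rho x ^ (2 * τ - n - 1) := by
    have h1 := (hV.bound.mul H.firstOrder_scalarCurvature).mul
      (isBigO_refl (fun x : Euc n => (rho x ^ n)⁻¹ * (rho x)⁻¹) (ballEnd n))
    refine h1.congr' ?_ ?_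
    · filter_upwards [eventually_rho_pos n] with x h3
      rw [hwρ x h3]
      field_simp
    · filter_upwards [eventually_rho_pos n] with x h3
      rw [Real.rpow_sub h3, Real.rpow_sub h3, Real.rpow_one, Real.rpow_natCast,
        mul_comm 2 τ, Real.rpow_mul h3.le, Real.rpow_two]
      field_simp
  have hdiv := sum_pd_fluxWeight_mul_massH hn hV H.smooth_all H.symm
  have hO : (fun x => ∑ j, pd j (F j) x) =O[ballEnd n]
      fun x => |g x| + rho x ^ (2 * τ - n - 1) := by
    have hnn : ∀ᶠ x in ballEnd n, 0 ≤ rho x ^ (2 * τ - n - 1) :=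
      (eventually_rho_pos n).mono fun x hx => Real.rpow_nonneg hx.le _
    have g1 : g =O[ballEnd n] fun x => |g x| + rho x ^ (2 * τ - n - 1) := by
      refine IsBigO.of_bound 1 (hnn.mono fun x hx => ?_)
      rw [one_mul, Real.norm_eq_abs, Real.norm_of_nonneg (by positivity)]
      linarith
    have g2 : (fun x : Euc n => rho x ^ (2 * τ - n - 1)) =O[ballEnd n]
        fun x => |g x| + rho x ^ (2 * τ - n - 1) := by
      refine IsBigO.of_bound 1 (hnn.mono fun x hx => ?_)
      rw [one_mul, Real.norm_of_nonneg hx, Real.norm_of_nonneg (by positivity)]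
      linarith [abs_nonneg (g x)]
    refine ((hA.trans g1).sub (hB.trans g2)).congr' ?_ EventuallyEq.rfl
    filter_upwards [hdiv] with x hx
    rw [hx]
    ring
  obtain ⟨C, hC⟩ := hO.bound
  have hsm : ∀ᶠ x in ballEnd n, ∀ j, ContDiffAt ℝ 1 (F j) x := by
    filter_upwards [H.smooth_all, eventually_rho_pos n] with x h1 h2 j
    exact (contDiffAt_fluxWeight h2.ne').mul (contDiffAt_massH hV h2.ne' h1 j)
  -- One shell on which the bound, the smoothness and the inclusion in the region of the
  -- integrability hypothesis hold together.
  obtain ⟨a, ha0, ha1, ha⟩ := exists_shell_of_eventually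
    ((hC.and hsm).and (eventually_mem_hypExterior (n := n) R))
  have hFs : ∀ j, ContDiffOn ℝ 1 (F j) (shell n a) := fun j x hx =>
    ((ha x hx).1.2 j).contDiffWithinAt
  have hn0 : n ≠ 0 := by omega
  obtain ⟨L, hL⟩ := exists_tendsto_flux hn0 ha0 ha1 hFs (by
    have i1 : IntegrableOn g (shell n a) := hint.mono_set fun x hx => (ha x hx).2
    -- `τ > n/2` is exactly `2τ - n - 1 > -1`.
    have i2 : IntegrableOn (fun x : Euc n => rho x ^ (2 * τ - n - 1)) (shell n a) :=
      integrableOn_rho_rpow hn0 (by linarith)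
    refine Integrable.mono' ((i1.abs.add i2).const_mul C) ?_ ?_
    · refine ContinuousOn.aestronglyMeasurable ?_ (isOpen_shell n a).measurableSet
      exact continuousOn_finsetSum _ fun j _ =>
        ((hFs j).continuousOn_fderiv_of_isOpen (isOpen_shell n a) le_rfl).clm_apply
          continuousOn_const
    · rw [ae_restrict_iff' (isOpen_shell n a).measurableSet]
      refine Eventually.of_forall fun x hx => ((ha x hx).1.1).trans_eq ?_
      rw [Real.norm_of_nonneg]
      · rfl
      · exact add_nonneg (abs_nonneg _) (Real.rpow_nonneg (rho_pos_iff.2 hx.2).le _))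
  refine ⟨L, (hL.comp tendsto_sqrt_one_sub).congr' ?_⟩
  filter_upwards [Ioo_mem_nhdsGT (show (0 : ℝ) < 1 / 2 by norm_num)] with ε hε
  rw [sphereFlux_eq (by omega) _ hε]
  rfl

lemma massH_add {a b : Fin n → Fin n → Euc n → ℝ} {x : Euc n}
    (ha : ∀ i j, DifferentiableAt ℝ (a i j) x) (hb : ∀ i j, DifferentiableAt ℝ (b i j) x)
    (j : Fin n) : massH (fun i j y => a i j y + b i j y) V j x = massH a V j x + massH b V j x := by
  simp only [massH, pd_add (ha _ _) (hb _ _), Finset.sum_add_distrib, mul_add, add_mul]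
  ring

/-- For `h = φ δ` the zeroth-order terms `n xⱼ φ - n xⱼ φ` cancel, the derivative terms give `(1 -
n) V ∂ⱼφ`, and the last two give `(n - 1) φ ∂ⱼV`. -/
lemma massH_kd {φ : Euc n → ℝ} {x : Euc n} (hφ : DifferentiableAt ℝ φ x)
    (j : Fin n) : massH (fun i j y => kd i j * φ y) V j x
      = (n - 1) * wronskianForm φ V j x := by
  have e1 : ∑ i, x i * (kd i j * φ x) = x j * φ x := by
    rw [← sum_kd_mul' j fun i => x i * φ x]
    exact Finset.sum_congr rfl fun i _ => by ring
  have e2 : ∑ i, kd i j * φ x * pd i V x = φ x * pd j V x := by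
    rw [← sum_kd_mul' j fun i => φ x * pd i V x]
    exact Finset.sum_congr rfl fun i _ => by ring
  simp only [massH, pd_const_mul _ hφ, wronskianForm, sum_kd_mul', ← Finset.sum_mul, sum_kd_self,
    e1, e2]
  ring

end Mass

/-! ### Weighted Hölder norms -/

section Weighted

variable {n : ℕ}

lemma zero_mem_normalizedCoord_preimage {x : Euc n} (hx : ‖x‖ < 1) :
    (0 : Euc n) ∈ normalizedCoord x ⁻¹' hypBall x 1 := by
  simp [normalizedCoord, hypBall, hypDist, hx]

lemma enorm_iteratedFDeriv_le_holderNormOn {E F : Type*} [NormedAddCommGroup E] [NormedSpace ℝ E]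
    [NormedAddCommGroup F] [NormedSpace ℝ F] {k j : ℕ} (hj : j ≤ k) {α : ℝ≥0} {U : Set E}
    {f : E → F} {y : E} (hy : y ∈ U) :
    ‖iteratedFDeriv ℝ j f y‖ₑ ≤ holderNormOn k α U f := by
  refine le_trans ?_ le_self_add
  refine le_trans (le_iSup₂_of_le (f := fun y _ => ‖iteratedFDeriv ℝ j f y‖ₑ) y hy le_rfl) ?_
  exact Finset.single_le_sum (f := fun j => ⨆ y ∈ U, ‖iteratedFDeriv ℝ j f y‖ₑ)
    (fun _ _ => zero_le) (Finset.mem_range.2 (by omega))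

lemma fderiv_comp_affine {F : Type*} [NormedAddCommGroup F] [NormedSpace ℝ F] {f : Euc n → F}
    {x ξ : Euc n} {c : ℝ} (hf : DifferentiableAt ℝ f (x + c • ξ)) :
    fderiv ℝ (fun ξ => f (x + c • ξ)) ξ = c • fderiv ℝ f (x + c • ξ) := by
  have h1 : HasFDerivAt (fun ξ : Euc n => x + c • ξ) (c • ContinuousLinearMap.id ℝ (Euc n)) ξ :=
    ((hasFDerivAt_id ξ).const_smul c).const_add x
  have h2 : HasFDerivAt (fun ξ => f (x + c • ξ)) _ ξ := hf.hasFDerivAt.comp ξ h1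
  rw [h2.fderiv]
  ext v
  simp

lemma norm_basisVec (i : Fin n) : ‖(basisVec i : Euc n)‖ = 1 := by simp [basisVec]

/-- Functions with finite weighted norm decay. -/
lemma decay_of_weightedNorm {F : Type*} [NormedAddCommGroup F] [NormedSpace ℝ F] {f : Euc n → F}
    {m k : ℕ} (hk : 2 ≤ k) {α : ℝ≥0} {τ R : ℝ} (hf : ∀ᶠ x in ballEnd n, ContDiffAt ℝ 2 f x)
    (hW : ⨆ x ∈ hypExterior n R, ENNReal.ofReal (rho x ^ (-τ))
      * holderNormOn k α (normalizedCoord x ⁻¹' hypBall x 1)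
        (fun ξ => rho x ^ m • f (normalizedCoord x ξ)) < ⊤) (L : F →L[ℝ] ℝ) :
    Decay (fun x => (rho x ^ m)⁻¹ * rho x ^ τ) (fun x => L (f x)) := by
  set W := ⨆ x ∈ hypExterior n R, ENNReal.ofReal (rho x ^ (-τ))
      * holderNormOn k α (normalizedCoord x ⁻¹' hypBall x 1)
        (fun ξ => rho x ^ m • f (normalizedCoord x ξ)) with hWdef
  set C := W.toReal
  -- Of the norm on each ball only the derivatives of order at most two at the centre `ξ = 0` are
  -- kept. In the coordinate `y = x + ρ(x) ξ` each derivative carries one factor `ρ(x)`, which gives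
  -- the scaled derivatives. The exponent `m` is 0 for functions and 2 for 2-tensors.
  have hbound : ∀ x ∈ hypExterior n R, ∀ j ≤ 2,
      ‖iteratedFDeriv ℝ j (fun ξ => rho x ^ m • f (normalizedCoord x ξ)) 0‖ ≤ C * rho x ^ τ := by
    intro x hx j hj
    have hr : 0 < rho x := rho_pos_iff.2 hx.1
    have h1 : ENNReal.ofReal (rho x ^ (-τ))
        * ‖iteratedFDeriv ℝ j (fun ξ => rho x ^ m • f (normalizedCoord x ξ)) 0‖ₑ ≤ W :=
      (mul_le_mul_right (enorm_iteratedFDeriv_le_holderNormOn (hj.trans hk)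
        (zero_mem_normalizedCoord_preimage hx.1)) _).trans
        (le_iSup₂_of_le (f := fun x _ => ENNReal.ofReal (rho x ^ (-τ))
          * holderNormOn k α (normalizedCoord x ⁻¹' hypBall x 1)
          (fun ξ => rho x ^ m • f (normalizedCoord x ξ))) x hx le_rfl)
    have h2 := ENNReal.toReal_mono hW.ne h1
    rw [ENNReal.toReal_mul, ENNReal.toReal_ofReal (Real.rpow_nonneg hr.le _), toReal_enorm,
      Real.rpow_neg hr.le] at h2
    have h3 : 0 < rho x ^ τ := Real.rpow_pos_of_pos hr τ
    rwa [inv_mul_le_iff₀ h3, mul_comm] at h2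
  have hev := (hf.and (eventually_mem_hypExterior (n := n) R)).and (eventually_rho_pos n)
  have key : ∀ᶠ x in ballEnd n, ‖f x‖ ≤ C * ((rho x ^ m)⁻¹ * rho x ^ τ) ∧
      rho x * ‖fderiv ℝ f x‖ ≤ C * ((rho x ^ m)⁻¹ * rho x ^ τ) ∧
      rho x ^ 2 * ‖fderiv ℝ (fderiv ℝ f) x‖ ≤ C * ((rho x ^ m)⁻¹ * rho x ^ τ) := by
    filter_upwards [hev] with x ⟨⟨h1, h2⟩, h3⟩
    have hb := hbound x h2
    have hm : 0 < rho x ^ m := pow_pos h3 m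
    have e0 : x + rho x • (0 : Euc n) = x := by simp
    have hd : ∀ᶠ ξ in 𝓝 (0 : Euc n), DifferentiableAt ℝ f (x + rho x • ξ) := by
      have hc : ContinuousAt (fun ξ : Euc n => x + rho x • ξ) 0 := by fun_prop
      have := hc.tendsto
      rw [e0] at this
      exact this.eventually ((h1.eventually (by simp)).mono fun _ h => h.differentiableAt (by simp))
    have hfd : ∀ ξ : Euc n, DifferentiableAt ℝ f (x + rho x • ξ) →
        fderiv ℝ (fun ξ => rho x ^ m • f (normalizedCoord x ξ)) ξ
          = (rho x ^ m * rho x) • fderiv ℝ f (x + rho x • ξ) := by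
      intro ξ h
      have h4 : DifferentiableAt ℝ (fun ξ => f (x + rho x • ξ)) ξ :=
        DifferentiableAt.comp (g := f) (f := fun ξ : Euc n => x + rho x • ξ) ξ h (by fun_prop)
      simp only [normalizedCoord]
      rw [fderiv_fun_const_smul h4, fderiv_comp_affine h, smul_smul]
    have hfd2 : fderiv ℝ (fderiv ℝ fun ξ => rho x ^ m • f (normalizedCoord x ξ)) 0
          = (rho x ^ m * rho x * rho x) • fderiv ℝ (fderiv ℝ f) x := by
      have h5 : DifferentiableAt ℝ (fderiv ℝ f) (x + rho x • (0 : Euc n)) := by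
        rw [e0]
        exact (h1.fderiv_right (m := 1) (by norm_num)).differentiableAt one_ne_zero
      have h4 : DifferentiableAt ℝ (fun ξ => fderiv ℝ f (x + rho x • ξ)) 0 :=
        DifferentiableAt.comp (g := fderiv ℝ f) (f := fun ξ : Euc n => x + rho x • ξ) 0 h5
          (by fun_prop)
      have h6 : fderiv ℝ (fun ξ => rho x ^ m • f (normalizedCoord x ξ)) =ᶠ[𝓝 0]
          fun ξ => (rho x ^ m * rho x) • fderiv ℝ f (x + rho x • ξ) := by
        filter_upwards [hd] with ξ hξ using hfd ξ hξ
      rw [h6.fderiv_eq, fderiv_fun_const_smul h4, fderiv_comp_affine h5, smul_smul, e0]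
    have b0 := hb 0 (by norm_num)
    have b1 := hb 1 (by norm_num)
    have b2 := hb 2 le_rfl
    rw [norm_iteratedFDeriv_zero, normalizedCoord, e0, norm_smul, Real.norm_of_nonneg hm.le] at b0
    rw [norm_iteratedFDeriv_one, hfd 0 hd.self_of_nhds, e0, norm_smul,
      Real.norm_of_nonneg (by positivity)] at b1
    rw [← norm_iteratedFDeriv_fderiv, norm_iteratedFDeriv_one, hfd2, norm_smul,
      Real.norm_of_nonneg (by positivity)] at b2
    have e : C * ((rho x ^ m)⁻¹ * rho x ^ τ) = (C * rho x ^ τ) / rho x ^ m := by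
      rw [div_eq_mul_inv]; ring
    rw [e]
    refine ⟨?_, ?_, ?_⟩ <;> rw [le_div_iff₀ hm]
    · linarith
    · linarith
    · linarith
  have hnn : ∀ᶠ x : Euc n in ballEnd n, 0 ≤ (rho x ^ m)⁻¹ * rho x ^ τ := by
    filter_upwards [eventually_rho_pos n] with x hx
    have := Real.rpow_pos_of_pos hx τ
    positivity
  have hpd : ∀ᶠ x in ballEnd n, ∀ i, pd i (fun y => L (f y)) x = L (fderiv ℝ f x (basisVec i)) := by
    filter_upwards [hf] with x hx i
    have : HasFDerivAt (fun y => L (f y)) _ x :=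
      L.hasFDerivAt.comp x (hx.differentiableAt (by simp)).hasFDerivAt
    rw [pd, this.fderiv]
    rfl
  have hpd2 : ∀ᶠ x in ballEnd n, ∀ i j, pd i (pd j fun y => L (f y)) x
      = L (fderiv ℝ (fderiv ℝ f) x (basisVec i) (basisVec j)) := by
    filter_upwards [hf, eventually_eventually_ballEnd hpd] with x hx h i j
    rw [pd_congr (h.mono fun y hy => hy j)]
    have h5 : DifferentiableAt ℝ (fderiv ℝ f) x :=
      (hx.fderiv_right (m := 1) (by norm_num)).differentiableAt one_ne_zero
    have : HasFDerivAt (fun y => L (fderiv ℝ f y (basisVec j))) _ x :=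
      L.hasFDerivAt.comp x (h5.hasFDerivAt.clm_apply (hasFDerivAt_const (basisVec j) x))
    rw [pd, this.fderiv]
    simp
  refine ⟨hf.mono fun x hx => L.contDiff.contDiffAt.comp x hx, ?_, fun i => ?_, fun i j => ?_⟩
  · refine IsBigO.of_bound (‖L‖ * C) ?_
    filter_upwards [key, hnn] with x h1 h2
    rw [Real.norm_of_nonneg h2, mul_assoc]
    exact (L.le_opNorm _).trans (mul_le_mul_of_nonneg_left h1.1 (norm_nonneg _))
  · refine IsBigO.of_bound (‖L‖ * C) ?_
    filter_upwards [key, hnn, hpd, eventually_rho_pos n] with x h1 h2 h3 h4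
    rw [Real.norm_of_nonneg h2, mul_assoc, h3, norm_mul, Real.norm_of_nonneg h4.le]
    have h5 : ‖L (fderiv ℝ f x (basisVec i))‖ ≤ ‖L‖ * ‖fderiv ℝ f x‖ := by
      refine (L.le_opNorm _).trans (mul_le_mul_of_nonneg_left ?_ (norm_nonneg _))
      simpa [norm_basisVec] using (fderiv ℝ f x).le_opNorm (basisVec i)
    calc rho x * ‖L (fderiv ℝ f x (basisVec i))‖ ≤ rho x * (‖L‖ * ‖fderiv ℝ f x‖) :=
          mul_le_mul_of_nonneg_left h5 h4.le
      _ = ‖L‖ * (rho x * ‖fderiv ℝ f x‖) := by ring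
      _ ≤ _ := mul_le_mul_of_nonneg_left h1.2.1 (norm_nonneg _)
  · refine IsBigO.of_bound (‖L‖ * C) ?_
    filter_upwards [key, hnn, hpd2, eventually_rho_pos n] with x h1 h2 h3 h4
    rw [Real.norm_of_nonneg h2, mul_assoc, h3, norm_mul, Real.norm_of_nonneg (by positivity)]
    have h5 : ‖L (fderiv ℝ (fderiv ℝ f) x (basisVec i) (basisVec j))‖
        ≤ ‖L‖ * ‖fderiv ℝ (fderiv ℝ f) x‖ := by
      refine (L.le_opNorm _).trans (mul_le_mul_of_nonneg_left ?_ (norm_nonneg _))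
      simpa [norm_basisVec] using
        (fderiv ℝ (fderiv ℝ f) x).le_opNorm₂ (basisVec i) (basisVec j)
    calc rho x ^ 2 * ‖L (fderiv ℝ (fderiv ℝ f) x (basisVec i) (basisVec j))‖
          ≤ rho x ^ 2 * (‖L‖ * ‖fderiv ℝ (fderiv ℝ f) x‖) :=
          mul_le_mul_of_nonneg_left h5 (by positivity)
      _ = ‖L‖ * (rho x ^ 2 * ‖fderiv ℝ (fderiv ℝ f) x‖) := by ring
      _ ≤ _ := mul_le_mul_of_nonneg_left h1.2.2 (norm_nonneg _)

lemma decay_rho : Decay (rho (n := n)) rho := by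
  have h1 : ∀ j, pd j (rho (n := n)) = fun x => (-1) * x j := fun j => by
    ext x; rw [pd_rho]; ring
  refine ⟨Eventually.of_forall fun x => contDiff_rho.contDiffAt, isBigO_refl _ _, fun i => ?_,
    fun i j => ?_⟩
  · simp only [h1]
    simpa using (isBigO_refl (rho (n := n)) _).mul (isBigO_coord i)
  · have h2 : ∀ x : Euc n, pd i (pd j rho) x = -kd i j := fun x => by
      rw [h1, pd_const_mul _ (differentiableAt_coord j), pd_coord, kd]
      split_ifs <;> ring
    simp only [h2, pow_two, mul_assoc]
    simpa using (isBigO_refl (rho (n := n)) _).mul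
      (isBigO_rho.mul (isBigO_const_const (kd i j) one_ne_zero (ballEnd n)))

lemma tendsto_rho_rpow {τ : ℝ} (hτ : 0 < τ) :
    Tendsto (fun x : Euc n => rho x ^ τ) (ballEnd n) (𝓝 0) := by
  have := (Real.continuousAt_rpow_const 0 τ (Or.inr hτ.le)).tendsto
  rw [Real.zero_rpow hτ.ne'] at this
  exact this.comp ((tendsto_rho n).mono_right nhdsWithin_le_nhds)

/-- A flux of a mass 1-form of order `ρ^{2τ}` vanishes at infinity. -/
lemma tendsto_sphereFlux_massH_zero (hn : 3 ≤ n) {τ : ℝ} (hτ : (n : ℝ) / 2 < τ) {V : Euc n → ℝ}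
    (hV : IsPotential V) {r : Fin n → Fin n → Euc n → ℝ}
    (hr : ∀ i j, Decay (fun x => rho x ^ τ * rho x ^ τ) (r i j)) :
    Tendsto (sphereFlux (massH r V)) (𝓝[>] 0) (𝓝 0) := by
  refine tendsto_sphereFlux_zero (by omega) fun j => ?_
  have h1 := (isBigO_massH hV hr j).mul (isBigO_refl (fun x : Euc n => (rho x ^ n)⁻¹) (ballEnd n))
  refine (h1.trans_tendsto ?_).congr' ?_
  · refine (tendsto_rho_rpow (n := n) (τ := 2 * τ - n) (by linarith)).congr' ?_
    filter_upwards [eventually_rho_pos n] with x hx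
    rw [Real.rpow_sub hx, Real.rpow_natCast, two_mul, Real.rpow_add hx, div_eq_mul_inv]
  · filter_upwards [eventually_rho_pos n] with x hx
    have : (rho x ^ n)⁻¹ = fluxWeight x * (rho x)⁻¹ ^ 2 := by
      rw [fluxWeight, ← pow_add, Nat.sub_add_cancel (by omega), inv_pow]
    rw [this]
    field_simp

lemma decay_of_memWeightedHolder {H : Type*} [TopologicalSpace H] {I : ModelWithCorners ℝ (Euc n) H}
    {M : Type*} [TopologicalSpace M] [ChartedSpace H M] {Ψ : ChartAtInfinity I M} {α : ℝ≥0} {τ : ℝ}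
    {k : ℕ} (hk : 2 ≤ k) {θ : M → ℝ}
    (hθ : MemWeightedHolder k α τ Ψ θ) :
    Decay (fun x => rho x ^ τ) (θ ∘ Ψ.toHomeo.symm) := by
  have h1 : ∀ᶠ x in ballEnd n, ContDiffAt ℝ 2 (θ ∘ Ψ.toHomeo.symm) x := by
    filter_upwards [eventually_eventually_ballEnd (eventually_mem_hypExterior Ψ.radius)] with x hx
    exact (hθ.locHolder_end.1.contDiffAt hx).of_le (by exact_mod_cast hk)
  have h2 := decay_of_weightedNorm (m := 0) (k := k) (α := α) (τ := τ) (R := Ψ.radius + 1) hk h1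
    (by
      simp only [pow_zero, one_smul]
      exact hθ.weightedNorm_lt_top) (ContinuousLinearMap.id ℝ ℝ)
  simp only [pow_zero, inv_one, one_mul] at h2
  exact h2

end Weighted

/-! ### Asymptotically hyperbolic metrics -/

section Manifold

variable {n : ℕ} {H : Type*} [TopologicalSpace H] {I : ModelWithCorners ℝ (Euc n) H}
  {M : Type*} [TopologicalSpace M] [ChartedSpace H M] [IsManifold I ∞ M]
  {Ψ : ChartAtInfinity I M} {g : Metric I M} {α : ℝ≥0} {τ : ℝ}

/-- The components of `ρ² (Ψ_* g - b)`. -/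
def scaledError (Ψ : ChartAtInfinity I M) (g : Metric I M) (i j : Fin n) (x : Euc n) : ℝ :=
  rho x ^ 2 * compMat (metricError Ψ g) x i j

lemma compMat_hypMetric (x : Euc n) (i j : Fin n) :
    compMat hypMetric x i j = (rho x ^ 2)⁻¹ * kd i j := by
  have e : hypMetric x (basisVec i) (basisVec j)
      = (rho x ^ 2)⁻¹ * inner ℝ (basisVec i) (basisVec j) := rfl
  rw [compMat, Matrix.of_apply, e, inner_basisVec]
  simp [basisVec, kd, eq_comm]

lemma compMat_metricError (Ψ : ChartAtInfinity I M) (g : Metric I M) (x : Euc n) (i j : Fin n) :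
    compMat (metricError Ψ g) x i j = compMat (pushMetric Ψ g) x i j - (rho x ^ 2)⁻¹ * kd i j := by
  rw [← compMat_hypMetric]
  rfl

lemma compMat_pushMetric_symm (Ψ : ChartAtInfinity I M) (g : Metric I M) (x : Euc n)
    (i j : Fin n) : compMat (pushMetric Ψ g) x i j = compMat (pushMetric Ψ g) x j i :=
  g.symm _ _ _

lemma scaledError_symm (Ψ : ChartAtInfinity I M) (g : Metric I M) (x : Euc n) (i j : Fin n) :
    scaledError Ψ g i j x = scaledError Ψ g j i x := by
  rw [scaledError, scaledError, compMat_metricError, compMat_metricError, compMat_pushMetric_symm,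
    kd_comm]

lemma isEndMetric_pushMetric (hτ : 0 < τ)
    (hd : ∀ i j, Decay (fun x => rho x ^ τ) (scaledError Ψ g i j)) :
    IsEndMetric (fun x => rho x ^ τ) (pushMetric Ψ g) (scaledError Ψ g) := by
  refine ⟨tendsto_rho_rpow hτ, ?_, Eventually.of_forall fun x i j => scaledError_symm Ψ g x i j, hd⟩
  filter_upwards [eventually_rho_pos n] with x hx
  ext i j
  rw [Matrix.smul_apply, smul_eq_mul, gam, Matrix.of_apply, scaledError, compMat_metricError]
  field_simp
  ring

/-- The components of `e` decay like `ρ^{τ-2}` in the scaled sense; multiplication by `ρ²`, which is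
smooth and itself decays like `ρ²`, restores the rate `ρ^τ`. -/
lemma decay_scaledError (hg : IsAsympHyp 2 α τ Ψ g) (i j : Fin n) :
    Decay (fun x => rho x ^ τ) (scaledError Ψ g i j) := by
  let L : Tensor2 n →L[ℝ] ℝ := (ContinuousLinearMap.apply ℝ ℝ (basisVec j)).comp
    (ContinuousLinearMap.apply ℝ (Euc n →L[ℝ] ℝ) (basisVec i))
  have h1 : ∀ᶠ x in ballEnd n, ContDiffAt ℝ 2 (metricError Ψ g) x := by
    filter_upwards [eventually_eventually_ballEnd (eventually_mem_hypExterior Ψ.radius)] with x hx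
    exact hg.locHolder_error.1.contDiffAt hx
  have h2 := decay_of_weightedNorm (m := 2) le_rfl h1 hg.weightedNorm_lt_top L
  refine ((decay_rho.mul decay_rho).mul h2).mono ?_ |>.congr (Eventually.of_forall fun x => ?_)
  · refine (isBigO_refl (fun x : Euc n => rho x ^ τ) (ballEnd n)).congr' ?_ EventuallyEq.rfl
    filter_upwards [eventually_rho_pos n] with x hx
    field_simp
  · simp only [scaledError, L, compMat, Matrix.of_apply, ContinuousLinearMap.comp_apply,
      ContinuousLinearMap.apply_apply]
    ring

lemma pushMetric_conformal (φ : M → ℝ) (x : Euc n) :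
    pushMetric Ψ (conformal φ g) x
      = Real.exp (φ (Ψ.toHomeo.symm x)) • pushMetric Ψ g x := rfl

lemma massIntegral_eventuallyEq (hd : ∀ i j, Decay (fun x => rho x ^ τ) (scaledError Ψ g i j))
    (V : Euc n → ℝ) : massIntegral Ψ g V =ᶠ[𝓝[>] 0] fun ε =>
      (2 * sphereVolume n * ((n : ℝ) - 1))⁻¹ * sphereFlux (massH (scaledError Ψ g) V) ε := by
  have h1 : ∀ᶠ x in ballEnd n, ∀ i j, DifferentiableAt ℝ (scaledError Ψ g i j) x :=
    eventually_all.2 fun i => eventually_all.2 fun j =>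
      (hd i j).smooth.mono fun x hx => hx.differentiableAt (by simp)
  have h2 : ∀ᶠ x in ballEnd n, ∀ j, massForm (metricError Ψ g) V j x
      = massH (scaledError Ψ g) V j x := by
    refine (massForm_eq ?_ h1 (Eventually.of_forall fun x i j => scaledError_symm Ψ g x i j)).mono
      fun x hx j => hx V j
    filter_upwards [eventually_rho_pos n] with x hx i j
    rw [scaledError]
    field_simp
  filter_upwards [sphereFlux_congr h2] with ε hε
  rw [massIntegral, hε]

/-- The expansion of the error of the metric `e^{φ} g`, to first order in `φ`. -/
lemma scaledError_conformal (φ : M → ℝ) (i j : Fin n) {x : Euc n} (hx : 0 < rho x) :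
    scaledError Ψ (conformal φ g) i j x = scaledError Ψ g i j x
      + (kd i j * (φ ∘ Ψ.toHomeo.symm) x
        + (kd i j * (Real.exp ((φ ∘ Ψ.toHomeo.symm) x) - 1 - (φ ∘ Ψ.toHomeo.symm) x)
          + (Real.exp ((φ ∘ Ψ.toHomeo.symm) x) - 1) * scaledError Ψ g i j x)) := by
  have e : compMat (pushMetric Ψ (conformal φ g)) x i j
      = Real.exp (φ (Ψ.toHomeo.symm x)) * compMat (pushMetric Ψ g) x i j := by
    simp only [compMat, Matrix.of_apply, pushMetric_conformal]
    rfl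
  simp only [scaledError, compMat_metricError, e, Function.comp_apply]
  field_simp
  ring

end Manifold

end AHMass

end

/-! ### Comparison of the two masses -/

open AHMass in
theorem mainTheorem7 {n : ℕ} (hn : 3 ≤ n)
    {H : Type*} [TopologicalSpace H] (I : ModelWithCorners ℝ (AHMass.Euc n) H)
    {M : Type*} [TopologicalSpace M] [T2Space M] [SecondCountableTopology M]
    [ChartedSpace H M] [IsManifold I ∞ M]
    {k : ℕ} (hk : 2 ≤ k) {α : ℝ≥0} (hα₀ : 0 < α) (hα₁ : α < 1)
    {τ : ℝ} (hτ : (n : ℝ) / 2 < τ) {κ : ℝ} (hκ : κ = 4 / ((n : ℝ) - 2))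
    (Ψ : AHMass.ChartAtInfinity I M) (g : AHMass.Metric I M)
    (hg : AHMass.IsAsympHyp 2 α τ Ψ g) (hg_scal : AHMass.ScalarIntegrable Ψ g)
    (θ : M → ℝ) (hθ : AHMass.MemWeightedHolder k α τ Ψ θ)
    (ghat : AHMass.Metric I M) (hghat : ghat = AHMass.conformal (fun p => κ * θ p) g)
    (hghat_scal : AHMass.ScalarIntegrable Ψ ghat)
    (V : AHMass.Euc n → ℝ) (hV : V ∈ AHMass.kernelSpace n) :
    Tendsto (AHMass.massIntegral Ψ g V) (𝓝[>] 0) (𝓝 (AHMass.massFunctional Ψ g V)) ∧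
    Tendsto (AHMass.massIntegral Ψ ghat V) (𝓝[>] 0) (𝓝 (AHMass.massFunctional Ψ ghat V)) ∧
    ∃ L : ℝ,
      Tendsto (AHMass.sphereFlux (AHMass.wronskianForm (θ ∘ Ψ.toHomeo.symm) V))
        (𝓝[>] 0) (𝓝 L) ∧
      AHMass.massFunctional Ψ ghat V - AHMass.massFunctional Ψ g V
        = κ / (2 * AHMass.sphereVolume n) * L := by
  have hn' : (3 : ℝ) ≤ n := by exact_mod_cast hn
  have hτ0 : 0 < τ := by linarith
  have hκ0 : κ ≠ 0 := by
    rw [hκ]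
    exact div_ne_zero (by norm_num) (by linarith)
  have hP := isPotential_of_mem hV
  have hs := tendsto_rho_rpow (n := n) hτ0
  have dg := fun i j => decay_scaledError hg i j
  set φ : AHMass.Euc n → ℝ := fun x => κ * (θ ∘ Ψ.toHomeo.symm) x with hφ
  have dφ : Decay (fun x => rho x ^ τ) φ := (decay_of_memWeightedHolder hk hθ).const_mul κ
  -- The part of the conformal perturbation that is quadratic in the decaying quantities: the Taylor
  -- remainder of the exponential, and the product of `e^φ - 1` with `h`.
  set r : Fin n → Fin n → AHMass.Euc n → ℝ := fun i j x =>
    kd i j * (Real.exp (φ x) - 1 - φ x) + (Real.exp (φ x) - 1) * scaledError Ψ g i j x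
  have dr : ∀ i j, Decay (fun x => rho x ^ τ * rho x ^ τ) (r i j) := fun i j =>
    ((dφ.exp_sub_one_sub hs).const_mul (kd i j)).add ((dφ.exp_sub_one hs).mul (dg i j))
  have hexp : ∀ᶠ x in ballEnd n, ∀ i j, scaledError Ψ ghat i j x
      = scaledError Ψ g i j x + (kd i j * φ x + r i j x) := by
    filter_upwards [eventually_rho_pos n] with x hx i j
    rw [hghat, scaledError_conformal _ i j hx]
    rfl
  have dghat : ∀ i j, Decay (fun x => rho x ^ τ) (scaledError Ψ ghat i j) := fun i j => by
    have h1 : (fun x : AHMass.Euc n => rho x ^ τ * rho x ^ τ) =O[ballEnd n]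
        fun x => rho x ^ τ := by
      simpa using (hs.isBigO_one ℝ).mul (isBigO_refl (fun x : AHMass.Euc n => rho x ^ τ) _)
    exact ((dg i j).add ((dφ.const_mul (kd i j)).add ((dr i j).mono h1))).congr
      (hexp.mono fun x hx => (hx i j).symm)
  obtain ⟨L₁, hL₁⟩ := exists_tendsto_sphereFlux_massH hn hτ (isEndMetric_pushMetric hτ0 dg) hP
    hg_scal
  obtain ⟨L₂, hL₂⟩ := exists_tendsto_sphereFlux_massH hn hτ (isEndMetric_pushMetric hτ0 dghat) hP
    hghat_scal
  have hr0 := tendsto_sphereFlux_massH_zero hn hτ hP dr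
  have m₁ : Tendsto (massIntegral Ψ g V) (𝓝[>] 0) (𝓝 ((2 * sphereVolume n * ((n : ℝ) - 1))⁻¹ * L₁)) :=
    (hL₁.const_mul _).congr' (massIntegral_eventuallyEq dg V).symm
  have m₂ : Tendsto (massIntegral Ψ ghat V) (𝓝[>] 0)
      (𝓝 ((2 * sphereVolume n * ((n : ℝ) - 1))⁻¹ * L₂)) :=
    (hL₂.const_mul _).congr' (massIntegral_eventuallyEq dghat V).symm
  -- The witness for the flux of `θ dV - V dθ` solves `L₂ - L₁ = κ (n - 1) L`, as linearity of the
  -- mass form dictates; division needs `κ ≠ 0` and `n ≠ 1`.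
  refine ⟨tendsto_nhds_limUnder ⟨_, m₁⟩, tendsto_nhds_limUnder ⟨_, m₂⟩,
    (κ * (n - 1))⁻¹ * (L₂ - L₁), ?_, ?_⟩
  · have hc : κ * ((n : ℝ) - 1) ≠ 0 := mul_ne_zero hκ0 (by linarith)
    have hform : ∀ᶠ x in ballEnd n, ∀ j, massH (scaledError Ψ ghat) V j x
        = massH (scaledError Ψ g) V j x
          + (κ * (n - 1) * wronskianForm (θ ∘ Ψ.toHomeo.symm) V j x + massH r V j x) := by
      filter_upwards [eventually_eventually_ballEnd hexp,
        eventually_all.2 fun i => eventually_all.2 fun j => (dg i j).smooth,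
        eventually_all.2 fun i => eventually_all.2 fun j => (dr i j).smooth,
        (decay_of_memWeightedHolder hk hθ).smooth] with x h1 h2 h3 h4 j
      have d1 := fun i j => (h2 i j).differentiableAt (by simp)
      have d2 := fun i j => (h3 i j).differentiableAt (by simp)
      have d3 : DifferentiableAt ℝ (θ ∘ Ψ.toHomeo.symm) x := h4.differentiableAt (by simp)
      have d4 : DifferentiableAt ℝ φ x := d3.const_mul κ
      have d5 : ∀ i j : Fin n, DifferentiableAt ℝ (fun y => kd i j * φ y) x :=
        fun i j => d4.const_mul (kd i j)
      have e1 : massH (scaledError Ψ ghat) V j x = massH (fun i j y => scaledError Ψ g i j y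
          + (kd i j * φ y + r i j y)) V j x := by
        have e2 : ∀ a b, scaledError Ψ ghat a b x
            = scaledError Ψ g a b x + (kd a b * φ x + r a b x) := h1.self_of_nhds
        have e3 : ∀ m a b, pd m (scaledError Ψ ghat a b) x
            = pd m (fun y => scaledError Ψ g a b y + (kd a b * φ y + r a b y)) x := fun m a b =>
          pd_congr (h1.mono fun y hy => hy a b) m
        simp only [massH, e2, e3]
      have e4 : wronskianForm φ V j x = κ * wronskianForm (θ ∘ Ψ.toHomeo.symm) V j x := by
        rw [wronskianForm, wronskianForm, hφ, pd_const_mul _ d3]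
        ring
      rw [e1, massH_add d1 (fun i j => (d5 i j).fun_add (d2 i j)), massH_add d5 d2, massH_kd d4, e4]
      ring
    have cmass : ∀ {h : Fin n → Fin n → AHMass.Euc n → ℝ} {s : AHMass.Euc n → ℝ},
        (∀ i j, Decay s (h i j)) → ∀ᶠ x in ballEnd n, ∀ j, ContinuousAt (massH h V j) x := by
      intro h s hh
      filter_upwards [eventually_all.2 fun i => eventually_all.2 fun j => (hh i j).smooth,
        eventually_rho_pos n] with x h1 h2 j
      exact (contDiffAt_massH hP h2.ne' h1 j).continuousAt
    have cw : ∀ᶠ x in ballEnd n, ∀ j, ContinuousAt (fun x => κ * ((n : ℝ) - 1)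
        * wronskianForm (θ ∘ Ψ.toHomeo.symm) V j x) x := by
      filter_upwards [(decay_of_memWeightedHolder hk hθ).smooth, eventually_rho_pos n]
        with x h1 h2 j
      have h3 := hP.smooth x h2.ne'
      exact continuousAt_const.mul ((h1.continuousAt.mul (differentiableAt_pd h3 j).continuousAt).sub
        (h3.continuousAt.mul (differentiableAt_pd h1 j).continuousAt))
    -- For small `ε` this is an exact identity of fluxes, so the limit of the right side is obtained
    -- from the three known limits on the left, the last of which is zero.
    have hflux : ∀ᶠ ε in 𝓝[>] (0 : ℝ), (κ * ((n : ℝ) - 1))⁻¹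
        * (sphereFlux (massH (scaledError Ψ ghat) V) ε - sphereFlux (massH (scaledError Ψ g) V) ε
          - sphereFlux (massH r V) ε) = sphereFlux (wronskianForm (θ ∘ Ψ.toHomeo.symm) V) ε := by
      filter_upwards [sphereFlux_congr hform, sphereFlux_add (cmass dg)
        (η' := fun j x => κ * ((n : ℝ) - 1) * wronskianForm (θ ∘ Ψ.toHomeo.symm) V j x
          + massH r V j x)
        ((cw.and (cmass dr)).mono fun x hx j => (hx.1 j).add (hx.2 j)), sphereFlux_add cw (cmass dr)] with ε h1 h2 h3
      rw [h1, h2, h3, sphereFlux_const_mul, inv_mul_eq_iff_eq_mul₀ hc]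
      ring
    have := (((hL₂.sub hL₁).sub hr0).const_mul (κ * ((n : ℝ) - 1))⁻¹).congr' hflux
    simpa using this
  · have e1 : massFunctional Ψ g V = _ := m₁.limUnder_eq
    have e2 : massFunctional Ψ ghat V = _ := m₂.limUnder_eq
    rw [e1, e2]
    have hn1 : (n : ℝ) - 1 ≠ 0 := by linarith
    -- Splitting the inverses first keeps `ω_{n-1}⁻¹` as a common factor, so that only `κ ≠ 0` and
    -- `n ≠ 1` are needed for the cancellation.
    rw [mul_inv, mul_inv, mul_inv, div_eq_mul_inv, mul_inv]
    field_simp
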